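/- **STAR model and variational posterior.** For each $n$ let $X_n\in\mathbb R^{n\times p}$ ($p$ fixed) be a design matrix with rows $x_i^\top$ and centered columns. A model $k$ is a set of $p_k$ of the $p$ regressors; $X_k$ denotes the corresponding columns and $x_{i,k}^\top$ their rows. In the STAR model $k$ with parameters $\theta=(\alpha,\beta,\sigma^2)$, $\sigma^2>0$, the latent $z_i\sim\mathcal N(\alpha+x_{i,k}^\top\beta,\sigma^2)$ are independent and the observed counts are $y_i=\lfloor e^{z_i}\rfloor$, $i=1,\dots,n$; thus $p(y_i\mid z_i)=\mathbb 1\{z_i\in[a_i,b_i)\}$, with $[a_i,b_i)=[\log y_i,\log(y_i+1))$ for $y_i>0$ and $(-\infty,0)$ for $y_i=0$. The prior is $p(\alpha,\sigma^2)=1/\sigma^2$ and $\beta\mid\sigma^2\sim\mathcal N(0,g\sigma^2(X_k^\top X_k)^{-1})$ with $g=n$. The mean-field variational posterior $q(z)q(\theta)$ has $q(\theta)=\mathcal N(\alpha;\mu_\alpha,\omega_\alpha)\,\mathcal N(\beta;\mu_\beta,\Omega_\beta)\,\mathcal{IG}(\sigma^2;a,b)$ and $q(z)=\prod_i q(z_i)$,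 where $q(z_i)$ is $\mathcal N(\mu_i,b/a)$, $\mu_i=\mu_\alpha+x_{i,k}^\top\mu_\beta$, truncated to $[a_i,b_i)$. With $m_i$, $s_i$ the mean and variance of $q(z_i)$, it is a fixed point of the coordinate ascent (CAVI) updates $$\mu_\alpha=\tfrac1n\sum_i m_i,\quad \omega_\alpha=\tfrac{b}{na},\quad \mu_\beta=\tfrac{g}{1+g}(X_k^\top X_k)^{-1}X_k^\top m,\quad \Omega_\beta=\tfrac{g}{1+g}\tfrac ba (X_k^\top X_k)^{-1},\quad a=\tfrac{n+p_k}2,$$ $$b=\tfrac12\Big[\sum_i(m_i-\mu_i)^2+\sum_i s_i+n\omega_\alpha+\tfrac1g\mu_\beta^\top X_k^\top X_k\mu_\beta+(1+\tfrac1g)\operatorname{tr}(X_k^\top X_k\Omega_\beta)\Big]>0 .$$ Put $\hat z=\mathbb E_q[z]$, $\hat\theta=\mathbb E_q[\theta]$, $$p_{\mathrm{VBC}}(y)=\frac{p(y\mid\hat z)\,p(\hat z\mid\hat\theta)\,p(\hat\theta)}{q(\hat z)\,q(\hat\theta)},\qquad \mathrm{VBC}=-2\log p_{\mathrm{VBC}}(y).$$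 **Assumptions.** $X_n^\top X_n/n$ converges to a positive definite matrix and $\frac1n\sum_{i,j}x_{ij}^4$ is bounded. The data are generated by the STAR model with fixed true parameters $(\alpha^*,\beta^*,\sigma^{2*})$, $\sigma^{2*}>0$, $k^*=\{j:\beta^*_j\ne0\}$, and $k^*$ belongs to the collection $\mathcal M$ of candidate models. With probability tending to one, the fitted variational posteriors $q_k$, $k\in\mathcal M$, are CAVI fixed points. For every $k\in\mathcal M$, $q_k(\theta)$ contracts at the rate $1/\sqrt n$ around a fixed model-specific true value $\theta^*_k$ with positive variance component (for all $\varepsilon>0$ there is $M$ with $\Pr\{q_k(\|\theta-\theta_k^*\|>M/\sqrt n)>\varepsilon\}\le\varepsilon$ for all large $n$), where $\theta_k^*=(\alpha^*,\beta^*_k,\sigma^{2*})$ whenever $k\supseteq k^*$. **Conclusions.** 1. For all $\theta$ with $\sigma^2>0$, with $\mu_i=\alpha+x_{i,k}^\top\beta$: $p(y\mid\theta)=\int p(y\mid z)p(z\mid\theta)\,dz=\prod_{i}\big[\Phi\big(\tfrac{b_i-\mu_i}{\sigma}\big)-\Phi\big(\tfrac{a_i-\mu_i}{\sigma}\big)\big]$.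 2. The condition $p(y\mid\hat z)\,p(\hat z\mid\hat\theta)/q(\hat z)=p(y\mid\hat\theta)$ holds asymptotically, in the following sense. At every CAVI fixed point it holds exactly when $\hat\theta$ is replaced by $(\mu_\alpha,\mu_\beta,b/a)$. Moreover $\hat\alpha=\mu_\alpha$ and $\hat\beta=\mu_\beta$ for all large $n$, $\hat\sigma^2/(b/a)\to1$ as $n\to\infty$, and at $\hat\theta$ the logarithms of the two sides differ by $\mathcal O(1)$; all this uniformly over models, data and fixed points. 3. For every $k\in\mathcal M$, $\log p_{\mathrm{VBC}}(y\mid k)=\log p(y\mid\hat\theta_k)-\frac{p_k+2}2\log n+\mathcal O_P(1)$, the BIC form. 4. Model selection based on the VBC is consistent: $\Pr\{\mathrm{VBC}_{k^*}<\mathrm{VBC}_k\text{ for all }k\in\mathcal M,\ k\ne k^*\}\to1$ as $n\to\infty$. -/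

import Mathlib

open MeasureTheory ProbabilityTheory Filter Topology Matrix

noncomputable section

namespace STAR

/-! ### Densities and distributions -/

/-- The standard normal distribution function `Φ`. -/
def Phi (x : ℝ) : ℝ := (gaussianReal 0 1).real (Set.Iic x)

/-- Density of the normal law with mean `μ` and variance `s`. -/
def normalPDF (μ s x : ℝ) : ℝ := gaussianPDFReal μ s.toNNReal x

/-- Density of the multivariate normal law with mean `μ` and (positive definite) covariance
matrix `V`. -/
def mvNormalPDF {ι : Type} [Fintype ι] [DecidableEq ι] (μ : EuclideanSpace ℝ ι)
    (V : Matrix ι ι ℝ) (x : EuclideanSpace ℝ ι) : ℝ :=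
  (Real.sqrt ((2 * Real.pi) ^ Fintype.card ι * V.det))⁻¹ *
    Real.exp (-((fun j => x j - μ j) ⬝ᵥ (V⁻¹ *ᵥ fun j => x j - μ j)) / 2)

/-- Density of the inverse gamma law with shape `a` and scale `b`. -/
def invGammaPDF (a b x : ℝ) : ℝ :=
  if 0 < x then b ^ a / Real.Gamma a * x ^ (-a - 1) * Real.exp (-b / x) else 0

/-- The inverse gamma law with shape `a` and scale `b`. -/
def invGammaMeasure (a b : ℝ) : Measure ℝ :=
  volume.withDensity fun x => ENNReal.ofReal (invGammaPDF a b x)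

/-- Density of the normal law with mean `μ` and variance `s`, truncated to the set `I`. -/
def truncNormalPDF (μ s : ℝ) (I : Set ℝ) (x : ℝ) : ℝ :=
  I.indicator (fun x => normalPDF μ s x / ∫ u in I, normalPDF μ s u) x

/-! ### The STAR model: `y i = ⌊exp (z i)⌋` with `z` a Gaussian linear regression -/

/-- Regression parameters `(α, β, σ²)`. -/
abbrev Param (ι : Type) : Type := ℝ × EuclideanSpace ℝ ι × ℝ

/-- The latent interval of a count: `(-∞, 0)` for the count `0`, and
`[log m, log (m + 1))` for a count `m > 0`. -/
def latentInterval (m : ℕ) : Set ℝ :=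
  if m = 0 then Set.Iio 0 else Set.Ico (Real.log m) (Real.log (m + 1))

/-- The latent interval is the set of latent values that produce the count. -/
theorem mem_latentInterval_iff (m : ℕ) (z : ℝ) :
    z ∈ latentInterval m ↔ ⌊Real.exp z⌋₊ = m := by
  unfold latentInterval
  split_ifs with h
  · subst h
    rw [Nat.floor_eq_zero, Set.mem_Iio, Real.exp_lt_one_iff]
  · have hm : (0 : ℝ) < m := by exact_mod_cast Nat.pos_of_ne_zero h
    rw [Nat.floor_eq_iff (Real.exp_pos z).le, Set.mem_Ico, Real.log_le_iff_le_exp hm,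
      Real.lt_log_iff_exp_lt (by linarith)]

section SingleModel

variable {n : ℕ} {ι : Type} [Fintype ι] [DecidableEq ι]

/-- The linear predictor `α + xᵢᵀ β`. -/
def linPred (X : Matrix (Fin n) ι ℝ) (α : ℝ) (β : EuclideanSpace ℝ ι) (i : Fin n) : ℝ :=
  α + ∑ j, X i j * β j

/-- The law of the count vector under the STAR model with parameters `(α, β, σ²)`:
the `z i` are independent `N(α + xᵢᵀ β, σ²)` and `y i = ⌊exp (z i)⌋`. -/
def dataLaw (X : Matrix (Fin n) ι ℝ) (θ : Param ι) : Measure (Fin n → ℕ) :=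
  Measure.pi fun i =>
    (gaussianReal (linPred X θ.1 θ.2.1 i) θ.2.2.toNNReal).map fun z => ⌊Real.exp z⌋₊

/-- `p(y | z)`. -/
def obsGivenLatent (y : Fin n → ℕ) (z : Fin n → ℝ) : ℝ :=
  ∏ i, if ⌊Real.exp (z i)⌋₊ = y i then 1 else 0

/-- `p(z | θ)`. -/
def latentDensity (X : Matrix (Fin n) ι ℝ) (θ : Param ι) (z : Fin n → ℝ) : ℝ :=
  ∏ i, normalPDF (linPred X θ.1 θ.2.1 i) θ.2.2 (z i)

/-- The observed data likelihood `p(y | θ) = ∫ p(y | z) p(z | θ) dz`. -/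
def likelihood (X : Matrix (Fin n) ι ℝ) (y : Fin n → ℕ) (θ : Param ι) : ℝ :=
  ∫ z : Fin n → ℝ, obsGivenLatent y z * latentDensity X θ z

/-- The product of interval probabilities `∏ᵢ [Φ((bᵢ - μᵢ)/σ) - Φ((aᵢ - μᵢ)/σ)]`, where
`aᵢ`, `bᵢ` are the end points of the latent interval of `y i`; for `y i = 0` one has
`aᵢ = -∞`, whose term vanishes, and `bᵢ = log (0 + 1) = 0`. -/
def intervalLikelihood (X : Matrix (Fin n) ι ℝ) (y : Fin n → ℕ) (θ : Param ι) : ℝ :=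
  ∏ i, (Phi ((Real.log (y i + 1) - linPred X θ.1 θ.2.1 i) / Real.sqrt θ.2.2) -
    if y i = 0 then 0
    else Phi ((Real.log (y i) - linPred X θ.1 θ.2.1 i) / Real.sqrt θ.2.2))

/-- The prior density `p(α, β, σ²) = 1 · N(β; 0, g σ² (XᵀX)⁻¹) · 1/σ²`
(flat in `α`, Jeffreys in `σ²`, `g`-prior on `β`). -/
def priorDensity (X : Matrix (Fin n) ι ℝ) (g : ℝ) (θ : Param ι) : ℝ :=
  1 * mvNormalPDF 0 ((g * θ.2.2) • (Xᵀ * X)⁻¹) θ.2.1 * (1 / θ.2.2)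

/-! ### The mean-field variational posterior -/

/-- The parameters of `q(α) = N(μα, ωα)`, `q(β) = N(μβ, Ωβ)`, `q(σ²) = IG(a, b)`. -/
structure VarParams (ι : Type) where
  μα : ℝ
  ωα : ℝ
  μβ : EuclideanSpace ℝ ι
  Ωβ : Matrix ι ι ℝ
  a : ℝ
  b : ℝ

/-- The density of the factor `q(z i)`: the normal law with mean `μα + xᵢᵀ μβ` and variance
`ξ = b / a`, truncated to the latent interval of `y i`. -/
def qzPDF (X : Matrix (Fin n) ι ℝ) (y : Fin n → ℕ) (v : VarParams ι) (i : Fin n) : ℝ → ℝ :=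
  truncNormalPDF (linPred X v.μα v.μβ i) (v.b / v.a) (latentInterval (y i))

/-- `q(z) = ∏ᵢ q(zᵢ)`. -/
def qz (X : Matrix (Fin n) ι ℝ) (y : Fin n → ℕ) (v : VarParams ι) (z : Fin n → ℝ) : ℝ :=
  ∏ i, qzPDF X y v i (z i)

/-- `m i`, the mean of `q(z i)`; the vector of these is the point estimate of `z`. -/
def zHat (X : Matrix (Fin n) ι ℝ) (y : Fin n → ℕ) (v : VarParams ι) (i : Fin n) : ℝ :=
  ∫ z, z * qzPDF X y v i z

/-- `s i`, the variance of `q(z i)`. -/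
def zVar (X : Matrix (Fin n) ι ℝ) (y : Fin n → ℕ) (v : VarParams ι) (i : Fin n) : ℝ :=
  ∫ z, (z - zHat X y v i) ^ 2 * qzPDF X y v i z

/-- The density of `q(θ) = q(α) q(β) q(σ²)`. -/
def qTheta (v : VarParams ι) (θ : Param ι) : ℝ :=
  normalPDF v.μα v.ωα θ.1 * mvNormalPDF v.μβ v.Ωβ θ.2.1 * invGammaPDF v.a v.b θ.2.2

/-- The distribution `q(θ) = q(α) q(β) q(σ²)`. -/
def qThetaMeasure (v : VarParams ι) : Measure (Param ι) :=
  (gaussianReal v.μα v.ωα.toNNReal).prod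
    ((multivariateGaussian v.μβ v.Ωβ).prod (invGammaMeasure v.a v.b))

/-- The point estimate of `θ`: the expectation of `θ` under `q(θ)`. -/
def thetaHat (v : VarParams ι) : Param ι := ∫ θ, θ ∂(qThetaMeasure v)

/-- `v` is a fixed point of the coordinate ascent (CAVI) updates, i.e. the factors `q(z)` (given
by `v` as in `qz`), `q(α)`, `q(β)`, `q(σ²)` are all unchanged by their updates. -/
structure IsCAVIFixedPoint (X : Matrix (Fin n) ι ℝ) (g : ℝ) (y : Fin n → ℕ)
    (v : VarParams ι) : Prop where
  b_pos : 0 < v.b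
  μα_eq : v.μα = (∑ i, zHat X y v i) / n
  ωα_eq : v.ωα = v.b / (n * v.a)
  μβ_eq : v.μβ = WithLp.toLp 2 ((g / (1 + g)) • ((Xᵀ * X)⁻¹ *ᵥ (Xᵀ *ᵥ zHat X y v)))
  Ωβ_eq : v.Ωβ = (g / (1 + g) * (v.b / v.a)) • (Xᵀ * X)⁻¹
  a_eq : v.a = ((n : ℝ) + Fintype.card ι) / 2
  b_eq : v.b = (∑ i, (zHat X y v i - linPred X v.μα v.μβ i) ^ 2 + ∑ i, zVar X y v i
      + n * v.ωα + 1 / g * (v.μβ.ofLp ⬝ᵥ ((Xᵀ * X) *ᵥ v.μβ.ofLp))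
      + (1 + 1 / g) * (Xᵀ * X * v.Ωβ).trace) / 2

/-! ### The variational Bayes criterion -/

/-- `p(y | ẑ) p(ẑ | θ) / q(ẑ)`. -/
def latentRatio (X : Matrix (Fin n) ι ℝ) (y : Fin n → ℕ) (v : VarParams ι) (θ : Param ι) : ℝ :=
  obsGivenLatent y (zHat X y v) * latentDensity X θ (zHat X y v) / qz X y v (zHat X y v)

/-- `p_VBC(y) = p(y | ẑ) p(ẑ | θ̂) p(θ̂) / (q(ẑ) q(θ̂))`. -/
def pVBC (X : Matrix (Fin n) ι ℝ) (g : ℝ) (y : Fin n → ℕ) (v : VarParams ι) : ℝ :=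
  obsGivenLatent y (zHat X y v) * latentDensity X (thetaHat v) (zHat X y v) *
    priorDensity X g (thetaHat v) / (qz X y v (zHat X y v) * qTheta v (thetaHat v))

/-- `VBC = -2 log p_VBC(y)`. -/
def VBC (X : Matrix (Fin n) ι ℝ) (g : ℝ) (y : Fin n → ℕ) (v : VarParams ι) : ℝ :=
  -2 * Real.log (pVBC X g y v)

end SingleModel

/-- The columns of the design matrix that belong to the model `k`. -/
def subDesign {n p : ℕ} (X : Matrix (Fin n) (Fin p) ℝ) (k : Finset (Fin p)) :
    Matrix (Fin n) k ℝ :=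
  X.submatrix id Subtype.val

/-! ### Stochastic order notions, for a sequence of probability spaces -/

/-- `W n = O_P(1)`. -/
def IsBoundedInProb {Ω : ℕ → Type} [∀ n, MeasurableSpace (Ω n)] (P : ∀ n, Measure (Ω n))
    (W : ∀ n, Ω n → ℝ) : Prop :=
  ∀ ε > 0, ∃ M : ℝ, ∀ᶠ n in atTop, (P n).real {ω | M < |W n ω|} ≤ ε

/-- The random distributions `Q n ω` contract around `θ₀` at the rate `1/√n`. -/
def ContractsAtRootN {Ω : ℕ → Type} [∀ n, MeasurableSpace (Ω n)] (P : ∀ n, Measure (Ω n))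
    {E : Type} [NormedAddCommGroup E] [MeasurableSpace E] (Q : ∀ n, Ω n → Measure E)
    (θ₀ : E) : Prop :=
  ∀ ε > 0, ∃ M : ℝ, ∀ᶠ n : ℕ in atTop,
    (P n).real {ω | ε < (Q n ω).real {θ | M / Real.sqrt n < ‖θ - θ₀‖}} ≤ ε

end STAR

end

open STAR

/-!
The count `y i` is the index of the cell of `ℝ` containing the latent variable `z i`, so by
Fubini the likelihood is the product of the normal probabilities of the cells
(`likelihood_eq_prod`, `likelihood_eq_intervalLikelihood`).

*The latent ratio.* At a fixed point, `q(z)` is the latent law at `(μα, μβ, b / a)` restricted to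
the cells and normalized by the likelihood at that parameter, so the ratio of the complete-data
density to `q(z)` is exactly the likelihood there (`latentRatio_eq_likelihood`). The mean of
`q(θ)` is `(μα, μβ, b / (a - 1))` (`thetaHat_eq`), which differs only by a factor `1 + O(1 / n)`
in the variance. Such a change of scale moves the log of a cell probability by `O(1 / n)` times
one plus the squared standardized residual at the truncated mean
(`sqrt_mul_cellProb_le`, `cellProb_div_le`), and the fixed point equation for `b` bounds the sum
of these squares by a multiple of `n`. The total is a universal constant
(`abs_log_latentRatio_sub_le`).

*The BIC form.* In the ratio of the prior to `q(θ)` at the point estimate the determinants of the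
Gram matrix cancel, and Stirling's formula for the inverse gamma normalization leaves the power of
`n` (`abs_log_pVBC_sub_le`). What remains is bounded as long as the point estimate stays in a
compact set of parameters, and it is even `√n`-consistent: `q(θ)` is symmetric in `(α, β)` about
its mean, so mass near `θ₀` forces the mean near `θ₀`, and Chebyshev's inequality does the same
for the inverse gamma component (`thetaHat_close`, `isRootNConsistent_thetaHat`).

*Consistency.* Two comparisons of the likelihoods at the point estimates suffice.

- If `k ⊇ kstar`, then `log p(y ∣ θ̂ₖ) - log p(y ∣ θ*)` is bounded above in probability
  (`isBoundedInProb_log_likelihood_ratio`), and for `k = kstar` also below. In the natural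
  parameters `(α / σ², β / σ², 1 / σ²)` the log-likelihood is a difference of two convex
  log-partition functions, and the one subtracted is explicit. Linearizing it at the truth makes
  the difference convex (`convexOn_convexifiedLogLik`), at a bounded cost on a cube of side of
  order `1 / √n` (`exists_convexifiedLogLik_bound`). There the log-likelihood is therefore
  controlled by its values at the finitely many vertices (`exists_log_likelihood_vertex_bound`),
  and at each of them Markov's inequality for the likelihood ratio, which has mean one, gives the
  bound (`dataLaw_log_likelihood_ratio_le`). The lower bound uses convexity again: the value at
  the center is at most the average of those at a point and at its reflection. The difference of
  at least `½ log n` between the penalties then decides.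
- If `k ⊉ kstar`, the fitted means stay away from the true ones in quadratic mean, by positive
  definiteness of the limiting Gram matrix, and the fourth moments keep a positive proportion of
  the observations at bounded predictors. The Hellinger affinity between the two laws of the data
  is thus exponentially small (`exists_exponential_separation`), the log-likelihood at `θₖ*` falls
  short of that at `θ*` by a multiple of `n`, and so does the one at `θ̂ₖ`
  (`exists_log_likelihood_deficit`), which exceeds every penalty.
-/

noncomputable section

namespace STAR

/-! ### Latent intervals and cell probabilities -/

theorem measurableSet_latentInterval (m : ℕ) : MeasurableSet (latentInterval m) := by
  unfold latentInterval; split_ifs <;> measurability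

theorem convex_latentInterval (m : ℕ) : Convex ℝ (latentInterval m) := by
  unfold latentInterval
  split_ifs
  · exact convex_Iio 0
  · exact convex_Ico _ _

theorem log_lt_log_add_one {m : ℕ} (h : m ≠ 0) : Real.log m < Real.log (m + 1) :=
  Real.log_lt_log (by exact_mod_cast Nat.pos_of_ne_zero h) (by linarith)

theorem volume_latentInterval_ne_zero (m : ℕ) : volume (latentInterval m) ≠ 0 := by
  unfold latentInterval
  split_ifs with h
  · simp
  · simpa using log_lt_log_add_one h

theorem normalPDF_eq {s : ℝ} (hs : 0 < s) (μ x : ℝ) :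
    normalPDF μ s x = (Real.sqrt (2 * Real.pi * s))⁻¹ * Real.exp (-(x - μ) ^ 2 / (2 * s)) := by
  simp [normalPDF, gaussianPDFReal_def, Real.coe_toNNReal _ hs.le]

theorem normalPDF_pos {s : ℝ} (hs : 0 < s) (μ x : ℝ) : 0 < normalPDF μ s x :=
  gaussianPDFReal_pos _ _ _ (by simpa using hs)

theorem normalPDF_nonneg (μ s x : ℝ) : 0 ≤ normalPDF μ s x := gaussianPDFReal_nonneg _ _ _

theorem integrable_normalPDF (μ s : ℝ) : Integrable (normalPDF μ s) :=
  integrable_gaussianPDFReal _ _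

/-- The probability of the count `m` when the latent variable is normal with mean `μ` and
variance `s`. -/
def cellProb (m : ℕ) (μ s : ℝ) : ℝ := ∫ u in latentInterval m, normalPDF μ s u

theorem cellProb_pos (m : ℕ) (μ : ℝ) {s : ℝ} (hs : 0 < s) : 0 < cellProb m μ s := by
  rw [cellProb, setIntegral_pos_iff_support_of_nonneg_ae
    (Eventually.of_forall fun x => normalPDF_nonneg _ _ _) (integrable_normalPDF _ _).integrableOn]
  have : Function.support (normalPDF μ s) = Set.univ := by
    ext x; simpa using (normalPDF_pos hs μ x).ne'
  rw [this, Set.univ_inter]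
  exact pos_iff_ne_zero.2 (volume_latentInterval_ne_zero m)

theorem ofReal_cellProb (m : ℕ) (μ : ℝ) {s : ℝ} (hs : 0 < s) :
    ENNReal.ofReal (cellProb m μ s) = gaussianReal μ s.toNNReal (latentInterval m) := by
  rw [gaussianReal_apply_eq_integral _ (by simpa using hs)]; rfl

theorem cellProb_eq_measureReal (m : ℕ) (μ : ℝ) {s : ℝ} (hs : 0 < s) :
    cellProb m μ s = (gaussianReal μ s.toNNReal).real (latentInterval m) := by
  rw [measureReal_def, ← ofReal_cellProb m μ hs, ENNReal.toReal_ofReal (cellProb_pos m μ hs).le]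

theorem gaussianReal_real_Iic (μ : ℝ) {s : ℝ} (hs : 0 < s) (x : ℝ) :
    (gaussianReal μ s.toNNReal).real (Set.Iic x) = Phi ((x - μ) / Real.sqrt s) := by
  have h1 : gaussianReal μ s.toNNReal
      = (gaussianReal 0 1).map (fun u => μ + Real.sqrt s * u) := by
    have := gaussianReal_map_const_mul (μ := 0) (v := 1) (Real.sqrt s)
    have h2 : (fun u => μ + Real.sqrt s * u) = (fun x => μ + x) ∘ (fun u => Real.sqrt s * u) := rfl
    rw [h2, ← Measure.map_map (by fun_prop) (by fun_prop), this, gaussianReal_map_const_add]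
    congr 1
    · simp
    · ext; simp [Real.sq_sqrt hs.le, hs.le]
  have hsq : 0 < Real.sqrt s := Real.sqrt_pos.2 hs
  rw [h1, map_measureReal_apply (by fun_prop) measurableSet_Iic, Phi]
  congr 1
  ext u
  simp only [Set.mem_preimage, Set.mem_Iic]
  rw [le_div_iff₀ hsq]
  constructor <;> intro h <;> linarith

theorem Phi_sub_Phi {x y : ℝ} (h : x ≤ y) : Phi y - Phi x = (gaussianReal 0 1).real (Set.Ioc x y) := by
  have := measureReal_union (μ := gaussianReal 0 1) (s₁ := Set.Iic x) (s₂ := Set.Ioc x y)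
    (Set.disjoint_left.2 fun u hu hu' => not_lt.2 hu hu'.1) measurableSet_Ioc
  rw [Set.Iic_union_Ioc_eq_Iic h] at this
  rw [Phi, Phi, this]; ring

theorem Phi_strictMono : StrictMono Phi := by
  intro x y h
  have h1 := Phi_sub_Phi h.le
  have h2 : 0 < (gaussianReal 0 1).real (Set.Ioc x y) := by
    rw [measureReal_def, ENNReal.toReal_pos_iff]
    refine ⟨pos_iff_ne_zero.2 fun h0 => ?_, measure_lt_top _ _⟩
    have := gaussianReal_absolutelyContinuous' 0 one_ne_zero h0
    simp at this
    linarith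
  linarith

theorem continuous_Phi : Continuous Phi := by
  have h : ∀ x, Phi x = ∫ u in Set.Iic x, gaussianPDFReal 0 1 u := by
    intro x
    rw [Phi, measureReal_def, gaussianReal_apply_eq_integral _ one_ne_zero, ENNReal.toReal_ofReal]
    exact integral_nonneg fun _ => gaussianPDFReal_nonneg _ _ _
  have hint : Integrable (gaussianPDFReal 0 1) := integrable_gaussianPDFReal 0 1
  have h2 : Phi = fun x => Phi 0 + ∫ u in (0 : ℝ)..x, gaussianPDFReal 0 1 u := by
    ext x
    rw [h, h, ← intervalIntegral.integral_Iic_sub_Iic hint.integrableOn hint.integrableOn]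
    ring
  rw [h2]
  exact continuous_const.add
    (intervalIntegral.continuous_primitive (fun _ _ => hint.intervalIntegrable) 0)

theorem cellProb_eq_Phi (m : ℕ) (μ : ℝ) {s : ℝ} (hs : 0 < s) :
    cellProb m μ s = Phi ((Real.log (m + 1) - μ) / Real.sqrt s) -
      if m = 0 then 0 else Phi ((Real.log m - μ) / Real.sqrt s) := by
  have hna : NullSingletonClass (gaussianReal μ s.toNNReal) :=
    nullSingletonClass_gaussianReal (by simpa using hs)
  rw [cellProb_eq_measureReal m μ hs]
  unfold latentInterval
  split_ifs with h
  · subst h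
    simp only [Nat.cast_zero, zero_add, Real.log_one, sub_zero]
    rw [measureReal_congr Iio_ae_eq_Iic, gaussianReal_real_Iic μ hs]
  · rw [measureReal_congr Ico_ae_eq_Ioc, ← gaussianReal_real_Iic μ hs, ← gaussianReal_real_Iic μ hs]
    have := measureReal_union (μ := gaussianReal μ s.toNNReal) (s₁ := Set.Iic (Real.log m))
      (s₂ := Set.Ioc (Real.log m) (Real.log (m + 1)))
      (Set.disjoint_left.2 fun u hu hu' => not_lt.2 hu hu'.1) measurableSet_Ioc
    rw [Set.Iic_union_Ioc_eq_Iic (log_lt_log_add_one h).le] at this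
    linarith

section SingleModel

variable {n : ℕ} {ι : Type} [Fintype ι]

theorem likelihood_eq_prod (X : Matrix (Fin n) ι ℝ) (y : Fin n → ℕ) (θ : Param ι) :
    likelihood X y θ = ∏ i, cellProb (y i) (linPred X θ.1 θ.2.1 i) θ.2.2 := by
  unfold likelihood obsGivenLatent latentDensity cellProb
  simp_rw [← Finset.prod_mul_distrib]
  rw [integral_fintype_prod_volume_eq_prod (fun i z => (if ⌊Real.exp z⌋₊ = y i then (1 : ℝ) else 0) *
      normalPDF (linPred X θ.1 θ.2.1 i) θ.2.2 z)]
  refine Finset.prod_congr rfl fun i _ => ?_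
  rw [← integral_indicator (measurableSet_latentInterval _)]
  refine integral_congr_ae (Eventually.of_forall fun z => ?_)
  by_cases h : z ∈ latentInterval (y i)
  · simp [h, (mem_latentInterval_iff _ _).1 h]
  · simp [h, mt (mem_latentInterval_iff _ _).2 h]

theorem likelihood_pos (X : Matrix (Fin n) ι ℝ) (y : Fin n → ℕ) {θ : Param ι} (hθ : 0 < θ.2.2) :
    0 < likelihood X y θ := by
  rw [likelihood_eq_prod]
  exact Finset.prod_pos fun i _ => cellProb_pos _ _ hθ

theorem likelihood_eq_intervalLikelihood (X : Matrix (Fin n) ι ℝ) (y : Fin n → ℕ) {θ : Param ι}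
    (hθ : 0 < θ.2.2) : likelihood X y θ = intervalLikelihood X y θ := by
  rw [likelihood_eq_prod]
  exact Finset.prod_congr rfl fun i _ => cellProb_eq_Phi _ _ hθ

theorem measurable_floor_exp : Measurable fun z : ℝ => ⌊Real.exp z⌋₊ :=
  Nat.measurable_floor.comp Real.measurable_exp

instance (X : Matrix (Fin n) ι ℝ) (θ : Param ι) : IsProbabilityMeasure (dataLaw X θ) := by
  unfold dataLaw
  have : ∀ i, IsProbabilityMeasure
      ((gaussianReal (linPred X θ.1 θ.2.1 i) θ.2.2.toNNReal).map fun z => ⌊Real.exp z⌋₊) :=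
    fun i => Measure.isProbabilityMeasure_map measurable_floor_exp.aemeasurable
  infer_instance

theorem map_floor_singleton (m : ℕ) (μ : ℝ) {s : ℝ} (hs : 0 < s) :
    (gaussianReal μ s.toNNReal).map (fun z => ⌊Real.exp z⌋₊) {m} =
      ENNReal.ofReal (cellProb m μ s) := by
  rw [Measure.map_apply measurable_floor_exp (measurableSet_singleton m), ofReal_cellProb m μ hs]
  congr 1
  ext z
  simp [mem_latentInterval_iff]

theorem dataLaw_singleton (X : Matrix (Fin n) ι ℝ) (y : Fin n → ℕ) {θ : Param ι}
    (hθ : 0 < θ.2.2) : dataLaw X θ {y} = ENNReal.ofReal (likelihood X y θ) := by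
  have : ∀ i, IsProbabilityMeasure
      ((gaussianReal (linPred X θ.1 θ.2.1 i) θ.2.2.toNNReal).map fun z => ⌊Real.exp z⌋₊) :=
    fun i => Measure.isProbabilityMeasure_map measurable_floor_exp.aemeasurable
  rw [dataLaw, Measure.pi_singleton, likelihood_eq_prod,
    ENNReal.ofReal_prod_of_nonneg fun i _ => (cellProb_pos _ _ hθ).le]
  exact Finset.prod_congr rfl fun i _ => map_floor_singleton _ _ hθ

end SingleModel

/-! ### Truncated normal means and rescaled cell probabilities -/

theorem setIntegral_pos_latentInterval {m : ℕ} {f : ℝ → ℝ} (hf : ∀ x ∈ latentInterval m, 0 < f x)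
    (hint : IntegrableOn f (latentInterval m)) : 0 < ∫ x in latentInterval m, f x := by
  rw [setIntegral_pos_iff_support_of_nonneg_ae _ hint]
  · have : latentInterval m ⊆ Function.support f := fun x hx => (hf x hx).ne'
    rw [Set.inter_eq_right.2 this]
    exact pos_iff_ne_zero.2 (volume_latentInterval_ne_zero m)
  · exact (ae_restrict_mem (measurableSet_latentInterval m)).mono fun x hx => (hf x hx).le

theorem integrable_id_mul_normalPDF (μ : ℝ) {s : ℝ} (hs : 0 < s) :
    Integrable fun x => x * normalPDF μ s x := by
  have h : Integrable id (gaussianReal μ s.toNNReal) :=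
    (memLp_id_gaussianReal 1).integrable le_rfl
  rw [gaussianReal_of_var_ne_zero _ (by simpa using hs),
    integrable_withDensity_iff_integrable_smul' (measurable_gaussianPDF _ _)
      (Eventually.of_forall fun _ => gaussianPDF_lt_top)] at h
  refine h.congr (Eventually.of_forall fun x => ?_)
  simp [toReal_gaussianPDF, normalPDF, mul_comm]

/-- The mean of a normal law truncated to a latent interval lies in this interval. -/
theorem integral_truncNormalPDF_mem (m : ℕ) (μ : ℝ) {s : ℝ} (hs : 0 < s) :
    ∫ z, z * truncNormalPDF μ s (latentInterval m) z ∈ latentInterval m := by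
  set I := latentInterval m with hI
  have hZ : 0 < ∫ u in I, normalPDF μ s u := cellProb_pos m μ hs
  set Z := ∫ u in I, normalPDF μ s u with hZdef
  have h1 : ∫ z, z * truncNormalPDF μ s I z = (∫ z in I, z * normalPDF μ s z) / Z := by
    rw [← integral_div, ← integral_indicator (hI ▸ measurableSet_latentInterval m : MeasurableSet I)]
    congr 1
    ext z
    by_cases hz : z ∈ I
    · simp [truncNormalPDF, hz, ← hZdef, mul_div_assoc]
    · simp [truncNormalPDF, hz]
  have i1 : IntegrableOn (fun z => z * normalPDF μ s z) I :=
    (integrable_id_mul_normalPDF μ hs).integrableOn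
  have i2 : ∀ c, IntegrableOn (fun z => c * normalPDF μ s z) I :=
    fun c => ((integrable_normalPDF μ s).const_mul c).integrableOn
  have hup : ∀ u, (∀ z ∈ I, z < u) → ∫ z, z * truncNormalPDF μ s I z < u := by
    intro u hu
    have h2 : 0 < ∫ z in I, (u * normalPDF μ s z - z * normalPDF μ s z) := by
      apply setIntegral_pos_latentInterval
      · intro z hz
        rw [← sub_mul]
        exact mul_pos (by linarith [hu z hz]) (normalPDF_pos hs _ _)
      · exact (i2 u).sub i1
    rw [integral_sub (i2 u) i1, integral_const_mul, ← hZdef] at h2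
    rw [h1, div_lt_iff₀ hZ]
    linarith
  have hlo : ∀ l, (∀ z ∈ I, l ≤ z) → l ≤ ∫ z, z * truncNormalPDF μ s I z := by
    intro l hl
    have h2 : 0 ≤ ∫ z in I, (z * normalPDF μ s z - l * normalPDF μ s z) := by
      apply setIntegral_nonneg (measurableSet_latentInterval m)
      intro z hz
      rw [← sub_mul]
      exact mul_nonneg (by linarith [hl z hz]) (normalPDF_nonneg _ _ _)
    rw [integral_sub i1 (i2 l), integral_const_mul, ← hZdef] at h2
    rw [h1, le_div_iff₀ hZ]
    linarith
  generalize (∫ z, z * truncNormalPDF μ s I z) = M at hup hlo ⊢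
  by_cases h : m = 0
  · simp only [hI, latentInterval, h, if_true] at hup ⊢
    exact hup 0 fun z hz => hz
  · simp only [hI, latentInterval, h, if_false] at hup hlo ⊢
    exact ⟨hlo _ fun z hz => hz.1, hup _ fun z hz => hz.2⟩

theorem normalPDF_div_eq {s c : ℝ} (hs : 0 < s) (hc : 0 < c) (μ x : ℝ) :
    normalPDF μ (s / c) x =
      Real.sqrt c * ((Real.sqrt (2 * Real.pi * s))⁻¹ * Real.exp (-(c * (x - μ) ^ 2) / (2 * s))) := by
  rw [normalPDF_eq (div_pos hs hc), ← mul_assoc]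
  congr 1
  · rw [← mul_div_assoc, Real.sqrt_div (by positivity), inv_div, div_eq_mul_inv]
  · congr 1
    field_simp

/-- Enlarging the variance from `s` to `s / c` decreases a cell probability at most by the
factor `√c`. -/
theorem sqrt_mul_cellProb_le {s c : ℝ} (hs : 0 < s) (hc : 0 < c) (hc1 : c ≤ 1) (m : ℕ) (μ : ℝ) :
    Real.sqrt c * cellProb m μ s ≤ cellProb m μ (s / c) := by
  unfold cellProb
  rw [← integral_const_mul]
  refine integral_mono ((integrable_normalPDF μ s).const_mul _).integrableOn
    (integrable_normalPDF μ _).integrableOn fun x => ?_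
  simp only
  rw [normalPDF_div_eq hs hc, normalPDF_eq hs]
  gcongr
  nlinarith [sq_nonneg (x - μ)]

/-- Enlarging the variance from `s` to `s / c` increases a cell probability at most by a factor
that is governed by the distance of the mean to any point `z` of the latent interval. The
substitution `u ↦ z + c (u - z)` maps the latent interval into itself. -/
theorem cellProb_div_le {s c : ℝ} (hs : 0 < s) (hc : 0 < c) (hc1 : c ≤ 1) {m : ℕ} (μ : ℝ)
    {z : ℝ} (hz : z ∈ latentInterval m) :
    Real.sqrt c * Real.exp (-((1 - c) * (z - μ) ^ 2) / (2 * s)) * cellProb m μ (s / c) ≤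
      cellProb m μ s := by
  set I := latentInterval m with hI
  have hIm : MeasurableSet I := measurableSet_latentInterval m
  set g : ℝ → ℝ := I.indicator (normalPDF μ s) with hg
  have hgint : Integrable g := (integrable_normalPDF μ s).indicator hIm
  have hsub : ∫ v, g (c * v + (1 - c) * z) = c⁻¹ * cellProb m μ s := by
    have := Measure.integral_comp_mul_left (fun v => g (v + (1 - c) * z)) c
    rw [this, integral_add_right_eq_self g, hg, integral_indicator hIm, abs_of_pos (inv_pos.2 hc)]
    rfl
  have hgint2 : Integrable fun v => g (c * v + (1 - c) * z) :=
    (hgint.comp_add_right ((1 - c) * z)).comp_mul_left' hc.ne'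
  have key : Real.exp (-((1 - c) * (z - μ) ^ 2) / (2 * s)) * (Real.sqrt c)⁻¹ * cellProb m μ (s / c)
      ≤ c⁻¹ * cellProb m μ s := by
    rw [← hsub]
    unfold cellProb
    rw [← integral_const_mul, ← integral_indicator hIm]
    refine integral_mono (((integrable_normalPDF μ _).const_mul _).indicator hIm) hgint2 fun v => ?_
    by_cases hv : v ∈ I
    · have hmem : c * v + (1 - c) * z ∈ I :=
        convex_latentInterval m hv hz hc.le (by linarith) (by ring)
      simp only [hg, Set.indicator_of_mem hv, Set.indicator_of_mem hmem]
      rw [normalPDF_div_eq hs hc, normalPDF_eq hs]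
      have hsc : Real.sqrt c ≠ 0 := (Real.sqrt_pos.2 hc).ne'
      have : Real.exp (-((1 - c) * (z - μ) ^ 2) / (2 * s)) * (Real.sqrt c)⁻¹ *
          (Real.sqrt c * ((Real.sqrt (2 * Real.pi * s))⁻¹ *
            Real.exp (-(c * (v - μ) ^ 2) / (2 * s)))) =
          (Real.sqrt (2 * Real.pi * s))⁻¹ *
            Real.exp (-((1 - c) * (z - μ) ^ 2 + c * (v - μ) ^ 2) / (2 * s)) := by
        rw [show -((1 - c) * (z - μ) ^ 2 + c * (v - μ) ^ 2) / (2 * s) =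
          -((1 - c) * (z - μ) ^ 2) / (2 * s) + -(c * (v - μ) ^ 2) / (2 * s) by ring, Real.exp_add]
        field_simp
      rw [this]
      gcongr
      nlinarith [mul_nonneg (mul_nonneg hc.le (sub_nonneg.2 hc1)) (sq_nonneg (v - z))]
    · simp only [Set.indicator_of_notMem hv]
      exact Set.indicator_nonneg (fun x _ => normalPDF_nonneg _ _ _) _
  have hsc := Real.sqrt_pos.2 hc
  have h3 := mul_le_mul_of_nonneg_left key hc.le
  rw [mul_inv_cancel_left₀ hc.ne'] at h3
  refine le_trans (le_of_eq ?_) h3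
  have hcs : c * (Real.sqrt c)⁻¹ = Real.sqrt c := by rw [← div_eq_mul_inv, Real.div_sqrt]
  linear_combination (-(Real.exp (-((1 - c) * (z - μ) ^ 2) / (2 * s)) * cellProb m μ (s / c))) * hcs

/-! ### Fixed points of the coordinate ascent updates -/

section SingleModel

variable {n : ℕ} {ι : Type} [Fintype ι] [DecidableEq ι]

namespace IsCAVIFixedPoint

variable {X : Matrix (Fin n) ι ℝ} {y : Fin n → ℕ} {w : VarParams ι}

theorem n_pos (h : IsCAVIFixedPoint X (n : ℝ) y w) : 0 < n := by
  rcases Nat.eq_zero_or_pos n with rfl | h0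
  · have hb := h.b_eq
    simp at hb
    exact absurd hb h.b_pos.ne'
  · exact h0

theorem a_pos (h : IsCAVIFixedPoint X (n : ℝ) y w) : 0 < w.a := by
  have : (0 : ℝ) < n := by exact_mod_cast h.n_pos
  rw [h.a_eq]; positivity

theorem zHat_mem (h : IsCAVIFixedPoint X (n : ℝ) y w) (i : Fin n) :
    zHat X y w i ∈ latentInterval (y i) :=
  integral_truncNormalPDF_mem _ _ (div_pos h.b_pos h.a_pos)

theorem sum_sq_le (h : IsCAVIFixedPoint X (n : ℝ) y w) :
    ∑ i, (zHat X y w i - linPred X w.μα w.μβ i) ^ 2 ≤ 2 * w.b := by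
  have hn : (0 : ℝ) < n := by exact_mod_cast h.n_pos
  have ha := h.a_pos
  have hb := h.b_pos
  have hξ := div_pos hb ha
  have h1 : 0 ≤ ∑ i, zVar X y w i := by
    refine Finset.sum_nonneg fun i _ => integral_nonneg fun z => mul_nonneg (sq_nonneg _) ?_
    exact Set.indicator_nonneg (fun x _ => div_nonneg (normalPDF_nonneg _ _ _)
      (cellProb_pos (y i) _ hξ).le) _
  have h2 : 0 ≤ n * w.ωα := by rw [h.ωα_eq]; positivity
  have h3 : 0 ≤ 1 / (n : ℝ) * (w.μβ.ofLp ⬝ᵥ ((Xᵀ * X) *ᵥ w.μβ.ofLp)) := by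
    refine mul_nonneg (by positivity) ?_
    simpa using (Matrix.posSemidef_conjTranspose_mul_self X).dotProduct_mulVec_nonneg w.μβ.ofLp
  have h4 : 0 ≤ (1 + 1 / (n : ℝ)) * (Xᵀ * X * w.Ωβ).trace := by
    refine mul_nonneg (by positivity) ?_
    rw [h.Ωβ_eq, Matrix.mul_smul, Matrix.trace_smul, smul_eq_mul]
    refine mul_nonneg (by positivity) ?_
    by_cases hu : IsUnit (Xᵀ * X).det
    · rw [Matrix.mul_nonsing_inv _ hu]; simp
    · rw [Matrix.nonsing_inv_apply_not_isUnit _ hu]; simp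
  have := h.b_eq
  linarith

end IsCAVIFixedPoint

theorem obsGivenLatent_zHat {X : Matrix (Fin n) ι ℝ} {y : Fin n → ℕ} {w : VarParams ι}
    (h : IsCAVIFixedPoint X (n : ℝ) y w) : obsGivenLatent y (zHat X y w) = 1 :=
  Finset.prod_eq_one fun i _ => if_pos ((mem_latentInterval_iff _ _).1 (h.zHat_mem i))

theorem latentRatio_eq_prod {X : Matrix (Fin n) ι ℝ} {y : Fin n → ℕ} {w : VarParams ι}
    (h : IsCAVIFixedPoint X (n : ℝ) y w) (θ : Param ι) :
    latentRatio X y w θ = ∏ i, normalPDF (linPred X θ.1 θ.2.1 i) θ.2.2 (zHat X y w i) /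
      normalPDF (linPred X w.μα w.μβ i) (w.b / w.a) (zHat X y w i) *
        cellProb (y i) (linPred X w.μα w.μβ i) (w.b / w.a) := by
  have hξ := div_pos h.b_pos h.a_pos
  rw [latentRatio, obsGivenLatent_zHat h, one_mul, latentDensity, qz, ← Finset.prod_div_distrib]
  refine Finset.prod_congr rfl fun i _ => ?_
  rw [qzPDF, truncNormalPDF, Set.indicator_of_mem (h.zHat_mem i)]
  change _ / (_ / cellProb _ _ _) = _
  rw [div_div_eq_mul_div, div_mul_eq_mul_div]

theorem latentRatio_eq_likelihood {X : Matrix (Fin n) ι ℝ} {y : Fin n → ℕ} {w : VarParams ι}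
    (h : IsCAVIFixedPoint X (n : ℝ) y w) :
    latentRatio X y w (w.μα, w.μβ, w.b / w.a) = likelihood X y (w.μα, w.μβ, w.b / w.a) := by
  have hξ := div_pos h.b_pos h.a_pos
  rw [latentRatio_eq_prod h, likelihood_eq_prod]
  refine Finset.prod_congr rfl fun i _ => ?_
  rw [div_self (normalPDF_pos hξ _ _).ne', one_mul]

theorem latentRatio_pos {X : Matrix (Fin n) ι ℝ} {y : Fin n → ℕ} {w : VarParams ι}
    (h : IsCAVIFixedPoint X (n : ℝ) y w) {θ : Param ι} (hθ : 0 < θ.2.2) :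
    0 < latentRatio X y w θ := by
  have hξ := div_pos h.b_pos h.a_pos
  rw [latentRatio_eq_prod h]
  exact Finset.prod_pos fun i _ => mul_pos
    (div_pos (normalPDF_pos hθ _ _) (normalPDF_pos hξ _ _)) (cellProb_pos _ _ hξ)

/-- Replacing the scale `b / a` by the posterior mean `b / (a - 1)` changes the logarithms of the
latent ratio and of the likelihood by bounded amounts, since the relative change of the scale is
`O(1/n)` and `∑ (ẑᵢ - μᵢ)² ≤ 2 b` at a fixed point. -/
theorem abs_log_latentRatio_sub_le {X : Matrix (Fin n) ι ℝ} {y : Fin n → ℕ} {w : VarParams ι}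
    (h : IsCAVIFixedPoint X (n : ℝ) y w) (ha : 1 < w.a) :
    |Real.log (latentRatio X y w (w.μα, w.μβ, w.b / (w.a - 1))) -
      Real.log (likelihood X y (w.μα, w.μβ, w.b / (w.a - 1)))| ≤ n / (w.a - 1) + 2 := by
  have hb := h.b_pos
  have ha0 := h.a_pos
  set ξ := w.b / w.a with hξdef
  have hξ : 0 < ξ := div_pos hb ha0
  set c := (w.a - 1) / w.a with hcdef
  have hc : 0 < c := div_pos (by linarith) ha0
  have hc1 : c ≤ 1 := by rw [hcdef, div_le_one ha0]; linarith
  have hξ' : w.b / (w.a - 1) = ξ / c := by rw [hξdef, hcdef]; field_simp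
  have hcξ : (1 - c) / ξ = 1 / w.b := by rw [hξdef, hcdef]; field_simp; ring
  have hξc : 0 < ξ / c := div_pos hξ hc
  have hsc := Real.sqrt_pos.2 hc
  set L := -Real.log (Real.sqrt c) with hL
  have hL0 : 0 ≤ L := by
    rw [hL]; have := Real.log_nonpos hsc.le (Real.sqrt_le_one.2 hc1); linarith
  have hLle : 2 * L ≤ 1 / (w.a - 1) := by
    have h1 : 2 * L = Real.log (c⁻¹) := by rw [hL, Real.log_sqrt hc.le, Real.log_inv]; ring
    rw [h1]
    refine (Real.log_le_sub_one_of_pos (inv_pos.2 hc)).trans (le_of_eq ?_)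
    rw [hcdef]; field_simp [(by linarith : w.a - 1 ≠ 0)]; ring
  rw [latentRatio_eq_prod h, likelihood_eq_prod, hξ']
  simp only
  rw [Real.log_prod fun i _ => (mul_pos (div_pos (normalPDF_pos hξc _ _) (normalPDF_pos hξ _ _))
      (cellProb_pos _ _ hξ)).ne', Real.log_prod fun i _ => (cellProb_pos _ _ hξc).ne',
    ← Finset.sum_sub_distrib]
  set d : Fin n → ℝ := fun i => (zHat X y w i - linPred X w.μα w.μβ i) ^ 2 with hd
  have key : ∀ i, |Real.log (normalPDF (linPred X w.μα w.μβ i) (ξ / c) (zHat X y w i) /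
      normalPDF (linPred X w.μα w.μβ i) ξ (zHat X y w i) *
        cellProb (y i) (linPred X w.μα w.μβ i) ξ) -
      Real.log (cellProb (y i) (linPred X w.μα w.μβ i) (ξ / c))| ≤ 2 * L + d i / w.b := by
    intro i
    set μ := linPred X w.μα w.μβ i
    set z := zHat X y w i
    have p1 := cellProb_pos (y i) μ hξ
    have p2 := cellProb_pos (y i) μ hξc
    have hratio : normalPDF μ (ξ / c) z / normalPDF μ ξ z =
        Real.sqrt c * Real.exp (d i / (2 * w.b)) := by
      rw [normalPDF_div_eq hξ hc, normalPDF_eq hξ]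
      have : d i / (2 * w.b) = -(c * (z - μ) ^ 2) / (2 * ξ) - -(z - μ) ^ 2 / (2 * ξ) := by
        have e : d i / (2 * w.b) = (z - μ) ^ 2 / 2 * (1 / w.b) := by simp only [hd]; ring
        rw [e, ← hcξ]; ring
      rw [this, Real.exp_sub]
      have : Real.sqrt (2 * Real.pi * ξ) ≠ 0 := by positivity
      field_simp
    have e1 := sqrt_mul_cellProb_le hξ hc hc1 (y i) μ
    have e2 := cellProb_div_le hξ hc hc1 μ (h.zHat_mem i)
    have l1 := Real.log_le_log (by positivity) e1
    have l2 := Real.log_le_log (by positivity) e2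
    rw [Real.log_mul hsc.ne' p1.ne'] at l1
    rw [Real.log_mul (by positivity) p2.ne', Real.log_mul hsc.ne' (by positivity), Real.log_exp]
      at l2
    have e3 : -((1 - c) * (z - μ) ^ 2) / (2 * ξ) = -(d i / (2 * w.b)) := by
      have e : d i / (2 * w.b) = (z - μ) ^ 2 / 2 * (1 / w.b) := by simp only [hd]; ring
      rw [e, ← hcξ]; ring
    rw [e3] at l2
    rw [hratio, Real.log_mul (by positivity) p1.ne', Real.log_mul hsc.ne' (by positivity),
      Real.log_exp]
    have hdi : 0 ≤ d i / (2 * w.b) := by positivity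
    have hd2 : d i / w.b = 2 * (d i / (2 * w.b)) := by field_simp
    rw [abs_le, hd2]
    constructor <;> linarith
  refine (Finset.abs_sum_le_sum_abs _ _).trans ((Finset.sum_le_sum fun i _ => key i).trans ?_)
  rw [Finset.sum_add_distrib, ← Finset.sum_div, Finset.sum_const, Finset.card_univ,
    Fintype.card_fin, nsmul_eq_mul]
  have h1 : (∑ i, d i) / w.b ≤ 2 := by
    rw [div_le_iff₀ hb]; exact h.sum_sq_le
  have h2 : (n : ℝ) * (2 * L) ≤ n * (1 / (w.a - 1)) :=
    mul_le_mul_of_nonneg_left hLle (Nat.cast_nonneg n)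
  have h3 : (n : ℝ) * (1 / (w.a - 1)) = n / (w.a - 1) := by ring
  linarith

end SingleModel

/-! ### The inverse gamma law and the variational point estimate -/

theorem integral_rpow_mul_exp_neg_div {s b : ℝ} (hs : 0 < s) (hb : 0 < b) :
    ∫ x in Set.Ioi (0 : ℝ), x ^ (-s - 1) * Real.exp (-b / x) = Real.Gamma s / b ^ s := by
  have h := integral_comp_rpow_Ioi (fun t : ℝ => t ^ (s - 1) * Real.exp (-(b * t)))
    (show (-1 : ℝ) ≠ 0 by norm_num)
  rw [Real.integral_rpow_mul_exp_neg_mul_Ioi hs hb] at h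
  rw [show Real.Gamma s / b ^ s = (1 / b) ^ s * Real.Gamma s by
    rw [one_div, Real.inv_rpow hb.le]; ring, ← h]
  refine setIntegral_congr_fun measurableSet_Ioi fun x (hx : 0 < x) => ?_
  simp only [smul_eq_mul, abs_neg, abs_one, one_mul]
  rw [← Real.rpow_mul hx.le, ← mul_assoc, ← Real.rpow_add hx, Real.rpow_neg_one]
  rw [show -b / x = -(b * x⁻¹) by ring]
  congr 2
  ring

theorem measurable_invGammaPDF (a b : ℝ) : Measurable (invGammaPDF a b) := by
  unfold invGammaPDF
  exact Measurable.ite measurableSet_Ioi (by fun_prop) measurable_const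

theorem invGammaPDF_nonneg {a b : ℝ} (ha : 0 < a) (hb : 0 < b) (x : ℝ) : 0 ≤ invGammaPDF a b x := by
  unfold invGammaPDF
  split_ifs
  · have := Real.Gamma_pos_of_pos ha
    positivity
  · exact le_rfl

theorem integral_invGammaPDF_mul_pow {a b : ℝ} (hb : 0 < b) (j : ℕ) (hj : j < a) :
    ∫ x, invGammaPDF a b x * x ^ j = b ^ j * Real.Gamma (a - j) / Real.Gamma a := by
  have ha : 0 < a := lt_of_le_of_lt (Nat.cast_nonneg j) hj
  have h1 : ∀ x, invGammaPDF a b x * x ^ j = (Set.Ioi (0 : ℝ)).indicator (fun x =>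
      b ^ a / Real.Gamma a * (x ^ (-(a - j) - 1) * Real.exp (-b / x))) x := by
    intro x
    by_cases hx : 0 < x
    · rw [invGammaPDF, if_pos hx, Set.indicator_of_mem (Set.mem_Ioi.2 hx)]
      rw [show -(a - j) - 1 = (-a - 1) + (j : ℝ) by ring, Real.rpow_add hx, Real.rpow_natCast]
      ring
    · rw [invGammaPDF, if_neg hx, Set.indicator_of_notMem (by simpa using hx), zero_mul]
  simp_rw [h1]
  rw [integral_indicator measurableSet_Ioi, integral_const_mul,
    integral_rpow_mul_exp_neg_div (by linarith) hb, Real.rpow_sub hb, Real.rpow_natCast]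
  have := Real.Gamma_pos_of_pos ha
  have := Real.rpow_pos_of_pos hb a
  field_simp

theorem integrable_invGammaPDF_mul_pow {a b : ℝ} (hb : 0 < b) (j : ℕ) (hj : j < a) :
    Integrable fun x => invGammaPDF a b x * x ^ j := by
  apply Integrable.of_integral_ne_zero
  rw [integral_invGammaPDF_mul_pow hb j hj]
  have := Real.Gamma_pos_of_pos (lt_of_le_of_lt (Nat.cast_nonneg j) hj)
  have := Real.Gamma_pos_of_pos (sub_pos.2 hj)
  positivity

theorem isProbabilityMeasure_invGammaMeasure {a b : ℝ} (ha : 0 < a) (hb : 0 < b) :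
    IsProbabilityMeasure (invGammaMeasure a b) := by
  constructor
  have h0 : ((0 : ℕ) : ℝ) < a := by simpa using ha
  have h1 := integral_invGammaPDF_mul_pow hb 0 h0
  have h2 := integrable_invGammaPDF_mul_pow hb 0 h0
  simp only [pow_zero, mul_one, Nat.cast_zero, sub_zero, one_mul] at h1 h2
  rw [invGammaMeasure, withDensity_apply _ MeasurableSet.univ, Measure.restrict_univ,
    ← ofReal_integral_eq_lintegral_ofReal h2 (Eventually.of_forall (invGammaPDF_nonneg ha hb)), h1,
    div_self (Real.Gamma_pos_of_pos ha).ne', ENNReal.ofReal_one]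

theorem integrable_pow_invGammaMeasure {a b : ℝ} (hb : 0 < b) (j : ℕ) (hj : j < a) :
    Integrable (fun x => x ^ j) (invGammaMeasure a b) := by
  have ha : 0 < a := lt_of_le_of_lt (Nat.cast_nonneg j) hj
  rw [invGammaMeasure, integrable_withDensity_iff_integrable_smul'
    (measurable_invGammaPDF a b).ennreal_ofReal (Eventually.of_forall fun _ => ENNReal.ofReal_lt_top)]
  refine (integrable_invGammaPDF_mul_pow hb j hj).congr (Eventually.of_forall fun x => ?_)
  simp [ENNReal.toReal_ofReal (invGammaPDF_nonneg ha hb x)]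

theorem integral_pow_invGammaMeasure {a b : ℝ} (hb : 0 < b) (j : ℕ) (hj : j < a) :
    ∫ x, x ^ j ∂(invGammaMeasure a b) = b ^ j * Real.Gamma (a - j) / Real.Gamma a := by
  have ha : 0 < a := lt_of_le_of_lt (Nat.cast_nonneg j) hj
  rw [invGammaMeasure, integral_withDensity_eq_integral_toReal_smul
    (measurable_invGammaPDF a b).ennreal_ofReal (Eventually.of_forall fun _ => ENNReal.ofReal_lt_top),
    ← integral_invGammaPDF_mul_pow hb j hj]
  congr 1
  ext x
  simp [ENNReal.toReal_ofReal (invGammaPDF_nonneg ha hb x)]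

theorem integral_id_invGammaMeasure {a b : ℝ} (hb : 0 < b) (ha : 1 < a) :
    ∫ x, x ∂(invGammaMeasure a b) = b / (a - 1) := by
  have h := integral_pow_invGammaMeasure hb 1 (a := a) (by simpa using ha)
  simp only [pow_one, Nat.cast_one] at h
  have hG := Real.Gamma_add_one (s := a - 1) (by linarith)
  rw [sub_add_cancel] at hG
  have := Real.Gamma_pos_of_pos (sub_pos.2 ha)
  have h1 : a - 1 ≠ 0 := by linarith
  rw [h, hG]
  field_simp

theorem integral_sub_mean_sq_invGammaMeasure {a b : ℝ} (hb : 0 < b) (ha : 2 < a) :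
    ∫ x, (x - b / (a - 1)) ^ 2 ∂(invGammaMeasure a b) = (b / (a - 1)) ^ 2 / (a - 2) := by
  have hp := isProbabilityMeasure_invGammaMeasure (a := a) (by linarith) hb
  have h := integral_pow_invGammaMeasure hb 2 (a := a) (by simpa using ha)
  have i2 := integrable_pow_invGammaMeasure hb 2 (a := a) (by simpa using ha)
  have i1 := integrable_pow_invGammaMeasure hb 1 (a := a) (by simp; linarith)
  have m1 := integral_id_invGammaMeasure hb (a := a) (by linarith)
  simp only [pow_one, Nat.cast_ofNat] at h i1
  set m := b / (a - 1) with hm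
  have e : ∀ x : ℝ, (x - m) ^ 2 = x ^ 2 - 2 * m * x + m ^ 2 := fun x => by ring
  simp_rw [e]
  rw [integral_add (f := fun x : ℝ => x ^ 2 - 2 * m * x) (i2.sub (i1.const_mul (2 * m)))
      (integrable_const _), integral_sub i2 (i1.const_mul _), integral_const_mul, m1, h]
  have hG := Real.Gamma_add_one (s := a - 1) (by linarith)
  rw [sub_add_cancel] at hG
  have hG2 := Real.Gamma_add_one (s := a - 2) (by linarith)
  rw [show a - 2 + 1 = a - 1 by ring] at hG2
  have := Real.Gamma_pos_of_pos (sub_pos.2 ha)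
  have h1 : a - 1 ≠ 0 := by linarith
  have h2 : a - 2 ≠ 0 := by linarith
  rw [hG, hG2, hm]
  simp
  field_simp
  ring

/-- If the law `ν` is symmetric about `c` and puts at least half of its mass on a ball, then `c`
lies in this ball. -/
theorem norm_sub_le_of_symmetric {E : Type*} [NormedAddCommGroup E] [NormedSpace ℝ E]
    [MeasurableSpace E] [BorelSpace E] (ν : Measure E)
    [IsProbabilityMeasure ν] {c x₀ : E} {r : ℝ} (hsymm : ν.map (fun x => c + c - x) = ν)
    (hν : ν.real {x | r < ‖x - x₀‖} < 1 / 2) : ‖c - x₀‖ ≤ r := by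
  by_contra! hcon
  have hA : MeasurableSet {x : E | r < ‖x - x₀‖} :=
    (isOpen_lt continuous_const (by fun_prop)).measurableSet
  have hm : Measurable fun x : E => c + c - x := (by fun_prop : Continuous _).measurable
  have h1 : ν.real ((fun x => c + c - x) ⁻¹' {x | r < ‖x - x₀‖}) = ν.real {x | r < ‖x - x₀‖} := by
    conv_rhs => rw [← hsymm]
    rw [map_measureReal_apply hm hA]
  have h2 : (Set.univ : Set E) ⊆ {x | r < ‖x - x₀‖} ∪ (fun x => c + c - x) ⁻¹' {x | r < ‖x - x₀‖} := by
    intro x _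
    by_contra hx
    simp only [Set.mem_union, Set.mem_ofPred_eq, Set.mem_preimage, not_or, not_lt] at hx
    have h3 : (2 : ℝ) • (c - x₀) = (x - x₀) + (c + c - x - x₀) := by rw [two_smul]; abel
    have h4 : ‖(2 : ℝ) • (c - x₀)‖ ≤ r + r := by
      rw [h3]; exact (norm_add_le _ _).trans (add_le_add hx.1 hx.2)
    rw [norm_smul] at h4
    norm_num at h4
    linarith
  have h5 := (measureReal_mono (μ := ν) h2).trans (measureReal_union_le _ _)
  rw [h1, probReal_univ] at h5
  linarith

theorem stdGaussian_map_neg {E : Type*} [NormedAddCommGroup E] [InnerProductSpace ℝ E]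
    [FiniteDimensional ℝ E] [MeasurableSpace E] [BorelSpace E] :
    (stdGaussian E).map (fun x => -x) = stdGaussian E :=
  stdGaussian_map (LinearIsometryEquiv.neg ℝ)

section

variable {ι : Type} [Fintype ι] [DecidableEq ι]

theorem multivariateGaussian_map_reflection (μ : EuclideanSpace ℝ ι) (V : Matrix ι ι ℝ) :
    (multivariateGaussian μ V).map (fun x => μ + μ - x) = multivariateGaussian μ V := by
  unfold multivariateGaussian
  rw [Measure.map_map (by fun_prop) (by fun_prop)]
  conv_rhs => rw [← stdGaussian_map_neg]
  rw [Measure.map_map (by fun_prop) (by fun_prop)]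
  congr 1
  ext1 x
  simp only [Function.comp_apply, map_neg]
  abel

theorem gaussianReal_map_reflection (μ : ℝ) (v : NNReal) :
    (gaussianReal μ v).map (fun x => μ + μ - x) = gaussianReal μ v := by
  rw [gaussianReal_map_const_sub]; simp

theorem isProbabilityMeasure_qThetaMeasure {v : VarParams ι} (ha : 0 < v.a) (hb : 0 < v.b) :
    IsProbabilityMeasure (qThetaMeasure v) := by
  have := isProbabilityMeasure_invGammaMeasure ha hb
  unfold qThetaMeasure
  infer_instance

theorem thetaHat_eq {v : VarParams ι} (ha : 1 < v.a) (hb : 0 < v.b) :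
    thetaHat v = (v.μα, v.μβ, v.b / (v.a - 1)) := by
  have hp := isProbabilityMeasure_invGammaMeasure (a := v.a) (by linarith) hb
  have i1 : Integrable (fun x : ℝ => x) (gaussianReal v.μα v.ωα.toNNReal) :=
    IsGaussian.integrable_fun_id
  have i2 : Integrable (fun x => x) (multivariateGaussian v.μβ v.Ωβ) :=
    IsGaussian.integrable_fun_id
  have i3 : Integrable (fun x => x) (invGammaMeasure v.a v.b) := by
    simpa using integrable_pow_invGammaMeasure hb 1 (a := v.a) (by simpa using ha)
  have j2 : Integrable (fun x : EuclideanSpace ℝ ι × ℝ => x.1)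
    ((multivariateGaussian v.μβ v.Ωβ).prod (invGammaMeasure v.a v.b)) := i2.comp_fst _
  have j3 : Integrable (fun x : EuclideanSpace ℝ ι × ℝ => x.2)
    ((multivariateGaussian v.μβ v.Ωβ).prod (invGammaMeasure v.a v.b)) := i3.comp_snd _
  have k1 : Integrable (fun θ : Param ι => θ.1) (qThetaMeasure v) := i1.comp_fst _
  have k2 : Integrable (fun θ : Param ι => θ.2.1) (qThetaMeasure v) := j2.comp_snd _
  have k3 : Integrable (fun θ : Param ι => θ.2.2) (qThetaMeasure v) := j3.comp_snd _
  have e1 : ∫ θ : Param ι, θ.1 ∂(qThetaMeasure v) = v.μα := by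
    rw [qThetaMeasure, integral_fun_fst (fun x : ℝ => x)]; simp
  have e2 : ∫ θ : Param ι, θ.2.1 ∂(qThetaMeasure v) = v.μβ := by
    rw [qThetaMeasure, integral_fun_snd (fun x : EuclideanSpace ℝ ι × ℝ => x.1),
      integral_fun_fst (fun x : EuclideanSpace ℝ ι => x)]; simp
  have e3 : ∫ θ : Param ι, θ.2.2 ∂(qThetaMeasure v) = v.b / (v.a - 1) := by
    rw [qThetaMeasure, integral_fun_snd (fun x : EuclideanSpace ℝ ι × ℝ => x.2),
      integral_fun_snd (fun x : ℝ => x), integral_id_invGammaMeasure hb ha]; simp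
  have h2 : ∫ θ : Param ι, θ.2 ∂(qThetaMeasure v) = (v.μβ, v.b / (v.a - 1)) := by
    rw [← e2, ← e3]; exact integral_pair k2 k3
  rw [thetaHat, ← h2, ← e1]
  exact integral_pair k1 (k2.prodMk k3)

/-- If `q(θ)` puts most of its mass on the ball of radius `r` about `θ₀`, then the location
estimates lie in this ball by symmetry, and the scale estimate is close to it by Chebyshev's
inequality for the inverse gamma law. -/
theorem thetaHat_close {v : VarParams ι} (ha : 18 ≤ v.a) (hb : 0 < v.b) {θ₀ : Param ι} {r : ℝ}
    (hq : (qThetaMeasure v).real {θ | r < ‖θ - θ₀‖} ≤ 1 / 4) :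
    |v.μα - θ₀.1| ≤ r ∧ ‖v.μβ - θ₀.2.1‖ ≤ r ∧
      |v.b / (v.a - 1) - θ₀.2.2| ≤ r + 4 * (θ₀.2.2 + r) / Real.sqrt (v.a - 2) := by
  have hp := isProbabilityMeasure_invGammaMeasure (a := v.a) (by linarith) hb
  have hqp := isProbabilityMeasure_qThetaMeasure (v := v) (by linarith) hb
  have hn1 : ∀ θ : Param ι, |θ.1 - θ₀.1| ≤ ‖θ - θ₀‖ := fun θ => norm_fst_le (θ - θ₀)
  have hn2 : ∀ θ : Param ι, ‖θ.2.1 - θ₀.2.1‖ ≤ ‖θ - θ₀‖ := fun θ =>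
    (norm_fst_le (θ - θ₀).2).trans (norm_snd_le (θ - θ₀))
  have hn3 : ∀ θ : Param ι, |θ.2.2 - θ₀.2.2| ≤ ‖θ - θ₀‖ := fun θ =>
    (norm_snd_le (θ - θ₀).2).trans (norm_snd_le (θ - θ₀))
  have hp1 : MeasurePreserving (fun θ : Param ι => θ.1) (qThetaMeasure v) _ := measurePreserving_fst
  have hp2 : MeasurePreserving (fun θ : Param ι => θ.2.1) (qThetaMeasure v) _ :=
    measurePreserving_fst.comp measurePreserving_snd
  have hp3 : MeasurePreserving (fun θ : Param ι => θ.2.2) (qThetaMeasure v) _ :=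
    measurePreserving_snd.comp measurePreserving_snd
  refine ⟨?_, ?_, ?_⟩
  · refine norm_sub_le_of_symmetric _ (gaussianReal_map_reflection v.μα v.ωα.toNNReal)
      (lt_of_le_of_lt ?_ (by norm_num : (1 / 4 : ℝ) < 1 / 2))
    rw [← hp1.measureReal_preimage
      (isOpen_lt continuous_const (by fun_prop)).measurableSet.nullMeasurableSet]
    exact (measureReal_mono fun θ hθ => lt_of_lt_of_le hθ (hn1 θ)).trans hq
  · refine norm_sub_le_of_symmetric _ (multivariateGaussian_map_reflection v.μβ v.Ωβ)
      (lt_of_le_of_lt ?_ (by norm_num : (1 / 4 : ℝ) < 1 / 2))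
    rw [← hp2.measureReal_preimage
      (isOpen_lt continuous_const (by fun_prop)).measurableSet.nullMeasurableSet]
    exact (measureReal_mono fun θ hθ => lt_of_lt_of_le hθ (hn2 θ)).trans hq
  · set m := v.b / (v.a - 1) with hm
    have hm0 : 0 < m := div_pos hb (by linarith)
    set ν := invGammaMeasure v.a v.b
    have hA : ν.real {x | r < |x - θ₀.2.2|} ≤ 1 / 4 := by
      rw [← hp3.measureReal_preimage
        (isOpen_lt continuous_const (by fun_prop)).measurableSet.nullMeasurableSet]
      exact (measureReal_mono fun θ hθ => lt_of_lt_of_le hθ (hn3 θ)).trans hq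
    have ha2 : 0 < v.a - 2 := by linarith
    have hB : ν.real {x | 4 * m ^ 2 / (v.a - 2) ≤ (x - m) ^ 2} ≤ 1 / 4 := by
      have hint : Integrable (fun x => (x - m) ^ 2) ν := by
        apply Integrable.of_integral_ne_zero
        rw [integral_sub_mean_sq_invGammaMeasure hb (by linarith)]
        positivity
      have := mul_meas_ge_le_integral_of_nonneg (μ := ν)
        (Eventually.of_forall fun x => sq_nonneg (x - m)) hint (4 * m ^ 2 / (v.a - 2))
      rw [integral_sub_mean_sq_invGammaMeasure hb (by linarith)] at this
      rw [show (v.b / (v.a - 1)) ^ 2 / (v.a - 2) = 4 * m ^ 2 / (v.a - 2) * (1 / 4) by ring] at this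
      exact le_of_mul_le_mul_left this (by positivity)
    obtain ⟨x, hx1, hx2⟩ : ∃ x, |x - θ₀.2.2| ≤ r ∧ (x - m) ^ 2 < 4 * m ^ 2 / (v.a - 2) := by
      by_contra! hcon
      have h2 : (Set.univ : Set ℝ) ⊆
          {x | r < |x - θ₀.2.2|} ∪ {x | 4 * m ^ 2 / (v.a - 2) ≤ (x - m) ^ 2} := by
        intro x _
        rcases lt_or_ge r (|x - θ₀.2.2|) with h | h
        · exact Or.inl h
        · exact Or.inr (hcon x h)
      have h5 := (measureReal_mono (μ := ν) h2).trans (measureReal_union_le _ _)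
      rw [probReal_univ] at h5
      linarith
    set t := Real.sqrt (v.a - 2) with ht
    have ht4 : 4 ≤ t := Real.le_sqrt_of_sq_le (by linarith)
    have hx3 : |x - m| ≤ 2 * m / t := by
      apply abs_le_of_sq_le_sq _ (by positivity)
      rw [div_pow, ht, Real.sq_sqrt ha2.le]
      rw [show (2 * m) ^ 2 = 4 * m ^ 2 by ring]
      exact hx2.le
    have hx4 : 2 * m / t ≤ m / 2 := by
      rw [div_le_div_iff₀ (by linarith) (by norm_num)]; nlinarith
    have hm2 : m ≤ 2 * (θ₀.2.2 + r) := by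
      have := abs_le.1 hx1
      have := abs_le.1 hx3
      linarith
    have hx5 : 2 * m / t ≤ 4 * (θ₀.2.2 + r) / t := by
      apply div_le_div_of_nonneg_right _ (by linarith); linarith
    have := abs_le.1 hx1
    have := abs_le.1 hx3
    rw [abs_le]
    constructor <;> linarith

end

/-! ### Stirling's formula for the Gamma function up to a bounded factor -/

theorem exists_abs_log_factorial_sub_le :
    ∃ C, ∀ j : ℕ, j ≠ 0 →
      |Real.log (j.factorial) - ((j + 1 / 2) * Real.log j - j)| ≤ C := by
  have h1 : Tendsto (fun j => Real.log (Stirling.stirlingSeq j)) atTop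
      (𝓝 (Real.log (Real.sqrt Real.pi))) :=
    (Real.continuousAt_log (by positivity)).tendsto.comp Stirling.tendsto_stirlingSeq_sqrt_pi
  obtain ⟨C, hC⟩ := (Metric.isBounded_range_of_tendsto _ h1).exists_norm_le
  refine ⟨C + 1 / 2 * Real.log 2, fun j hj => ?_⟩
  have hj' : (0 : ℝ) < j := by exact_mod_cast Nat.pos_of_ne_zero hj
  have h2 := hC _ ⟨j, rfl⟩
  simp only [Real.norm_eq_abs] at h2
  rw [Stirling.log_stirlingSeq_formula, Real.log_mul (by norm_num) hj'.ne',
    Real.log_div hj'.ne' (Real.exp_pos 1).ne', Real.log_exp] at h2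
  have h3 : 0 ≤ Real.log 2 := Real.log_nonneg (by norm_num)
  rw [abs_le] at h2 ⊢
  constructor <;> linarith

/-- Stirling's approximation of `log Γ`, up to a bounded term: between consecutive integers it
follows from the log-convexity of `Γ`. -/
theorem exists_abs_log_Gamma_sub_le :
    ∃ C, ∀ a : ℝ, 2 ≤ a → |Real.log (Real.Gamma a) - ((a - 1 / 2) * Real.log a - a)| ≤ C := by
  obtain ⟨C, hC⟩ := exists_abs_log_factorial_sub_le
  refine ⟨C + 4, fun a ha => ?_⟩
  -- write `a = j + t` with an integer `j` and `0 < t ≤ 1`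
  obtain ⟨j, hj1, hj2⟩ : ∃ j : ℕ, (j : ℝ) < a + 1 ∧ a ≤ j :=
    ⟨⌈a⌉₊, Nat.ceil_lt_add_one (by linarith), Nat.le_ceil a⟩
  obtain ⟨j, rfl⟩ : ∃ i, j = i + 1 :=
    Nat.exists_eq_succ_of_ne_zero (by rintro rfl; norm_num at hj2; linarith)
  push_cast at hj1 hj2
  have hj0 : j ≠ 0 := by rintro rfl; norm_num at hj2; linarith
  have hjp : (1 : ℝ) ≤ j := by exact_mod_cast Nat.one_le_iff_ne_zero.2 hj0
  obtain ⟨t, rfl⟩ : ∃ t, a = j + t := ⟨a - j, by ring⟩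
  have ht0 : 0 < t := by linarith
  have ht1 : t ≤ 1 := by linarith
  have hfeq : ∀ {y : ℝ}, 0 < y →
      (Real.log ∘ Real.Gamma) (y + 1) = (Real.log ∘ Real.Gamma) y + Real.log y := by
    intro y hy
    simp only [Function.comp_apply]
    rw [Real.Gamma_add_one hy.ne', Real.log_mul hy.ne' (Real.Gamma_pos_of_pos hy).ne', add_comm]
  have up := Real.BohrMollerup.f_add_nat_le Real.convexOn_log_Gamma hfeq hj0 ht0 ht1
  have lo := Real.BohrMollerup.f_add_nat_ge Real.convexOn_log_Gamma hfeq
    (n := j + 1) (by omega) ht0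
  simp only [Function.comp_apply] at up lo
  push_cast at lo
  rw [add_sub_cancel_right] at lo
  have e1 := hfeq (y := j) (by linarith)
  have e2 := hfeq (y := j + t) (by linarith)
  simp only [Function.comp_apply] at e1 e2
  rw [show (j : ℝ) + 1 + t = j + t + 1 by ring, e2] at lo
  rw [Real.Gamma_nat_eq_factorial] at e1 lo
  have h := abs_le.1 (hC j hj0)
  -- `log (j + t) - log j` lies between `0` and `t / j`
  have l1 : Real.log j ≤ Real.log (j + t) := Real.log_le_log (by linarith) (by linarith)
  have l2 : Real.log (j + t) - Real.log j ≤ t / j := by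
    rw [← Real.log_div (by linarith) (by linarith)]
    refine (Real.log_le_sub_one_of_pos (by positivity)).trans (le_of_eq ?_)
    field_simp; ring
  have l3 : t / j * (j + t) ≤ 2 := by
    rw [div_mul_eq_mul_div, div_le_iff₀ (by linarith)]; nlinarith
  set D := Real.log (j + t) - Real.log j with hD
  have hD0 : 0 ≤ D := by linarith
  have l4 : (j + t) * D ≤ 2 := by nlinarith
  have l5 : D ≤ 1 := l2.trans (by rw [div_le_one (by linarith)]; linarith)
  have l6 : 0 ≤ (j + t) * D := by positivity
  have eL : Real.log (j + t) = Real.log j + D := by rw [hD]; ring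
  rw [eL] at lo ⊢
  rw [abs_le]
  constructor <;> nlinarith

/-! ### The prior and the variational posterior at the point estimate -/

theorem abs_log_invGammaPDF_sub_le {C a b : ℝ} (ha : 2 ≤ a) (hb : 0 < b)
    (hC : |Real.log (Real.Gamma a) - ((a - 1 / 2) * Real.log a - a)| ≤ C) :
    |Real.log (invGammaPDF a b (b / (a - 1))) - 1 / 2 * Real.log a| ≤
      C + 3 + |Real.log (b / (a - 1))| := by
  set m := b / (a - 1) with hm
  have ha1 : 0 < a - 1 := by linarith
  have hm0 : 0 < m := div_pos hb ha1
  have hbm : b = (a - 1) * m := by rw [hm]; field_simp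
  have hG := Real.Gamma_pos_of_pos (show 0 < a by linarith)
  have e : Real.log (invGammaPDF a b m) =
      a * Real.log (a - 1) - Real.log m - Real.log (Real.Gamma a) - (a - 1) := by
    rw [invGammaPDF, if_pos hm0, Real.log_mul (by positivity) (by positivity),
      Real.log_mul (by positivity) (by positivity), Real.log_div (by positivity) (by positivity),
      Real.log_rpow hb, Real.log_rpow hm0, Real.log_exp, hbm, Real.log_mul ha1.ne' hm0.ne']
    have : -((a - 1) * m) / m = -(a - 1) := by field_simp
    rw [this]; ring
  have l1 : Real.log (a - 1) ≤ Real.log a := Real.log_le_log ha1 (by linarith)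
  have l2 : Real.log a - Real.log (a - 1) ≤ 1 / (a - 1) := by
    rw [← Real.log_div (by linarith) ha1.ne']
    refine (Real.log_le_sub_one_of_pos (by positivity)).trans (le_of_eq ?_)
    field_simp; ring
  have l3 : a * (Real.log a - Real.log (a - 1)) ≤ 2 := by
    refine (mul_le_mul_of_nonneg_left l2 (by linarith)).trans ?_
    rw [mul_one_div, div_le_iff₀ ha1]; linarith
  have l4 : 0 ≤ a * (Real.log a - Real.log (a - 1)) := mul_nonneg (by linarith) (by linarith)
  rw [e]
  have h1 := abs_le.1 hC
  have h2 := neg_abs_le (Real.log m)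
  have h3 := le_abs_self (Real.log m)
  rw [abs_le]
  constructor <;> nlinarith

section SingleModel

variable {n : ℕ} {ι : Type} [Fintype ι]

theorem dotProduct_gram_le (X : Matrix (Fin n) ι ℝ) (β : EuclideanSpace ℝ ι) :
    β.ofLp ⬝ᵥ ((Xᵀ * X) *ᵥ β.ofLp) ≤ (∑ i, ∑ j, X i j ^ 2) * ‖β‖ ^ 2 := by
  have e : β.ofLp ⬝ᵥ ((Xᵀ * X) *ᵥ β.ofLp) = ∑ i, (∑ j, X i j * β j) ^ 2 := by
    rw [← Matrix.mulVec_mulVec, Matrix.dotProduct_mulVec, Matrix.vecMul_transpose]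
    simp [dotProduct, Matrix.mulVec, sq]
  rw [e, EuclideanSpace.real_norm_sq_eq, Finset.sum_mul]
  exact Finset.sum_le_sum fun i _ => Finset.sum_mul_sq_le_sq_mul_sq _ _ _

variable [DecidableEq ι]

theorem mvNormalPDF_pos (μ : EuclideanSpace ℝ ι) {V : Matrix ι ι ℝ} (hV : 0 < V.det)
    (x : EuclideanSpace ℝ ι) : 0 < mvNormalPDF μ V x := by
  unfold mvNormalPDF; positivity

theorem log_mvNormalPDF (μ : EuclideanSpace ℝ ι) {V : Matrix ι ι ℝ} (hV : 0 < V.det)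
    (x : EuclideanSpace ℝ ι) :
    Real.log (mvNormalPDF μ V x) =
      -(1 / 2) * (Fintype.card ι * Real.log (2 * Real.pi) + Real.log V.det) -
        (fun j => x j - μ j) ⬝ᵥ (V⁻¹ *ᵥ fun j => x j - μ j) / 2 := by
  unfold mvNormalPDF
  rw [Real.log_mul (by positivity) (Real.exp_pos _).ne', Real.log_inv, Real.log_exp,
    Real.log_sqrt (by positivity), Real.log_mul (by positivity) hV.ne', Real.log_pow]
  ring

/-- The BIC form of `log p_VBC`, with an explicit bounded remainder: the determinants of the prior
and of the posterior covariance cancel up to powers of `n`, which, together with the height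
`≍ √n` of `q(α)` and of `q(σ²)` at the point estimate, give the penalty. -/
theorem abs_log_pVBC_sub_le {X : Matrix (Fin n) ι ℝ} {y : Fin n → ℕ} {w : VarParams ι}
    (h : IsCAVIFixedPoint X (n : ℝ) y w) (ha : 2 ≤ w.a) (hn : Fintype.card ι ≤ n)
    (hdet : 0 < (Xᵀ * X).det) {B R K C : ℝ} (hB : ∑ i, ∑ j, X i j ^ 2 ≤ B * n)
    (hR : ‖w.μβ‖ ≤ R) (hK : |Real.log (w.b / (w.a - 1))| ≤ K)
    (hC : |Real.log (Real.Gamma w.a) - ((w.a - 1 / 2) * Real.log w.a - w.a)| ≤ C) :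
    |Real.log (pVBC X n y w) - (Real.log (likelihood X y (thetaHat w)) -
      ((Fintype.card ι : ℝ) + 2) / 2 * Real.log n)| ≤
      n / (w.a - 1) + C + Fintype.card ι + B * R ^ 2 * Real.exp K + 3 * K + 20 := by
  have hb := h.b_pos
  have hn0 : (0 : ℝ) < n := by exact_mod_cast h.n_pos
  have hn1 : (1 : ℝ) ≤ n := by exact_mod_cast h.n_pos
  have ha1 : 0 < w.a - 1 := by linarith
  have ha0 : 0 < w.a := by linarith
  have h4 := abs_log_latentRatio_sub_le h (by linarith)
  have hIG := abs_log_invGammaPDF_sub_le ha hb hC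
  rw [pVBC, thetaHat_eq (by linarith) hb, priorDensity, qTheta]
  simp only
  set m := w.b / (w.a - 1) with hm
  have hm0 : 0 < m := div_pos hb ha1
  have hξ : 0 < w.b / w.a := div_pos hb ha0
  set k := Fintype.card ι with hk
  -- the determinants
  have hdi : 0 < ((Xᵀ * X)⁻¹).det := by
    rw [Matrix.det_nonsing_inv, Ring.inverse_eq_inv']; exact inv_pos.2 hdet
  have hu : IsUnit (Xᵀ * X).det := hdet.ne'.isUnit
  have hV : ((n * m) • (Xᵀ * X)⁻¹).det = (n * m) ^ k * ((Xᵀ * X)⁻¹).det := Matrix.det_smul _ _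
  have hΩ : w.Ωβ.det = (n / (1 + n) * (w.b / w.a)) ^ k * ((Xᵀ * X)⁻¹).det := by
    rw [h.Ωβ_eq, Matrix.det_smul]
  have hVp : 0 < ((n * m) • (Xᵀ * X)⁻¹).det := by rw [hV]; positivity
  have hΩp : 0 < w.Ωβ.det := by rw [hΩ]; positivity
  have hω : 0 < w.ωα := by rw [h.ωα_eq]; positivity
  have p1 := normalPDF_pos hω w.μα w.μα
  have p2 := mvNormalPDF_pos w.μβ hΩp w.μβ
  have p3 : 0 < invGammaPDF w.a w.b m := by
    rw [invGammaPDF, if_pos hm0]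
    have := Real.Gamma_pos_of_pos ha0
    positivity
  have p4 := mvNormalPDF_pos 0 hVp w.μβ
  have p5 := latentRatio_pos h (θ := (w.μα, w.μβ, m)) hm0
  have eq1 : obsGivenLatent y (zHat X y w) * latentDensity X (w.μα, w.μβ, m) (zHat X y w) *
      (1 * mvNormalPDF 0 ((n * m) • (Xᵀ * X)⁻¹) w.μβ * (1 / m)) /
      (qz X y w (zHat X y w) *
        (normalPDF w.μα w.ωα w.μα * mvNormalPDF w.μβ w.Ωβ w.μβ * invGammaPDF w.a w.b m)) =
      latentRatio X y w (w.μα, w.μβ, m) * (mvNormalPDF 0 ((n * m) • (Xᵀ * X)⁻¹) w.μβ / m) /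
        (normalPDF w.μα w.ωα w.μα * mvNormalPDF w.μβ w.Ωβ w.μβ * invGammaPDF w.a w.b m) := by
    rw [latentRatio, one_mul, mul_one_div, mul_div_mul_comm, mul_div_assoc (_ / qz _ _ _ _)]
  rw [eq1, Real.log_div (by positivity) (by positivity), Real.log_mul (by positivity)
    (by positivity), Real.log_div p4.ne' hm0.ne', Real.log_mul (by positivity) p3.ne',
    Real.log_mul p1.ne' p2.ne', log_mvNormalPDF _ hVp, log_mvNormalPDF _ hΩp, hV, hΩ,
    Real.log_mul (by positivity) hdi.ne', Real.log_mul (by positivity) hdi.ne', Real.log_pow,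
    Real.log_pow, Real.log_mul hn0.ne' hm0.ne', Real.log_mul (by positivity) hξ.ne',
    Real.log_div hn0.ne' (by positivity)]
  have hq0 : (fun j => w.μβ j - w.μβ j) ⬝ᵥ (w.Ωβ⁻¹ *ᵥ fun j => w.μβ j - w.μβ j) = 0 := by
    have : (fun j => w.μβ j - w.μβ j) = 0 := by ext; simp
    rw [this, zero_dotProduct]
  rw [hq0]
  -- the quadratic form of the prior
  set Q := (fun j => w.μβ j - (0 : EuclideanSpace ℝ ι) j) ⬝ᵥ
    (((n * m) • (Xᵀ * X)⁻¹)⁻¹ *ᵥ fun j => w.μβ j - (0 : EuclideanSpace ℝ ι) j) with hQ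
  have hQe : Q = (n * m)⁻¹ * (w.μβ.ofLp ⬝ᵥ ((Xᵀ * X) *ᵥ w.μβ.ofLp)) := by
    have e0 : (fun j => w.μβ j - (0 : EuclideanSpace ℝ ι) j) = w.μβ.ofLp := by ext; simp
    have e1 : ((n * m) • (Xᵀ * X)⁻¹)⁻¹ = (n * m)⁻¹ • (Xᵀ * X) := by
      apply Matrix.inv_eq_right_inv
      rw [Matrix.smul_mul, Matrix.mul_smul, smul_smul, Matrix.nonsing_inv_mul _ hu,
        mul_inv_cancel₀ (by positivity), one_smul]
    rw [hQ, e0, e1, Matrix.smul_mulVec, dotProduct_smul, smul_eq_mul]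
  have hQ0 : 0 ≤ Q := by
    rw [hQe]
    refine mul_nonneg (by positivity) ?_
    simpa using (Matrix.posSemidef_conjTranspose_mul_self X).dotProduct_mulVec_nonneg w.μβ.ofLp
  have hmK : m⁻¹ ≤ Real.exp K := by
    rw [← Real.exp_log (inv_pos.2 hm0), Real.log_inv]
    exact Real.exp_le_exp.2 ((neg_le_abs _).trans hK)
  have hR0 : 0 ≤ R := (norm_nonneg _).trans hR
  have hB0 : 0 ≤ B * n := le_trans (Finset.sum_nonneg fun i _ => Finset.sum_nonneg fun j _ =>
    sq_nonneg _) hB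
  have hB0' : 0 ≤ B := nonneg_of_mul_nonneg_left hB0 hn0
  have hQB : Q ≤ B * R ^ 2 * Real.exp K := by
    have h1 : w.μβ.ofLp ⬝ᵥ ((Xᵀ * X) *ᵥ w.μβ.ofLp) ≤ B * n * R ^ 2 :=
      (dotProduct_gram_le X w.μβ).trans (mul_le_mul hB (by gcongr) (by positivity) hB0)
    calc Q ≤ (n * m)⁻¹ * (B * n * R ^ 2) := by
          rw [hQe]; exact mul_le_mul_of_nonneg_left h1 (by positivity)
      _ = B * R ^ 2 * m⁻¹ := by field_simp
      _ ≤ _ := by gcongr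
  -- the scales
  have s1 : Real.log (w.b / w.a) = Real.log m - (Real.log w.a - Real.log (w.a - 1)) := by
    rw [hm, Real.log_div hb.ne' ha0.ne', Real.log_div hb.ne' ha1.ne']; ring
  have s2 : 0 ≤ Real.log w.a - Real.log (w.a - 1) :=
    sub_nonneg.2 (Real.log_le_log ha1 (by linarith))
  have s3 : Real.log w.a - Real.log (w.a - 1) ≤ 1 := by
    rw [← Real.log_div ha0.ne' ha1.ne']
    refine (Real.log_le_sub_one_of_pos (by positivity)).trans ?_
    rw [tsub_le_iff_right, div_le_iff₀ ha1]; linarith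
  have s4 : 0 ≤ Real.log (1 + n) - Real.log n :=
    sub_nonneg.2 (Real.log_le_log hn0 (by linarith))
  have s5 : Real.log (1 + n) - Real.log n ≤ 1 := by
    rw [← Real.log_div (by positivity) hn0.ne']
    refine (Real.log_le_sub_one_of_pos (by positivity)).trans ?_
    rw [tsub_le_iff_right, div_le_iff₀ hn0]; linarith
  have hkn : (k : ℝ) ≤ n := by exact_mod_cast hn
  have s6 : |Real.log w.a - Real.log n| ≤ 1 := by
    have hl2 : Real.log 2 ≤ 1 := by linarith [Real.log_two_lt_d9]
    rw [h.a_eq, ← hk]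
    have u1 : Real.log (((n : ℝ) + k) / 2) ≤ Real.log n :=
      Real.log_le_log (by positivity) (by linarith)
    have u2 : Real.log (n / 2) ≤ Real.log (((n : ℝ) + k) / 2) :=
      Real.log_le_log (by positivity) (by linarith [(Nat.cast_nonneg k : (0 : ℝ) ≤ k)])
    rw [Real.log_div hn0.ne' (by norm_num)] at u2
    rw [abs_le]; constructor <;> linarith
  have s7 : Real.log (normalPDF w.μα w.ωα w.μα) =
      1 / 2 * Real.log n - 1 / 2 * Real.log (2 * Real.pi) - 1 / 2 * Real.log (w.b / w.a) := by
    rw [normalPDF_eq hω]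
    have : w.ωα = w.b / w.a / n := by rw [h.ωα_eq]; field_simp
    simp only [sub_self, ne_eq, OfNat.ofNat_ne_zero, not_false_eq_true, zero_pow, neg_zero,
      zero_div, Real.exp_zero, mul_one]
    rw [Real.log_inv, Real.log_sqrt (by positivity), Real.log_mul (by positivity) hω.ne', this,
      Real.log_div hξ.ne' hn0.ne']
    ring
  have s8 : 0 ≤ Real.log (2 * Real.pi) := Real.log_nonneg (by linarith [Real.pi_gt_three])
  have s9 : Real.log (2 * Real.pi) ≤ 7 :=
    (Real.log_le_sub_one_of_pos (by positivity)).trans (by linarith [Real.pi_lt_four])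
  rw [s7, s1]
  have a1 := abs_le.1 h4
  have a2 := abs_le.1 hIG
  have a3 := abs_le.1 hK
  have a4 := abs_le.1 s6
  set D := Real.log w.a - Real.log (w.a - 1) with hD
  set E := Real.log (1 + n) - Real.log n with hE
  have e2 : Real.log n - Real.log (1 + n) = -E := by rw [hE]; ring
  rw [e2]
  have hk0 : (0 : ℝ) ≤ k := Nat.cast_nonneg k
  have b1 : 0 ≤ k * (D + E) := by positivity
  have b2 : k * (D + E) ≤ k * 2 := by gcongr; linarith
  set A := Real.log (latentRatio X y w (w.μα, w.μβ, m)) -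
    Real.log (likelihood X y (w.μα, w.μβ, m)) with hA
  set F := Real.log (invGammaPDF w.a w.b m) - 1 / 2 * Real.log w.a with hF
  rw [abs_le]
  have eA : Real.log (latentRatio X y w (w.μα, w.μβ, m)) =
    A + Real.log (likelihood X y (w.μα, w.μβ, m)) := by rw [hA]; ring
  have eF : Real.log (invGammaPDF w.a w.b m) = F + 1 / 2 * Real.log w.a := by rw [hF]; ring
  rw [eA, eF]
  constructor <;> linarith
end SingleModel

/-! ### Convexity of the log-likelihood in the natural parameters -/

/-- The log-partition function of the normal exponential family with natural parameters
`q = (μ / σ², 1 / σ²)`, restricted to the latent interval of the count `m`. -/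
def logCellPartition (m : ℕ) (q : ℝ × ℝ) : ℝ :=
  Real.log (∫ u in latentInterval m, Real.exp (q.1 * u - q.2 * u ^ 2 / 2))

theorem exp_natural_eq {t τ : ℝ} (hτ : 0 < τ) (u : ℝ) :
    Real.exp (t * u - τ * u ^ 2 / 2) =
      Real.sqrt (2 * Real.pi * τ⁻¹) * Real.exp (t ^ 2 / (2 * τ)) * normalPDF (t / τ) τ⁻¹ u := by
  rw [normalPDF_eq (inv_pos.2 hτ)]
  have : Real.sqrt (2 * Real.pi * τ⁻¹) ≠ 0 := by positivity
  have e : t * u - τ * u ^ 2 / 2 = t ^ 2 / (2 * τ) + -(u - t / τ) ^ 2 / (2 * τ⁻¹) := by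
    field_simp; ring
  rw [e, Real.exp_add]
  field_simp

theorem integrable_exp_natural (t : ℝ) {τ : ℝ} (hτ : 0 < τ) :
    Integrable fun u => Real.exp (t * u - τ * u ^ 2 / 2) := by
  simp_rw [exp_natural_eq hτ]
  exact (integrable_normalPDF _ _).const_mul _

theorem integral_exp_natural_pos (m : ℕ) (t : ℝ) {τ : ℝ} (hτ : 0 < τ) :
    0 < ∫ u in latentInterval m, Real.exp (t * u - τ * u ^ 2 / 2) :=
  setIntegral_pos_latentInterval (fun _ _ => Real.exp_pos _) (integrable_exp_natural t hτ).integrableOn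

theorem log_cellProb_eq (m : ℕ) (t : ℝ) {τ : ℝ} (hτ : 0 < τ) :
    Real.log (cellProb m (t / τ) τ⁻¹) =
      logCellPartition m (t, τ) -
        (t ^ 2 / (2 * τ) - 1 / 2 * Real.log τ + 1 / 2 * Real.log (2 * Real.pi)) := by
  have hc := cellProb_pos m (t / τ) (inv_pos.2 hτ)
  have h : logCellPartition m (t, τ) = Real.log (Real.sqrt (2 * Real.pi * τ⁻¹) *
      Real.exp (t ^ 2 / (2 * τ)) * cellProb m (t / τ) τ⁻¹) := by
    unfold logCellPartition cellProb
    simp only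
    simp_rw [exp_natural_eq hτ]
    rw [integral_const_mul]
  rw [h, Real.log_mul (by positivity) hc.ne', Real.log_mul (by positivity) (Real.exp_pos _).ne',
    Real.log_exp, Real.log_sqrt (by positivity), Real.log_mul (by positivity) (by positivity),
    Real.log_inv]
  ring

/-- Log-partition functions are convex in the natural parameters (Hölder's inequality). -/
theorem convexOn_logCellPartition (m : ℕ) :
    ConvexOn ℝ {q : ℝ × ℝ | 0 < q.2} (logCellPartition m) := by
  refine ⟨convex_halfSpace_gt (LinearMap.snd ℝ ℝ ℝ).isLinear 0, ?_⟩
  rintro ⟨t₁, τ₁⟩ (h₁ : 0 < τ₁) ⟨t₂, τ₂⟩ (h₂ : 0 < τ₂) a b ha hb hab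
  have h₃ : 0 < a * τ₁ + b * τ₂ := by
    have := Convex.min_le_combo τ₁ τ₂ ha hb hab
    exact lt_of_lt_of_le (lt_min h₁ h₂) this
  have p₁ := integral_exp_natural_pos m t₁ h₁
  have p₂ := integral_exp_natural_pos m t₂ h₂
  have p₃ := integral_exp_natural_pos m (a * t₁ + b * t₂) h₃
  have i₁ := (integrable_exp_natural t₁ h₁).integrableOn (s := latentInterval m)
  have i₂ := (integrable_exp_natural t₂ h₂).integrableOn (s := latentInterval m)
  have i₃ := (integrable_exp_natural (a * t₁ + b * t₂) h₃).integrableOn (s := latentInterval m)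
  simp only [logCellPartition, Prod.smul_mk, Prod.mk_add_mk, smul_eq_mul]
  set Z₁ := ∫ u in latentInterval m, Real.exp (t₁ * u - τ₁ * u ^ 2 / 2) with hZ₁
  set Z₂ := ∫ u in latentInterval m, Real.exp (t₂ * u - τ₂ * u ^ 2 / 2) with hZ₂
  rw [Real.log_le_iff_le_exp p₃]
  -- after normalization by `Z₁` and `Z₂`, integrate the convexity inequality of the exponential
  have key : ∫ u in latentInterval m,
      Real.exp ((a * t₁ + b * t₂) * u - (a * τ₁ + b * τ₂) * u ^ 2 / 2) ≤
      ∫ u in latentInterval m, Real.exp (a * Real.log Z₁ + b * Real.log Z₂) *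
        (a / Z₁ * Real.exp (t₁ * u - τ₁ * u ^ 2 / 2) +
          b / Z₂ * Real.exp (t₂ * u - τ₂ * u ^ 2 / 2)) := by
    refine integral_mono i₃ (((i₁.const_mul _).add (i₂.const_mul _)).const_mul _) fun u => ?_
    have hc := convexOn_exp.2 (Set.mem_univ (t₁ * u - τ₁ * u ^ 2 / 2 - Real.log Z₁))
      (Set.mem_univ (t₂ * u - τ₂ * u ^ 2 / 2 - Real.log Z₂)) ha hb hab
    simp only [smul_eq_mul, Real.exp_sub _ (Real.log _), Real.exp_log p₁, Real.exp_log p₂] at hc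
    have e : (a * t₁ + b * t₂) * u - (a * τ₁ + b * τ₂) * u ^ 2 / 2 =
        (a * Real.log Z₁ + b * Real.log Z₂) + (a * (t₁ * u - τ₁ * u ^ 2 / 2 - Real.log Z₁) +
          b * (t₂ * u - τ₂ * u ^ 2 / 2 - Real.log Z₂)) := by ring
    simp only
    rw [e, Real.exp_add]
    refine mul_le_mul_of_nonneg_left (hc.trans (le_of_eq ?_)) (Real.exp_pos _).le
    ring
  refine key.trans (le_of_eq ?_)
  rw [integral_const_mul, integral_add (i₁.const_mul _) (i₂.const_mul _), integral_const_mul,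
    integral_const_mul, ← hZ₁, ← hZ₂, div_mul_cancel₀ _ p₁.ne', div_mul_cancel₀ _ p₂.ne', hab,
    mul_one]

/-- The Bregman divergence of the normal log-partition function is explicit, nonnegative and
quadratically bounded. -/
theorem bregman_bounds {t t₀ τ τ₀ : ℝ} (hτ₀ : 0 < τ₀) (hτ : τ₀ / 2 ≤ τ) :
    0 ≤ t ^ 2 / (2 * τ) - 1 / 2 * Real.log τ - (t₀ ^ 2 / (2 * τ₀) - 1 / 2 * Real.log τ₀) -
      (t₀ / τ₀ * (t - t₀) - (t₀ ^ 2 / (2 * τ₀ ^ 2) + 1 / (2 * τ₀)) * (τ - τ₀)) ∧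
    t ^ 2 / (2 * τ) - 1 / 2 * Real.log τ - (t₀ ^ 2 / (2 * τ₀) - 1 / 2 * Real.log τ₀) -
      (t₀ / τ₀ * (t - t₀) - (t₀ ^ 2 / (2 * τ₀ ^ 2) + 1 / (2 * τ₀)) * (τ - τ₀)) ≤
      2 / τ₀ * (t - t₀) ^ 2 + (2 * t₀ ^ 2 / τ₀ ^ 3 + 1 / τ₀ ^ 2) * (τ - τ₀) ^ 2 := by
  have hτp : 0 < τ := by linarith
  have e : t ^ 2 / (2 * τ) - 1 / 2 * Real.log τ - (t₀ ^ 2 / (2 * τ₀) - 1 / 2 * Real.log τ₀) -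
      (t₀ / τ₀ * (t - t₀) - (t₀ ^ 2 / (2 * τ₀ ^ 2) + 1 / (2 * τ₀)) * (τ - τ₀)) =
      τ / 2 * (t / τ - t₀ / τ₀) ^ 2 + 1 / 2 * (τ / τ₀ - 1 - Real.log (τ / τ₀)) := by
    rw [Real.log_div hτp.ne' hτ₀.ne']
    field_simp
    ring
  rw [e]
  have l1 : Real.log (τ / τ₀) ≤ τ / τ₀ - 1 := Real.log_le_sub_one_of_pos (by positivity)
  have l2 : -Real.log (τ / τ₀) ≤ τ₀ / τ - 1 := by
    rw [← Real.log_inv, inv_div]; exact Real.log_le_sub_one_of_pos (by positivity)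
  refine ⟨add_nonneg (by positivity) (by linarith), ?_⟩
  have hinv : 1 / τ ≤ 2 / τ₀ := by rw [div_le_div_iff₀ hτp hτ₀]; linarith
  have b1 : τ / 2 * (t / τ - t₀ / τ₀) ^ 2 ≤
      1 / τ * ((t - t₀) ^ 2 + t₀ ^ 2 / τ₀ ^ 2 * (τ - τ₀) ^ 2) := by
    have e1 : τ / 2 * (t / τ - t₀ / τ₀) ^ 2 =
        1 / τ * (((t - t₀) - t₀ / τ₀ * (τ - τ₀)) ^ 2 / 2) := by field_simp; ring
    rw [e1]
    apply mul_le_mul_of_nonneg_left _ (by positivity)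
    have e2 : t₀ ^ 2 / τ₀ ^ 2 * (τ - τ₀) ^ 2 = (t₀ / τ₀ * (τ - τ₀)) ^ 2 := by field_simp
    rw [e2]
    nlinarith [sq_nonneg ((t - t₀) + t₀ / τ₀ * (τ - τ₀))]
  have b2 : 1 / 2 * (τ / τ₀ - 1 - Real.log (τ / τ₀)) ≤ 1 / τ * ((τ - τ₀) ^ 2 / (2 * τ₀)) := by
    have e1 : 1 / τ * ((τ - τ₀) ^ 2 / (2 * τ₀)) = 1 / 2 * (τ / τ₀ - 1 + (τ₀ / τ - 1)) := by
      field_simp; ring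
    rw [e1]; linarith
  have b3 := mul_le_mul_of_nonneg_right hinv
    (show 0 ≤ (t - t₀) ^ 2 + t₀ ^ 2 / τ₀ ^ 2 * (τ - τ₀) ^ 2 by positivity)
  have b4 := mul_le_mul_of_nonneg_right hinv (show 0 ≤ (τ - τ₀) ^ 2 / (2 * τ₀) by positivity)
  have e3 : 2 / τ₀ * ((t - t₀) ^ 2 + t₀ ^ 2 / τ₀ ^ 2 * (τ - τ₀) ^ 2) +
      2 / τ₀ * ((τ - τ₀) ^ 2 / (2 * τ₀)) =
      2 / τ₀ * (t - t₀) ^ 2 + (2 * t₀ ^ 2 / τ₀ ^ 3 + 1 / τ₀ ^ 2) * (τ - τ₀) ^ 2 := by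
    field_simp
    ring
  linarith

/-- Natural parameters `(α / σ², β / σ², 1 / σ²)`. -/
abbrev NatParam (ι : Type) : Type := ℝ × (ι → ℝ) × ℝ

section SingleModel

variable {n : ℕ} {ι : Type}

/-- The parameters `(α, β, σ²)` with given natural parameters. -/
def NatParam.toParam (η : NatParam ι) : Param ι :=
  (η.1 / η.2.2, WithLp.toLp 2 (fun j => η.2.1 j / η.2.2), η.2.2⁻¹)

/-- The natural parameters of `(α, β, σ²)`. -/
def natParam (θ : Param ι) : NatParam ι :=
  (θ.1 / θ.2.2, fun j => θ.2.1 j / θ.2.2, θ.2.2⁻¹)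

theorem toParam_natParam {θ : Param ι} (hθ : 0 < θ.2.2) : (natParam θ).toParam = θ := by
  have h := hθ.ne'
  obtain ⟨α, β, s⟩ := θ
  simp only at h
  refine Prod.ext ?_ (Prod.ext ?_ ?_)
  · simp only [natParam, NatParam.toParam]; field_simp
  · ext j; simp only [natParam, NatParam.toParam]; field_simp
  · simp [natParam, NatParam.toParam]

/-- The vertices of the cube `[-1, 1]^(ι + 2)`. -/
def cubeVertices (ι : Type) : Set (NatParam ι) :=
  {-1, 1} ×ˢ ((Set.univ.pi fun _ => {-1, 1}) ×ˢ {-1, 1})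

theorem abs_le_one_of_mem_cubeVertices {e : NatParam ι} (he : e ∈ cubeVertices ι) :
    |e.1| ≤ 1 ∧ (∀ j, |e.2.1 j| ≤ 1) ∧ |e.2.2| ≤ 1 := by
  have h : ∀ x : ℝ, x ∈ ({-1, 1} : Set ℝ) → |x| ≤ 1 := by
    rintro x (rfl | rfl) <;> simp
  exact ⟨h _ he.1, fun j => h _ (he.2.1 j (Set.mem_univ j)), h _ he.2.2⟩

variable [Fintype ι]

/-- The linear predictor on the natural scale, `μᵢ / σ²`. -/
def natPred (X : Matrix (Fin n) ι ℝ) (η : NatParam ι) (i : Fin n) : ℝ :=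
  η.1 + ∑ j, X i j * η.2.1 j

theorem natPred_add_smul (X : Matrix (Fin n) ι ℝ) (η u : NatParam ι) (a b : ℝ) (i : Fin n) :
    natPred X (a • η + b • u) i = a * natPred X η i + b * natPred X u i := by
  simp only [natPred, Prod.fst_add, Prod.smul_fst, Prod.snd_add, Prod.smul_snd, Pi.add_apply,
    Pi.smul_apply, smul_eq_mul, mul_add, Finset.mul_sum, Finset.sum_add_distrib]
  have h : ∀ (c : ℝ) (f : ι → ℝ), ∑ j, X i j * (c * f j) = ∑ j, c * (X i j * f j) :=
    fun c f => Finset.sum_congr rfl fun j _ => by ring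
  rw [h, h]
  ring

theorem linPred_toParam (X : Matrix (Fin n) ι ℝ) (η : NatParam ι) (i : Fin n) :
    linPred X η.toParam.1 η.toParam.2.1 i = natPred X η i / η.2.2 := by
  simp only [linPred, natPred, NatParam.toParam, add_div, Finset.sum_div, mul_div_assoc]

theorem natPred_sq_le (X : Matrix (Fin n) ι ℝ) (η : NatParam ι) (i : Fin n) :
    natPred X η i ^ 2 ≤ (1 + ∑ j, X i j ^ 2) * (η.1 ^ 2 + ∑ j, η.2.1 j ^ 2) := by
  have h := Finset.sum_mul_sq_le_sq_mul_sq Finset.univ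
    (fun o : Option ι => o.elim 1 (X i)) (fun o : Option ι => o.elim η.1 η.2.1)
  simpa [Fintype.sum_option, natPred] using h

/-- The log-likelihood as a function of the natural parameters. -/
def natLogLik (X : Matrix (Fin n) ι ℝ) (y : Fin n → ℕ) (η : NatParam ι) : ℝ :=
  Real.log (likelihood X y η.toParam)

theorem natLogLik_eq (X : Matrix (Fin n) ι ℝ) (y : Fin n → ℕ) {η : NatParam ι} (hη : 0 < η.2.2) :
    natLogLik X y η = ∑ i, (logCellPartition (y i) (natPred X η i, η.2.2) -
      (natPred X η i ^ 2 / (2 * η.2.2) - 1 / 2 * Real.log η.2.2 +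
        1 / 2 * Real.log (2 * Real.pi))) := by
  rw [natLogLik, likelihood_eq_prod,
    Real.log_prod fun i _ => (cellProb_pos _ _ (show 0 < η.toParam.2.2 from inv_pos.2 hη)).ne']
  refine Finset.sum_congr rfl fun i _ => ?_
  rw [linPred_toParam]
  exact log_cellProb_eq _ _ hη

/-- The log-likelihood, plus the Bregman divergence from `η₀` of the log-partition function of the
latent normal laws, up to an additive constant. The concave part of the log-likelihood is thereby
replaced by its linearization at `η₀`, which leaves a convex function. -/
def convexifiedLogLik (X : Matrix (Fin n) ι ℝ) (y : Fin n → ℕ) (η₀ η : NatParam ι) : ℝ :=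
  ∑ i, (logCellPartition (y i) (natPred X η i, η.2.2) -
    (natPred X η₀ i / η₀.2.2 * natPred X η i -
      (natPred X η₀ i ^ 2 / (2 * η₀.2.2 ^ 2) + 1 / (2 * η₀.2.2)) * η.2.2))

theorem convexOn_convexifiedLogLik (X : Matrix (Fin n) ι ℝ) (y : Fin n → ℕ) (η₀ : NatParam ι) :
    ConvexOn ℝ {η : NatParam ι | 0 < η.2.2} (convexifiedLogLik X y η₀) := by
  refine ⟨?_, ?_⟩
  · exact convex_halfSpace_gt ((LinearMap.snd ℝ (ι → ℝ) ℝ).comp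
      (LinearMap.snd ℝ ℝ ((ι → ℝ) × ℝ))).isLinear 0
  · intro x hx z hz a b ha hb hab
    simp only [convexifiedLogLik, smul_eq_mul, Finset.mul_sum]
    rw [← Finset.sum_add_distrib]
    refine Finset.sum_le_sum fun i _ => ?_
    have h := (convexOn_logCellPartition (y i)).2 (x := (natPred X x i, x.2.2)) hx
      (y := (natPred X z i, z.2.2)) hz ha hb hab
    simp only [Prod.smul_mk, Prod.mk_add_mk, smul_eq_mul] at h
    rw [natPred_add_smul]
    simp only [Prod.snd_add, Prod.smul_snd, smul_eq_mul]
    linarith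

theorem finite_cubeVertices : (cubeVertices ι).Finite :=
  (Set.toFinite _).prod ((Set.Finite.pi fun _ => Set.toFinite _).prod (Set.toFinite _))

theorem mem_convexHull_cubeVertices {u : NatParam ι} (h₁ : |u.1| ≤ 1) (h₂ : ∀ j, |u.2.1 j| ≤ 1)
    (h₃ : |u.2.2| ≤ 1) : u ∈ convexHull ℝ (cubeVertices ι) := by
  have hI : ∀ x : ℝ, |x| ≤ 1 → x ∈ convexHull ℝ ({-1, 1} : Set ℝ) := by
    intro x hx
    rw [convexHull_pair, segment_eq_Icc (by norm_num)]
    exact abs_le.1 hx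
  rw [cubeVertices, convexHull_prod, convexHull_prod, convexHull_pi]
  exact ⟨hI _ h₁, fun j _ => hI _ (h₂ j), hI _ h₃⟩

/-- In a cube of radius `r` about `η₀`, convexification changes the increments of the
log-likelihood by at most a multiple of `n r²`. -/
theorem exists_convexifiedLogLik_bound (η₀ : NatParam ι) (hη₀ : 0 < η₀.2.2) (B : ℝ) :
    ∃ K, ∀ (n : ℕ) (X : Matrix (Fin n) ι ℝ), ∑ i, ∑ j, X i j ^ 2 ≤ B * n →
      ∀ (y : Fin n → ℕ) (r : ℝ), 0 ≤ r → r ≤ η₀.2.2 / 2 →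
      ∀ u : NatParam ι, |u.1| ≤ 1 → (∀ j, |u.2.1 j| ≤ 1) → |u.2.2| ≤ 1 →
        natLogLik X y (η₀ + r • u) - natLogLik X y η₀ ≤
          convexifiedLogLik X y η₀ (η₀ + r • u) - convexifiedLogLik X y η₀ η₀ ∧
        convexifiedLogLik X y η₀ (η₀ + r • u) - convexifiedLogLik X y η₀ η₀ ≤
          natLogLik X y (η₀ + r • u) - natLogLik X y η₀ + K * (n * r ^ 2) := by
  obtain ⟨a₀, b₀, τ₀⟩ := η₀
  simp only at hη₀
  set Q := a₀ ^ 2 + ∑ j, b₀ j ^ 2 with hQ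
  set c := 2 / τ₀ * (1 + Fintype.card ι) + 2 * Q / τ₀ ^ 3 + 1 / τ₀ ^ 2 with hc
  have hQ0 : 0 ≤ Q := add_nonneg (sq_nonneg _) (Finset.sum_nonneg fun _ _ => sq_nonneg _)
  have hc0 : 0 ≤ c := by positivity
  refine ⟨c * (1 + B), fun n X hX y r hr0 hr u hu₁ hu₂ hu₃ => ?_⟩
  simp only at hr
  set η₀ : NatParam ι := (a₀, b₀, τ₀) with hη₀def
  set η := η₀ + r • u with hη
  have hτ : τ₀ / 2 ≤ η.2.2 := by
    have : η.2.2 = τ₀ + r * u.2.2 := rfl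
    rw [this]
    have := abs_le.1 hu₃
    nlinarith
  have hτp : 0 < η.2.2 := by linarith
  have hdiff : convexifiedLogLik X y η₀ η - convexifiedLogLik X y η₀ η₀ -
      (natLogLik X y η - natLogLik X y η₀) =
      ∑ i, (natPred X η i ^ 2 / (2 * η.2.2) - 1 / 2 * Real.log η.2.2 -
        (natPred X η₀ i ^ 2 / (2 * τ₀) - 1 / 2 * Real.log τ₀) -
        (natPred X η₀ i / τ₀ * (natPred X η i - natPred X η₀ i) -
          (natPred X η₀ i ^ 2 / (2 * τ₀ ^ 2) + 1 / (2 * τ₀)) * (η.2.2 - τ₀))) := by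
    rw [natLogLik_eq X y hτp, natLogLik_eq X y (η := η₀) hη₀]
    simp only [convexifiedLogLik, ← Finset.sum_sub_distrib]
    refine Finset.sum_congr rfl fun i _ => ?_
    simp only [hη₀def]
    ring
  have hlow : 0 ≤ convexifiedLogLik X y η₀ η - convexifiedLogLik X y η₀ η₀ -
      (natLogLik X y η - natLogLik X y η₀) := by
    rw [hdiff]
    exact Finset.sum_nonneg fun i _ => (bregman_bounds hη₀ hτ).1
  have hup : convexifiedLogLik X y η₀ η - convexifiedLogLik X y η₀ η₀ -
      (natLogLik X y η - natLogLik X y η₀) ≤ c * (1 + B) * (n * r ^ 2) := by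
    rw [hdiff]
    have hi : ∀ i, 2 / τ₀ * (natPred X η i - natPred X η₀ i) ^ 2 +
        (2 * natPred X η₀ i ^ 2 / τ₀ ^ 3 + 1 / τ₀ ^ 2) * (η.2.2 - τ₀) ^ 2 ≤
        c * r ^ 2 * (1 + ∑ j, X i j ^ 2) := by
      intro i
      have hW : 1 ≤ 1 + ∑ j, X i j ^ 2 := by
        have : 0 ≤ ∑ j, X i j ^ 2 := Finset.sum_nonneg fun _ _ => sq_nonneg _
        linarith
      set W := 1 + ∑ j, X i j ^ 2
      have sq1 : ∀ x : ℝ, |x| ≤ 1 → x ^ 2 ≤ 1 := fun x hx => (sq_le_one_iff_abs_le_one x).2 hx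
      have h1 : natPred X η i - natPred X η₀ i = r * natPred X u i := by
        have := natPred_add_smul X η₀ u 1 r i
        rw [one_smul, one_mul] at this
        rw [hη, this]; ring
      have h2 : natPred X u i ^ 2 ≤ W * (1 + Fintype.card ι) := by
        refine (natPred_sq_le X u i).trans (mul_le_mul_of_nonneg_left ?_ (by linarith))
        have : ∑ j, u.2.1 j ^ 2 ≤ ∑ _j : ι, (1 : ℝ) := Finset.sum_le_sum fun j _ => sq1 _ (hu₂ j)
        simp only [Finset.sum_const, Finset.card_univ, nsmul_eq_mul, mul_one] at this
        linarith [sq1 _ hu₁]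
      have h3 : natPred X η₀ i ^ 2 ≤ W * Q := natPred_sq_le X η₀ i
      have h4 : η.2.2 - τ₀ = r * u.2.2 := by
        have : η.2.2 = τ₀ + r * u.2.2 := rfl
        rw [this]; ring
      have h5 := sq1 _ hu₃
      rw [h1, h4, mul_pow, mul_pow]
      calc 2 / τ₀ * (r ^ 2 * natPred X u i ^ 2) +
            (2 * natPred X η₀ i ^ 2 / τ₀ ^ 3 + 1 / τ₀ ^ 2) * (r ^ 2 * u.2.2 ^ 2)
          ≤ 2 / τ₀ * (r ^ 2 * (W * (1 + Fintype.card ι))) +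
            (2 * (W * Q) / τ₀ ^ 3 + W / τ₀ ^ 2) * (r ^ 2 * 1) := by gcongr
        _ = c * r ^ 2 * W := by rw [hc]; ring
    refine (Finset.sum_le_sum fun i _ => (bregman_bounds hη₀ hτ).2.trans (hi i)).trans ?_
    rw [← Finset.mul_sum, Finset.sum_add_distrib]
    simp only [Finset.sum_const, Finset.card_univ, Fintype.card_fin, nsmul_eq_mul, mul_one]
    calc c * r ^ 2 * (n + ∑ i, ∑ j, X i j ^ 2) ≤ c * r ^ 2 * (n + B * n) := by gcongr
      _ = _ := by ring
  exact ⟨by linarith, by linarith⟩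

/-- In a cube of radius `r` about `η₀`, the increments of the log-likelihood are controlled, from
above and from below, by those at the vertices: a convex function is at most its maximum over the
vertices, and by symmetry about the center it cannot be much smaller than its value there. -/
theorem exists_natLogLik_vertex_bound (η₀ : NatParam ι) (hη₀ : 0 < η₀.2.2) (B : ℝ) :
    ∃ K, ∀ (n : ℕ) (X : Matrix (Fin n) ι ℝ), ∑ i, ∑ j, X i j ^ 2 ≤ B * n →
      ∀ (y : Fin n → ℕ) (r : ℝ), 0 ≤ r → r ≤ η₀.2.2 / 2 →
      ∀ u : NatParam ι, |u.1| ≤ 1 → (∀ j, |u.2.1 j| ≤ 1) → |u.2.2| ≤ 1 →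
        (∃ e ∈ cubeVertices ι, natLogLik X y (η₀ + r • u) - natLogLik X y η₀ ≤
          natLogLik X y (η₀ + r • e) - natLogLik X y η₀ + K * (n * r ^ 2)) ∧
        (∃ e ∈ cubeVertices ι, -(natLogLik X y (η₀ + r • e) - natLogLik X y η₀) -
          K * (n * r ^ 2) ≤ natLogLik X y (η₀ + r • u) - natLogLik X y η₀) := by
  obtain ⟨K, hK⟩ := exists_convexifiedLogLik_bound η₀ hη₀ B
  refine ⟨2 * max K 0, fun n X hX y r hr0 hr => ?_⟩
  have hKK : K * (n * r ^ 2) ≤ max K 0 * (n * r ^ 2) :=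
    mul_le_mul_of_nonneg_right (le_max_left _ _) (by positivity)
  have hK0 : 0 ≤ max K 0 * (n * r ^ 2) := mul_nonneg (le_max_right _ _) (by positivity)
  have hconv : ConvexOn ℝ {u : NatParam ι | 0 < (η₀ + r • u).2.2}
      (fun u => convexifiedLogLik X y η₀ (η₀ + r • u)) := by
    have h := ((convexOn_convexifiedLogLik X y η₀).translate_right η₀).comp_linearMap
      (r • (LinearMap.id : NatParam ι →ₗ[ℝ] NatParam ι))
    exact h
  have hmem : ∀ u : NatParam ι, |u.2.2| ≤ 1 → 0 < (η₀ + r • u).2.2 := by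
    intro u hu
    have : (η₀ + r • u).2.2 = η₀.2.2 + r * u.2.2 := rfl
    rw [this]
    have := abs_le.1 hu
    nlinarith
  have hsub : cubeVertices ι ⊆ {u : NatParam ι | 0 < (η₀ + r • u).2.2} :=
    fun e he => hmem e (abs_le_one_of_mem_cubeVertices he).2.2
  -- the upper bound, for every point of the cube
  have upper : ∀ u : NatParam ι, |u.1| ≤ 1 → (∀ j, |u.2.1 j| ≤ 1) → |u.2.2| ≤ 1 →
      ∃ e ∈ cubeVertices ι, convexifiedLogLik X y η₀ (η₀ + r • u) - convexifiedLogLik X y η₀ η₀ ≤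
        natLogLik X y (η₀ + r • e) - natLogLik X y η₀ + K * (n * r ^ 2) := by
    intro u h₁ h₂ h₃
    obtain ⟨e, he, hle⟩ := hconv.exists_ge_of_mem_convexHull hsub
      (mem_convexHull_cubeVertices h₁ h₂ h₃)
    obtain ⟨g₁, g₂, g₃⟩ := abs_le_one_of_mem_cubeVertices he
    have := (hK n X hX y r hr0 hr e g₁ g₂ g₃).2
    exact ⟨e, he, by linarith⟩
  intro u h₁ h₂ h₃
  have hu := hK n X hX y r hr0 hr u h₁ h₂ h₃
  constructor
  · obtain ⟨e, he, hle⟩ := upper u h₁ h₂ h₃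
    exact ⟨e, he, by linarith⟩
  · obtain ⟨e, he, hle⟩ := upper (-u) (by simpa using h₁) (fun j => by simpa using h₂ j)
      (by simpa using h₃)
    refine ⟨e, he, ?_⟩
    have hmid := hconv.2 (hmem u h₃) (hmem (-u) (by simpa using h₃))
      (by norm_num : (0 : ℝ) ≤ 1 / 2) (by norm_num : (0 : ℝ) ≤ 1 / 2) (by norm_num)
    rw [show (1 / 2 : ℝ) • u + (1 / 2 : ℝ) • -u = 0 by simp] at hmid
    simp only [smul_zero, add_zero, smul_eq_mul] at hmid
    linarith

end SingleModel

/-! ### Likelihood ratios of well-specified models -/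

theorem measure_le_mul_of_singleton {α : Type*} [Countable α] [MeasurableSpace α]
    [MeasurableSingletonClass α] (μ ν : Measure α) (A : Set α) (c : ENNReal)
    (h : ∀ y ∈ A, μ {y} ≤ c * ν {y}) : μ A ≤ c * ν A := by
  have e : ∀ ρ : Measure α, ρ A = ∑' y : A, ρ {(y : α)} := by
    intro ρ
    have := measure_biUnion (μ := ρ) A.to_countable (f := fun y => {y})
      (fun x _ y _ hxy => Set.disjoint_singleton.2 hxy) (fun y _ => measurableSet_singleton y)
    rwa [Set.biUnion_of_singleton] at this
  rw [e μ, e ν, ← ENNReal.tsum_mul_left]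
  exact ENNReal.tsum_le_tsum fun y => h y y.2

section SingleModel

variable {n : ℕ} {ι : Type} [Fintype ι]

/-- Markov's inequality for a likelihood ratio, whose expectation under the truth is one. -/
theorem dataLaw_log_likelihood_ratio_le (X : Matrix (Fin n) ι ℝ) {θ θ₀ : Param ι}
    (hθ : 0 < θ.2.2) (hθ₀ : 0 < θ₀.2.2) (t : ℝ) :
    (dataLaw X θ₀).real {y | t < Real.log (likelihood X y θ) - Real.log (likelihood X y θ₀)} ≤
      Real.exp (-t) := by
  have h := measure_le_mul_of_singleton (dataLaw X θ₀) (dataLaw X θ)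
    {y | t < Real.log (likelihood X y θ) - Real.log (likelihood X y θ₀)}
    (ENNReal.ofReal (Real.exp (-t))) fun y (hy : t < _) => by
      have p := likelihood_pos X y hθ
      have p₀ := likelihood_pos X y hθ₀
      rw [dataLaw_singleton X y hθ, dataLaw_singleton X y hθ₀,
        ← ENNReal.ofReal_mul (Real.exp_pos _).le]
      apply ENNReal.ofReal_le_ofReal
      rw [← Real.log_le_log_iff p₀ (by positivity), Real.log_mul (Real.exp_pos _).ne' p.ne',
        Real.log_exp]
      linarith
  refine ENNReal.toReal_le_of_le_ofReal (Real.exp_pos _).le (h.trans ?_)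
  exact mul_le_of_le_one_right' prob_le_one

end SingleModel

section

variable {ι : Type}

/-- The vertices of the cube of radius `ρ` about `θ₀` on the natural scale. -/
def vertexParam (θ₀ : Param ι) (ρ : ℝ) (e : NatParam ι) : Param ι :=
  (natParam θ₀ + ρ • e).toParam

theorem tendsto_vertexParam {θ₀ : Param ι} (hθ₀ : 0 < θ₀.2.2) (e : NatParam ι) :
    Tendsto (fun ρ => vertexParam θ₀ ρ e) (𝓝 0) (𝓝 θ₀) := by
  have hc : ContinuousAt (fun ρ : ℝ => vertexParam θ₀ ρ e) 0 := by
    have h0 : (natParam θ₀).2.2 + 0 * e.2.2 ≠ 0 := by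
      simp only [natParam, zero_mul, add_zero]; exact (inv_pos.2 hθ₀).ne'
    unfold vertexParam NatParam.toParam
    simp only [Prod.fst_add, Prod.snd_add, Prod.smul_fst, Prod.smul_snd, Pi.add_apply,
      Pi.smul_apply, smul_eq_mul]
    refine ContinuousAt.prodMk ?_ (ContinuousAt.prodMk ?_ ?_)
    · exact ContinuousAt.div (by fun_prop) (by fun_prop) h0
    · refine (PiLp.continuous_toLp 2 _).continuousAt.comp (continuousAt_pi.2 fun j => ?_)
      exact ContinuousAt.div (by fun_prop) (by fun_prop) h0
    · exact ContinuousAt.inv₀ (by fun_prop) h0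
  have h := hc.tendsto
  have e0 : vertexParam θ₀ 0 e = θ₀ := by
    simp [vertexParam, toParam_natParam hθ₀]
  rwa [e0] at h

variable [Fintype ι]

/-- The natural parameters are locally Lipschitz functions of the parameters. -/
theorem exists_natParam_lipschitz (θ₀ : Param ι) (hθ₀ : 0 < θ₀.2.2) :
    ∃ L > 0, ∀ ρ, ρ ≤ θ₀.2.2 / 2 → ∀ θ : Param ι, ‖θ - θ₀‖ ≤ ρ →
      0 < θ.2.2 ∧ |(natParam θ - natParam θ₀).1| ≤ L * ρ ∧
        (∀ j, |(natParam θ - natParam θ₀).2.1 j| ≤ L * ρ) ∧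
        |(natParam θ - natParam θ₀).2.2| ≤ L * ρ := by
  obtain ⟨α₀, β₀, s₀⟩ := θ₀
  simp only at hθ₀
  set N := ‖((α₀, β₀, s₀) : Param ι)‖ with hN
  have hN0 : 0 ≤ N := norm_nonneg _
  set L := 2 / s₀ * (1 + (N + 1) / s₀) with hL
  refine ⟨L, by positivity, fun ρ hρ θ hθ => ?_⟩
  simp only at hρ
  obtain ⟨α, β, s⟩ := θ
  have hα : |α - α₀| ≤ ρ := (norm_fst_le ((α, β, s) - (α₀, β₀, s₀) : Param ι)).trans hθ
  have h2 := (norm_snd_le ((α, β, s) - (α₀, β₀, s₀) : Param ι)).trans hθ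
  have hβ : ‖β - β₀‖ ≤ ρ := (norm_fst_le ((α, β, s) - (α₀, β₀, s₀) : Param ι).2).trans h2
  have hs : |s - s₀| ≤ ρ := (norm_snd_le ((α, β, s) - (α₀, β₀, s₀) : Param ι).2).trans h2
  have hα₀ : |α₀| ≤ N := norm_fst_le ((α₀, β₀, s₀) : Param ι)
  have hβ₀ : ‖β₀‖ ≤ N := (norm_fst_le ((α₀, β₀, s₀) : Param ι).2).trans (norm_snd_le _)
  have hρ0 : 0 ≤ ρ := (abs_nonneg _).trans hα
  have hs2 : s₀ / 2 ≤ s := by have := abs_le.1 hs; linarith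
  have hsp : 0 < s := by linarith
  have hinv : 1 / s ≤ 2 / s₀ := by rw [div_le_div_iff₀ hsp hθ₀]; linarith
  have key : ∀ x x₀ : ℝ, |x - x₀| ≤ ρ → |x₀| ≤ N + 1 → |x / s - x₀ / s₀| ≤ L * ρ := by
    intro x x₀ hx hx₀
    have e : x / s - x₀ / s₀ = 1 / s * ((x - x₀) - x₀ / s₀ * (s - s₀)) := by field_simp; ring
    rw [e, abs_mul, abs_of_pos (by positivity : 0 < 1 / s)]
    have h1 : |(x - x₀) - x₀ / s₀ * (s - s₀)| ≤ ρ + (N + 1) / s₀ * ρ := by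
      refine (abs_sub _ _).trans (add_le_add hx ?_)
      rw [abs_mul, abs_div, abs_of_pos hθ₀]
      gcongr
    calc 1 / s * |(x - x₀) - x₀ / s₀ * (s - s₀)| ≤ 2 / s₀ * (ρ + (N + 1) / s₀ * ρ) := by gcongr
      _ = L * ρ := by rw [hL]; ring
  refine ⟨hsp, key α α₀ hα (by linarith), fun j => ?_, ?_⟩
  · exact key (β j) (β₀ j) ((PiLp.norm_apply_le (β - β₀) j).trans hβ)
      (by linarith [PiLp.norm_apply_le β₀ j, Real.norm_eq_abs (β₀ j)])
  · have := key 1 1 (by simpa using hρ0) (by simpa using hN0)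
    simpa [natParam, one_div] using this

/-- Near `θ₀` the log-likelihood is controlled by its values at the vertices of a cube, uniformly
in the data and the sample size. -/
theorem exists_log_likelihood_vertex_bound (θ₀ : Param ι) (hθ₀ : 0 < θ₀.2.2) (B : ℝ) :
    ∃ L > 0, ∃ K, ∃ δ > 0, ∀ (n : ℕ) (X : Matrix (Fin n) ι ℝ), ∑ i, ∑ j, X i j ^ 2 ≤ B * n →
      ∀ (y : Fin n → ℕ) (ρ : ℝ), 0 < ρ → ρ ≤ δ → ∀ θ : Param ι, ‖θ - θ₀‖ ≤ ρ →
        (∃ e ∈ cubeVertices ι, Real.log (likelihood X y θ) - Real.log (likelihood X y θ₀) ≤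
          Real.log (likelihood X y (vertexParam θ₀ (L * ρ) e)) - Real.log (likelihood X y θ₀) +
            K * (n * ρ ^ 2)) ∧
        (∃ e ∈ cubeVertices ι,
          -(Real.log (likelihood X y (vertexParam θ₀ (L * ρ) e)) -
            Real.log (likelihood X y θ₀)) - K * (n * ρ ^ 2) ≤
          Real.log (likelihood X y θ) - Real.log (likelihood X y θ₀)) := by
  have hη₀ : 0 < (natParam θ₀).2.2 := inv_pos.2 hθ₀
  obtain ⟨L, hL, hlip⟩ := exists_natParam_lipschitz θ₀ hθ₀
  obtain ⟨K, hK⟩ := exists_natLogLik_vertex_bound (natParam θ₀) hη₀ B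
  refine ⟨L, hL, K * L ^ 2, min (θ₀.2.2 / 2) ((natParam θ₀).2.2 / 2 / L), by positivity,
    fun n X hX y ρ hρ0 hρ θ hθ => ?_⟩
  obtain ⟨hs, h₁, h₂, h₃⟩ := hlip ρ (hρ.trans (min_le_left _ _)) θ hθ
  have hLρ : L * ρ ≤ (natParam θ₀).2.2 / 2 := by
    have := hρ.trans (min_le_right _ _)
    rw [le_div_iff₀ hL] at this; linarith
  have hr : 0 < L * ρ := by positivity
  set u : NatParam ι := (L * ρ)⁻¹ • (natParam θ - natParam θ₀) with hu
  have hscale : ∀ x : ℝ, |x| ≤ L * ρ → |(L * ρ)⁻¹ * x| ≤ 1 := by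
    intro x hx
    rw [abs_mul, abs_of_pos (inv_pos.2 hr), inv_mul_le_iff₀ hr]; linarith
  have hθu : natParam θ = natParam θ₀ + (L * ρ) • u := by
    rw [hu, smul_inv_smul₀ hr.ne']; abel
  have hmain := hK n X hX y (L * ρ) hr.le hLρ u (hscale _ h₁) (fun j => hscale _ (h₂ j))
    (hscale _ h₃)
  rw [← hθu] at hmain
  simp only [natLogLik, toParam_natParam hs, toParam_natParam hθ₀] at hmain
  rw [show K * (n * (L * ρ) ^ 2) = K * L ^ 2 * (n * ρ ^ 2) by ring] at hmain
  exact hmain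

end

/-- The estimators `T n` are `√n`-consistent for `θ₀`: `T n - θ₀ = O_P(1/√n)`. -/
def IsRootNConsistent {Ω : ℕ → Type} [∀ n, MeasurableSpace (Ω n)] (P : ∀ n, Measure (Ω n))
    {E : Type} [NormedAddCommGroup E] (T : ∀ n, Ω n → E) (θ₀ : E) : Prop :=
  ∀ ε > 0, ∃ M > 0, ∀ᶠ n : ℕ in atTop, (P n).real {ω | M / Real.sqrt n < ‖T n ω - θ₀‖} ≤ ε

theorem tendsto_const_div_sqrt (M : ℝ) :
    Tendsto (fun n : ℕ => M / Real.sqrt n) atTop (𝓝 0) :=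
  tendsto_const_nhds.div_atTop (Real.tendsto_sqrt_atTop.comp tendsto_natCast_atTop_atTop)

theorem nat_mul_div_sqrt_sq {n : ℕ} (hn : n ≠ 0) (M : ℝ) : n * (M / Real.sqrt n) ^ 2 = M ^ 2 := by
  have : (n : ℝ) ≠ 0 := by exact_mod_cast hn
  rw [div_pow, Real.sq_sqrt (Nat.cast_nonneg n)]
  field_simp

/-- In a well-specified model, the log-likelihood ratio of a `√n`-consistent estimator and the
truth is bounded in probability. -/
theorem isBoundedInProb_log_likelihood_ratio {ι : Type} [Fintype ι]
    (X : ∀ n : ℕ, Matrix (Fin n) ι ℝ) {B : ℝ} (hX : ∀ n, ∑ i, ∑ j, X n i j ^ 2 ≤ B * n)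
    {θ₀ : Param ι} (hθ₀ : 0 < θ₀.2.2) (T : ∀ n, (Fin n → ℕ) → Param ι)
    (hT : IsRootNConsistent (fun n => dataLaw (X n) θ₀) T θ₀) :
    IsBoundedInProb (fun n => dataLaw (X n) θ₀) fun n y =>
      Real.log (likelihood (X n) y (T n y)) - Real.log (likelihood (X n) y θ₀) := by
  intro ε hε
  obtain ⟨M, hM, hTM⟩ := hT (ε / 2) (by positivity)
  obtain ⟨L, hL, K, δ, hδ, hbound⟩ := exists_log_likelihood_vertex_bound θ₀ hθ₀ B
  set V := (finite_cubeVertices (ι := ι)).toFinset with hV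
  -- with this `t` the vertices contribute at most `ε / 2`
  obtain ⟨t, ht⟩ : ∃ t : ℝ, V.card * Real.exp (-t) ≤ ε / 2 := by
    have h1 : Tendsto (fun t : ℝ => V.card * Real.exp (-t)) atTop (𝓝 (V.card * 0)) :=
      (Real.tendsto_exp_neg_atTop_nhds_zero).const_mul _
    rw [mul_zero] at h1
    exact (h1.eventually (Iic_mem_nhds (by positivity : (0 : ℝ) < ε / 2))).exists
  refine ⟨t + K * M ^ 2, ?_⟩
  have hsmall : ∀ᶠ n : ℕ in atTop, M / Real.sqrt n ≤ δ :=
    (tendsto_const_div_sqrt M).eventually (Iic_mem_nhds hδ)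
  have hpos : ∀ e ∈ V, ∀ᶠ n : ℕ in atTop, 0 < (vertexParam θ₀ (L * (M / Real.sqrt n)) e).2.2 := by
    intro e _
    have h0 : Tendsto (fun n : ℕ => L * (M / Real.sqrt n)) atTop (𝓝 0) := by
      simpa using (tendsto_const_div_sqrt M).const_mul L
    have h1 := ((tendsto_vertexParam hθ₀ e).comp h0).snd_nhds.snd_nhds
    exact h1.eventually (lt_mem_nhds hθ₀)
  filter_upwards [hTM, hsmall, (Finset.eventually_all V).2 hpos, eventually_gt_atTop 0]
    with n h1 h2 h3 h4
  have hn : (0 : ℝ) < n := by exact_mod_cast h4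
  have hρ : 0 < M / Real.sqrt n := by positivity
  set μ := dataLaw (X n) θ₀
  have hsub : {y | t + K * M ^ 2 < |Real.log (likelihood (X n) y (T n y)) -
      Real.log (likelihood (X n) y θ₀)|} ⊆ {y | M / Real.sqrt n < ‖T n y - θ₀‖} ∪
      ⋃ e ∈ V, {y | t < Real.log (likelihood (X n) y (vertexParam θ₀ (L * (M / Real.sqrt n)) e)) -
        Real.log (likelihood (X n) y θ₀)} := by
    intro y hy
    by_contra hcon
    simp only [Set.mem_union, Set.mem_ofPred_eq, Set.mem_iUnion, not_or, not_exists, not_lt] at hcon hy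
    obtain ⟨⟨e, he, hup⟩, ⟨e', he', hlo⟩⟩ := hbound n (X n) (hX n) y _ hρ h2 (T n y) hcon.1
    rw [nat_mul_div_sqrt_sq h4.ne'] at hup hlo
    have g1 := hcon.2 e (by simpa [hV] using he)
    have g2 := hcon.2 e' (by simpa [hV] using he')
    refine absurd hy (not_lt.2 (abs_le.2 ⟨?_, ?_⟩)) <;> linarith
  refine (measureReal_mono hsub).trans ((measureReal_union_le _ _).trans ?_)
  have hV2 : μ.real (⋃ e ∈ V, {y | t < Real.log (likelihood (X n) y
      (vertexParam θ₀ (L * (M / Real.sqrt n)) e)) - Real.log (likelihood (X n) y θ₀)}) ≤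
      V.card * Real.exp (-t) := by
    refine (measureReal_biUnion_finset_le _ _).trans ?_
    rw [← nsmul_eq_mul, ← Finset.sum_const]
    exact Finset.sum_le_sum fun e he => dataLaw_log_likelihood_ratio_le _ (h3 e he) hθ₀ t
  linarith

/-! ### Separation from misspecified parameters -/

/-- The Hellinger affinity measure of the laws of a count under two latent normal laws: its mass
at `m` is the geometric mean of the two probabilities of `m`. -/
def affinityMeasure (μ s μ' s' : ℝ) : Measure ℕ :=
  Measure.count.withDensity fun m => ENNReal.ofReal (Real.sqrt (cellProb m μ s * cellProb m μ' s'))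

theorem affinityMeasure_singleton (μ s μ' s' : ℝ) (m : ℕ) :
    affinityMeasure μ s μ' s' {m} =
      ENNReal.ofReal (Real.sqrt (cellProb m μ s * cellProb m μ' s')) := by
  rw [affinityMeasure, withDensity_apply _ (measurableSet_singleton m), lintegral_singleton,
    Measure.count_singleton, mul_one]

/-- The affinity is smaller than one by an amount that is quadratic in the difference of the
probabilities of any count `m₀`. -/
theorem affinityMeasure_univ_le {μ s μ' s' : ℝ} (hs : 0 < s) (hs' : 0 < s') (m₀ : ℕ) :
    affinityMeasure μ s μ' s' Set.univ ≤
      ENNReal.ofReal (Real.exp (-((cellProb m₀ μ s - cellProb m₀ μ' s') ^ 2 / 8))) := by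
  set d := (cellProb m₀ μ s - cellProb m₀ μ' s') ^ 2 / 8 with hd
  set Q := (gaussianReal μ s.toNNReal).map fun z => ⌊Real.exp z⌋₊
  set Q' := (gaussianReal μ' s'.toNNReal).map fun z => ⌊Real.exp z⌋₊
  have : IsProbabilityMeasure Q := Measure.isProbabilityMeasure_map measurable_floor_exp.aemeasurable
  have : IsProbabilityMeasure Q' :=
    Measure.isProbabilityMeasure_map measurable_floor_exp.aemeasurable
  have hd0 : 0 ≤ d := by positivity
  have key : (affinityMeasure μ s μ' s' + ENNReal.ofReal d • Measure.dirac m₀) Set.univ ≤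
      ENNReal.ofReal (1 / 2) * (Q + Q') Set.univ := by
    refine measure_le_mul_of_singleton _ _ _ _ fun m _ => ?_
    have p := cellProb_pos m μ hs
    have p' := cellProb_pos m μ' hs'
    rw [Measure.add_apply, Measure.add_apply, Measure.smul_apply, affinityMeasure_singleton,
      map_floor_singleton m μ hs, map_floor_singleton m μ' hs', ← ENNReal.ofReal_add p.le p'.le,
      ← ENNReal.ofReal_mul (by norm_num), Real.sqrt_mul p.le]
    set x := Real.sqrt (cellProb m μ s) with hx
    set x' := Real.sqrt (cellProb m μ' s') with hx'
    have ex : cellProb m μ s = x ^ 2 := (Real.sq_sqrt p.le).symm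
    have ex' : cellProb m μ' s' = x' ^ 2 := (Real.sq_sqrt p'.le).symm
    by_cases hm : m = m₀
    · have hp1 : cellProb m μ s ≤ 1 := by
        rw [cellProb_eq_measureReal m μ hs]; exact measureReal_le_one
      have hp1' : cellProb m μ' s' ≤ 1 := by
        rw [cellProb_eq_measureReal m μ' hs']; exact measureReal_le_one
      have hx1 : x ≤ 1 := Real.sqrt_le_one.2 hp1
      have hx1' : x' ≤ 1 := Real.sqrt_le_one.2 hp1'
      have hx0 : 0 ≤ x := Real.sqrt_nonneg _
      have hx0' : 0 ≤ x' := Real.sqrt_nonneg _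
      subst hm
      simp only [Measure.dirac_apply_of_mem (Set.mem_singleton m), smul_eq_mul, mul_one]
      rw [← ENNReal.ofReal_add (by positivity) hd0]
      apply ENNReal.ofReal_le_ofReal
      rw [hd, ex, ex']
      have h4 : (x + x') ^ 2 ≤ 4 := by nlinarith
      nlinarith [mul_nonneg (sq_nonneg (x - x')) (sub_nonneg.2 h4)]
    · have : Measure.dirac m₀ {m} = 0 := by
        rw [Measure.dirac_apply' _ (measurableSet_singleton m)]
        simp [Ne.symm hm]
      rw [this, smul_zero, add_zero]
      apply ENNReal.ofReal_le_ofReal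
      rw [ex, ex']
      nlinarith [sq_nonneg (x - x')]
  have h1 : ENNReal.ofReal (1 / 2) * (Q + Q') Set.univ = 1 := by
    rw [Measure.add_apply, measure_univ, measure_univ, one_add_one_eq_two,
      show (2 : ENNReal) = ENNReal.ofReal 2 by simp, ← ENNReal.ofReal_mul (by norm_num)]
    norm_num
  rw [h1, Measure.add_apply, Measure.smul_apply, measure_univ (μ := Measure.dirac m₀), smul_eq_mul,
    mul_one] at key
  calc affinityMeasure μ s μ' s' Set.univ ≤ 1 - ENNReal.ofReal d :=
        ENNReal.le_sub_of_add_le_right ENNReal.ofReal_ne_top key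
    _ = ENNReal.ofReal (1 - d) := by rw [ENNReal.ofReal_sub _ hd0, ENNReal.ofReal_one]
    _ ≤ _ := ENNReal.ofReal_le_ofReal (by linarith [Real.add_one_le_exp (-d)])

/-- A measure of the discrepancy of two laws of a count, based on the counts `0` and `1`. -/
def cellGap (μ s μ' s' : ℝ) : ℝ :=
  ((cellProb 0 μ s - cellProb 0 μ' s') ^ 2 + (cellProb 1 μ s - cellProb 1 μ' s') ^ 2) / 16

theorem cellGap_nonneg (μ s μ' s' : ℝ) : 0 ≤ cellGap μ s μ' s' := by unfold cellGap; positivity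

theorem affinityMeasure_univ_le_exp_cellGap {μ s μ' s' : ℝ} (hs : 0 < s) (hs' : 0 < s') :
    affinityMeasure μ s μ' s' Set.univ ≤ ENNReal.ofReal (Real.exp (-cellGap μ s μ' s')) := by
  set u := (cellProb 0 μ s - cellProb 0 μ' s') ^ 2 with hu
  set u' := (cellProb 1 μ s - cellProb 1 μ' s') ^ 2 with hu'
  have hg : cellGap μ s μ' s' = (u + u') / 16 := rfl
  rcases le_total u u' with h | h
  · refine (affinityMeasure_univ_le hs hs' 1).trans (ENNReal.ofReal_le_ofReal ?_)
    apply Real.exp_le_exp.2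
    rw [hg, ← hu']; linarith
  · refine (affinityMeasure_univ_le hs hs' 0).trans (ENNReal.ofReal_le_ofReal ?_)
    apply Real.exp_le_exp.2
    rw [hg, ← hu]; linarith

theorem cellProb_zero_eq (μ : ℝ) {s : ℝ} (hs : 0 < s) : cellProb 0 μ s = Phi (-μ / Real.sqrt s) := by
  rw [cellProb_eq_Phi 0 μ hs]; simp

theorem cellProb_one_eq (μ : ℝ) {s : ℝ} (hs : 0 < s) :
    cellProb 1 μ s = Phi ((Real.log 2 - μ) / Real.sqrt s) - Phi (-μ / Real.sqrt s) := by
  rw [cellProb_eq_Phi 1 μ hs]; norm_num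

/-- The probabilities of the counts `0` and `1` identify the latent normal law. -/
theorem cellGap_pos {μ s μ' s' : ℝ} (hs : 0 < s) (hs' : 0 < s') (hμ : μ ≠ μ') :
    0 < cellGap μ s μ' s' := by
  refine lt_of_le_of_ne (cellGap_nonneg _ _ _ _) fun h => hμ ?_
  have h0 : cellProb 0 μ s - cellProb 0 μ' s' = 0 := by unfold cellGap at h; nlinarith
  have h1 : cellProb 1 μ s - cellProb 1 μ' s' = 0 := by unfold cellGap at h; nlinarith
  rw [cellProb_zero_eq μ hs, cellProb_zero_eq μ' hs', sub_eq_zero] at h0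
  rw [cellProb_one_eq μ hs, cellProb_one_eq μ' hs', h0] at h1
  have e0 := Phi_strictMono.injective h0
  have e1 := Phi_strictMono.injective (a₁ := (Real.log 2 - μ) / Real.sqrt s)
    (a₂ := (Real.log 2 - μ') / Real.sqrt s') (by linarith)
  have hq := Real.sqrt_pos.2 hs
  have hq' := Real.sqrt_pos.2 hs'
  have hl : Real.log 2 ≠ 0 := (Real.log_pos (by norm_num)).ne'
  rw [sub_div, sub_div] at e1
  have e2 : Real.log 2 / Real.sqrt s = Real.log 2 / Real.sqrt s' := by
    have := neg_div (Real.sqrt s) μ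
    have := neg_div (Real.sqrt s') μ'
    linarith
  have e3 : Real.sqrt s = Real.sqrt s' := by
    rw [div_eq_div_iff hq.ne' hq'.ne'] at e2
    exact (mul_left_cancel₀ hl e2).symm
  rw [e3, div_left_inj' hq'.ne'] at e0
  linarith

theorem continuousOn_cellProb (m : ℕ) :
    ContinuousOn (fun q : ℝ × ℝ => cellProb m q.1 q.2) {q | 0 < q.2} := by
  have h : Set.EqOn (fun q : ℝ × ℝ => cellProb m q.1 q.2)
      (fun q => Phi ((Real.log (m + 1) - q.1) / Real.sqrt q.2) -
        if m = 0 then 0 else Phi ((Real.log m - q.1) / Real.sqrt q.2)) {q | 0 < q.2} :=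
    fun q hq => cellProb_eq_Phi m q.1 hq
  refine ContinuousOn.congr ?_ h
  have hdiv : ∀ c : ℝ, ContinuousOn (fun q : ℝ × ℝ => Phi ((c - q.1) / Real.sqrt q.2))
      {q | 0 < q.2} := fun c =>
    continuous_Phi.comp_continuousOn (ContinuousOn.div (by fun_prop) (by fun_prop)
      fun q hq => (Real.sqrt_pos.2 hq).ne')
  split_ifs
  · exact (hdiv _).sub continuousOn_const
  · exact (hdiv _).sub (hdiv _)

/-- Uniform separation of the count laws over compact sets of latent laws with separated means. -/
theorem exists_le_cellGap (C δ s₁ s₂ s' : ℝ) (hδ : 0 < δ) (hs₁ : 0 < s₁) (hs' : 0 < s') :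
    ∃ γ > 0, ∀ μ s μ' : ℝ, |μ| ≤ C → |μ'| ≤ C → δ ≤ |μ - μ'| → s₁ ≤ s → s ≤ s₂ →
      γ ≤ cellGap μ s μ' s' := by
  set T : Set (ℝ × ℝ × ℝ) := (Set.Icc (-C) C ×ˢ (Set.Icc s₁ s₂ ×ˢ Set.Icc (-C) C)) ∩
    {q | δ ≤ |q.1 - q.2.2|} with hT
  have hTc : IsCompact T := (isCompact_Icc.prod (isCompact_Icc.prod isCompact_Icc)).inter_right
    (isClosed_le continuous_const (by fun_prop))
  have hpos : ∀ q ∈ T, 0 < q.2.1 := fun q hq => lt_of_lt_of_le hs₁ hq.1.2.1.1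
  have hcont : ContinuousOn (fun q : ℝ × ℝ × ℝ => cellGap q.1 q.2.1 q.2.2 s') T := by
    have c1 : ∀ m, ContinuousOn (fun q : ℝ × ℝ × ℝ => cellProb m q.1 q.2.1) T := fun m =>
      (continuousOn_cellProb m).comp (f := fun q : ℝ × ℝ × ℝ => (q.1, q.2.1)) (by fun_prop) hpos
    have c2 : ∀ m, ContinuousOn (fun q : ℝ × ℝ × ℝ => cellProb m q.2.2 s') T := fun m =>
      (continuousOn_cellProb m).comp (f := fun q : ℝ × ℝ × ℝ => (q.2.2, s')) (by fun_prop)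
        fun q _ => hs'
    unfold cellGap
    exact ((((c1 0).sub (c2 0)).pow 2).add (((c1 1).sub (c2 1)).pow 2)).div_const _
  obtain ⟨γ, hγ, h⟩ := hTc.exists_forall_le' hcont (a := 0) fun q hq => by
    refine cellGap_pos (hpos q hq) hs' fun he => ?_
    have := hq.2
    simp only [Set.mem_ofPred_eq, he, sub_self, abs_zero] at this
    linarith
  exact ⟨γ, hγ, fun μ s μ' h1 h2 h3 h4 h5 => h (μ, s, μ') ⟨⟨abs_le.1 h1, ⟨h4, h5⟩, abs_le.1 h2⟩, h3⟩⟩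

section SingleModel

variable {n : ℕ} {ι : Type} [Fintype ι]

/-- A Chernoff bound for the likelihood ratio, in terms of the discrepancies of the count laws. -/
theorem dataLaw_neg_lt_log_likelihood_ratio_le (X : Matrix (Fin n) ι ℝ) {θ θ₀ : Param ι}
    (hθ : 0 < θ.2.2) (hθ₀ : 0 < θ₀.2.2) {t : ℝ} (ht : 0 ≤ t) :
    (dataLaw X θ₀).real {y | -t ≤ Real.log (likelihood X y θ) - Real.log (likelihood X y θ₀)} ≤
      Real.exp (t - ∑ i, cellGap (linPred X θ.1 θ.2.1 i) θ.2.2 (linPred X θ₀.1 θ₀.2.1 i) θ₀.2.2) := by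
  set g := fun i => cellGap (linPred X θ.1 θ.2.1 i) θ.2.2 (linPred X θ₀.1 θ₀.2.1 i) θ₀.2.2 with hg
  set ν : Fin n → Measure ℕ := fun i =>
    affinityMeasure (linPred X θ.1 θ.2.1 i) θ.2.2 (linPred X θ₀.1 θ₀.2.1 i) θ₀.2.2 with hν
  have hνle : ∀ i, ν i Set.univ ≤ ENNReal.ofReal (Real.exp (-g i)) :=
    fun i => affinityMeasure_univ_le_exp_cellGap hθ hθ₀
  have hfin : ∀ i, IsFiniteMeasure (ν i) := fun i => ⟨(hνle i).trans_lt ENNReal.ofReal_lt_top⟩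
  set A := {y | -t ≤ Real.log (likelihood X y θ) - Real.log (likelihood X y θ₀)}
  have h := measure_le_mul_of_singleton (dataLaw X θ₀) (Measure.pi ν) A
    (ENNReal.ofReal (Real.exp t)) fun y (hy : -t ≤ _) => by
      have p := likelihood_pos X y hθ
      have p₀ := likelihood_pos X y hθ₀
      have hpi : Measure.pi ν {y} =
          ENNReal.ofReal (Real.sqrt (likelihood X y θ * likelihood X y θ₀)) := by
        rw [Measure.pi_singleton, likelihood_eq_prod, likelihood_eq_prod,
          ← Finset.prod_mul_distrib, Real.sqrt_prod _ fun i _ =>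
            (mul_pos (cellProb_pos _ _ hθ) (cellProb_pos _ _ hθ₀)).le,
          ENNReal.ofReal_prod_of_nonneg fun i _ => Real.sqrt_nonneg _]
        exact Finset.prod_congr rfl fun i _ => affinityMeasure_singleton _ _ _ _ _
      rw [dataLaw_singleton X y hθ₀, hpi, ← ENNReal.ofReal_mul (Real.exp_pos _).le]
      apply ENNReal.ofReal_le_ofReal
      rw [← Real.log_le_log_iff p₀ (by positivity), Real.log_mul (Real.exp_pos _).ne'
        (by positivity), Real.log_exp, Real.log_sqrt (by positivity), Real.log_mul p.ne' p₀.ne']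
      linarith
  refine ENNReal.toReal_le_of_le_ofReal (Real.exp_pos _).le (h.trans ?_)
  calc ENNReal.ofReal (Real.exp t) * Measure.pi ν A
      ≤ ENNReal.ofReal (Real.exp t) * Measure.pi ν Set.univ := by gcongr; exact Set.subset_univ _
    _ ≤ ENNReal.ofReal (Real.exp t) * ∏ i, ENNReal.ofReal (Real.exp (-g i)) := by
        rw [Measure.pi_univ]
        gcongr with i
        exact hνle i
    _ = _ := by
        rw [← ENNReal.ofReal_prod_of_nonneg fun i _ => (Real.exp_pos _).le, ← Real.exp_sum,
          ← ENNReal.ofReal_mul (Real.exp_pos _).le, ← Real.exp_add, Finset.sum_neg_distrib,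
          sub_eq_add_neg]

theorem linPred_sq_le (X : Matrix (Fin n) ι ℝ) (α : ℝ) (β : EuclideanSpace ℝ ι) (i : Fin n) :
    linPred X α β i ^ 2 ≤ (1 + ∑ j, X i j ^ 2) * (α ^ 2 + ‖β‖ ^ 2) := by
  rw [EuclideanSpace.real_norm_sq_eq]
  exact natPred_sq_le X (α, β.ofLp, 0) i

end SingleModel

/-- The quadratic forms `XᵀX / n` are eventually bounded below, if their limit is positive
definite. -/
theorem exists_gram_lower_bound {p : ℕ} (X : ∀ n : ℕ, Matrix (Fin n) (Fin p) ℝ)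
    (S : Matrix (Fin p) (Fin p) ℝ) (hS : S.PosDef)
    (hlim : Tendsto (fun n : ℕ => (n : ℝ)⁻¹ • ((X n)ᵀ * X n)) atTop (𝓝 S)) :
    ∃ l > 0, ∀ᶠ n : ℕ in atTop, ∀ (v : Fin p → ℝ) (j : Fin p),
      l * n * v j ^ 2 ≤ ∑ i, (∑ j, X n i j * v j) ^ 2 := by
  have hcS : Continuous fun v : Fin p → ℝ => v ⬝ᵥ (S *ᵥ v) := by fun_prop
  obtain ⟨l, hl, hlS⟩ := (isCompact_sphere (0 : Fin p → ℝ) 1).exists_forall_le' hcS.continuousOn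
    (a := 0) fun v hv => by
      have hv0 : v ≠ 0 := by rintro rfl; simp at hv
      simpa using hS.dotProduct_mulVec_pos hv0
  have hev : ∀ᶠ A in 𝓝 S, ∀ v ∈ Metric.sphere (0 : Fin p → ℝ) 1, l / 2 < v ⬝ᵥ (A *ᵥ v) := by
    refine (isCompact_sphere _ _).eventually_forall_of_forall_eventually fun v hv => ?_
    have hc : Continuous fun z : Matrix (Fin p) (Fin p) ℝ × (Fin p → ℝ) => z.2 ⬝ᵥ (z.1 *ᵥ z.2) := by
      fun_prop
    exact hc.continuousAt.eventually (lt_mem_nhds (by linarith [hlS v hv]))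
  refine ⟨l / 2, by positivity, ?_⟩
  filter_upwards [hlim.eventually hev, eventually_gt_atTop 0] with n hn hn0 v j
  have hnp : (0 : ℝ) < n := by exact_mod_cast hn0
  have e : ∀ v : Fin p → ℝ, v ⬝ᵥ (((n : ℝ)⁻¹ • ((X n)ᵀ * X n)) *ᵥ v) =
      (n : ℝ)⁻¹ * ∑ i, (∑ j, X n i j * v j) ^ 2 := by
    intro v
    rw [Matrix.smul_mulVec, dotProduct_smul, ← Matrix.mulVec_mulVec, Matrix.dotProduct_mulVec,
      Matrix.vecMul_transpose, smul_eq_mul]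
    simp [dotProduct, Matrix.mulVec, sq]
  rcases eq_or_ne v 0 with rfl | hv
  · simp
  · have hvn : 0 < ‖v‖ := norm_pos_iff.2 hv
    have h1 := hn (‖v‖⁻¹ • v) (by
      rw [mem_sphere_zero_iff_norm, norm_smul, norm_inv, norm_norm, inv_mul_cancel₀ hvn.ne'])
    rw [Matrix.mulVec_smul, smul_dotProduct, dotProduct_smul, e] at h1
    simp only [smul_eq_mul] at h1
    have h2 : v j ^ 2 ≤ ‖v‖ ^ 2 := by
      rw [← sq_abs, ← Real.norm_eq_abs]
      gcongr
      exact norm_le_pi_norm v j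
    set W := ∑ i, (∑ j, X n i j * v j) ^ 2
    have h3 : ‖v‖⁻¹ * (‖v‖⁻¹ * ((n : ℝ)⁻¹ * W)) = W / (n * ‖v‖ ^ 2) := by field_simp
    rw [h3, lt_div_iff₀ (by positivity)] at h1
    calc l / 2 * n * v j ^ 2 ≤ l / 2 * n * ‖v‖ ^ 2 := by gcongr
      _ = l / 2 * (n * ‖v‖ ^ 2) := by ring
      _ ≤ W := h1.le

/-- A truncation argument: if the squared distances `d i` are large on average and dominated by
weights `W i` with bounded second moments, and if `g i` is bounded below wherever `d i` is not small
and `W i` is not large, then `g` is bounded below on average. -/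
theorem exists_sum_lower_bound {Λ E G γ : ℝ} (hΛ : 0 < Λ) (hE : 0 < E) (hG : 0 < G) (hγ : 0 < γ)
    {n : ℕ} (d W g : Fin n → ℝ) (hW : ∀ i, 0 ≤ W i) (hg : ∀ i, 0 ≤ g i) (hdE : ∀ i, d i ≤ E * W i)
    (hgap : ∀ i, W i ≤ 4 * E * G / Λ → Λ / 4 ≤ d i → γ ≤ g i)
    (hd : Λ * n ≤ ∑ i, d i) (hWsum : ∑ i, W i ^ 2 ≤ G * n) :
    γ / (E * (4 * E * G / Λ)) * Λ / 2 * n ≤ ∑ i, g i := by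
  set T := 4 * E * G / Λ with hT
  have hT0 : 0 < T := by positivity
  set κ := γ / (E * T) with hκ
  have hκ0 : 0 < κ := by positivity
  have hpt : ∀ i, κ * (d i - Λ / 4 - E / T * W i ^ 2) ≤ g i := by
    intro i
    have hW0 : 0 ≤ E / T * W i ^ 2 := by positivity
    by_cases hc1 : T < W i
    · refine le_trans (mul_nonpos_of_nonneg_of_nonpos hκ0.le ?_) (hg i)
      have : E * W i ≤ E / T * W i ^ 2 := by
        rw [div_mul_eq_mul_div, le_div_iff₀ hT0, sq, ← mul_assoc]
        exact mul_le_mul_of_nonneg_left hc1.le (mul_nonneg hE.le (hW i))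
      linarith [hdE i]
    by_cases hc2 : d i < Λ / 4
    · exact le_trans (mul_nonpos_of_nonneg_of_nonpos hκ0.le (by linarith)) (hg i)
    push Not at hc1 hc2
    refine le_trans ?_ (hgap i hc1 hc2)
    have : d i ≤ E * T := (hdE i).trans (by gcongr)
    rw [hκ, div_mul_eq_mul_div, div_le_iff₀ (by positivity)]
    exact mul_le_mul_of_nonneg_left (by linarith) hγ.le
  have hsum := Finset.sum_le_sum fun i (_ : i ∈ Finset.univ) => hpt i
  rw [← Finset.mul_sum, Finset.sum_sub_distrib, Finset.sum_sub_distrib, ← Finset.mul_sum] at hsum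
  simp only [Finset.sum_const, Finset.card_univ, Fintype.card_fin, nsmul_eq_mul] at hsum
  have hETG : E / T * (G * n) = Λ / 4 * n := by rw [hT]; field_simp
  have h10 : E / T * ∑ i, W i ^ 2 ≤ Λ / 4 * n := by
    rw [← hETG]; gcongr
  have h11 : κ * (Λ / 2 * n) ≤ κ * (∑ i, d i - n * (Λ / 4) - E / T * ∑ i, W i ^ 2) :=
    mul_le_mul_of_nonneg_left (by linarith) hκ0.le
  have h12 : κ * (Λ / 2 * n) = κ * Λ / 2 * n := by ring
  linarith

theorem sum_one_add_sum_sq_sq_le {n p : ℕ} (X : Matrix (Fin n) (Fin p) ℝ) {B : ℝ}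
    (hmom : ∑ i, ∑ j, X i j ^ 4 ≤ B * n) :
    ∑ i, (1 + ∑ j, X i j ^ 2) ^ 2 ≤ (1 + p) * (1 + |B|) * n := by
  have h1 : ∀ i, (1 + ∑ j, X i j ^ 2) ^ 2 ≤ (1 + p) * (1 + ∑ j, X i j ^ 4) := by
    intro i
    have := Finset.sum_mul_sq_le_sq_mul_sq Finset.univ (fun _ : Option (Fin p) => (1 : ℝ))
      (fun o : Option (Fin p) => o.elim 1 fun j => X i j ^ 2)
    simp only [Fintype.sum_option, Option.elim, one_pow, one_mul, Finset.sum_const,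
      Finset.card_univ, Fintype.card_option, Fintype.card_fin, nsmul_eq_mul, mul_one,
      ← pow_mul] at this
    push_cast at this
    rwa [add_comm (p : ℝ) 1] at this
  refine (Finset.sum_le_sum fun i _ => h1 i).trans ?_
  rw [← Finset.mul_sum, Finset.sum_add_distrib]
  simp only [Finset.sum_const, Finset.card_univ, Fintype.card_fin, nsmul_eq_mul, mul_one]
  rw [mul_assoc]
  have : B * n ≤ |B| * n := by gcongr; exact le_abs_self B
  exact mul_le_mul_of_nonneg_left (by linarith) (by positivity)

theorem linPred_sub {n p : ℕ} (X : Matrix (Fin n) (Fin p) ℝ) (α α' : ℝ)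
    (β β' : EuclideanSpace ℝ (Fin p)) (i : Fin n) :
    linPred X α β i - linPred X α' β' i = linPred X (α - α') (β - β') i := by
  simp only [linPred, PiLp.sub_apply, mul_sub, Finset.sum_sub_distrib]
  ring

theorem sum_linPred_sq_of_centered {n p : ℕ} {X : Matrix (Fin n) (Fin p) ℝ}
    (hX : ∀ j, ∑ i, X i j = 0) (α : ℝ) (β : EuclideanSpace ℝ (Fin p)) :
    ∑ i, linPred X α β i ^ 2 = n * α ^ 2 + ∑ i, (∑ j, X i j * β j) ^ 2 := by
  have hsum0 : ∑ i, ∑ j, X i j * β j = 0 := by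
    rw [Finset.sum_comm]
    refine Finset.sum_eq_zero fun j _ => ?_
    rw [← Finset.sum_mul, hX, zero_mul]
  have : ∀ i, linPred X α β i ^ 2 = α ^ 2 + 2 * α * (∑ j, X i j * β j) +
      (∑ j, X i j * β j) ^ 2 := by
    intro i; rw [linPred]; ring
  simp_rw [this]
  rw [Finset.sum_add_distrib, Finset.sum_add_distrib, ← Finset.mul_sum, hsum0]
  simp

/-- Parameters that miss a coefficient of the truth are separated from it at an exponential rate,
uniformly over bounded sets: a truncation argument, based on the fourth moments of the design,
shows that a positive fraction of the observations has well separated bounded predictors. -/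
theorem exists_exponential_separation {p : ℕ} (X : ∀ n : ℕ, Matrix (Fin n) (Fin p) ℝ)
    (hcentered : ∀ n j, ∑ i, X n i j = 0)
    (S : Matrix (Fin p) (Fin p) ℝ) (hS : S.PosDef)
    (hlim : Tendsto (fun n : ℕ => (n : ℝ)⁻¹ • ((X n)ᵀ * X n)) atTop (𝓝 S))
    {B : ℝ} (hmom : ∀ n : ℕ, ∑ i, ∑ j, X n i j ^ 4 ≤ B * n)
    {θ₀ : Param (Fin p)} (hθ₀ : 0 < θ₀.2.2) (D s₁ s₂ : ℝ) (hs₁ : 0 < s₁) {b : ℝ} (hb : 0 < b)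
    (j₀ : Fin p) :
    ∃ c > 0, ∀ᶠ n : ℕ in atTop, ∀ θ : Param (Fin p), |θ.1| ≤ D → ‖θ.2.1‖ ≤ D → s₁ ≤ θ.2.2 →
      θ.2.2 ≤ s₂ → b ≤ |θ.2.1 j₀ - θ₀.2.1 j₀| →
      (dataLaw (X n) θ₀).real
        {y | -(c * n) ≤ Real.log (likelihood (X n) y θ) - Real.log (likelihood (X n) y θ₀)} ≤
        Real.exp (-(c * n)) := by
  obtain ⟨l, hl, hgram⟩ := exists_gram_lower_bound X S hS hlim
  have hΛ : 0 < l * b ^ 2 := by positivity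
  -- `E` bounds the squared norms of all coefficient vectors and of their differences
  obtain ⟨E, hE0, hE⟩ : ∃ E > 0, 2 * D ^ 2 ≤ E / 4 ∧ θ₀.1 ^ 2 + ‖θ₀.2.1‖ ^ 2 ≤ E / 4 :=
    ⟨8 * (D ^ 2 + θ₀.1 ^ 2 + ‖θ₀.2.1‖ ^ 2) + 1, by positivity,
      by nlinarith [sq_nonneg θ₀.1, sq_nonneg ‖θ₀.2.1‖], by nlinarith [sq_nonneg D]⟩
  have hG : 0 < (1 + p) * (1 + |B|) := by positivity
  set G := (1 + p) * (1 + |B|) with hGdef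
  set Λ := l * b ^ 2 with hΛdef
  obtain ⟨γ, hγ, hgap⟩ := exists_le_cellGap (Real.sqrt (4 * E * G / Λ * E)) (Real.sqrt (Λ / 4))
    s₁ s₂ θ₀.2.2 (by positivity) hs₁ hθ₀
  refine ⟨γ / (E * (4 * E * G / Λ)) * Λ / 4, by positivity, ?_⟩
  filter_upwards [hgram] with n hn θ h₁ h₂ h₃ h₄ h₅
  have hsp : 0 < θ.2.2 := by linarith
  refine (dataLaw_neg_lt_log_likelihood_ratio_le (X n) hsp hθ₀ (by positivity)).trans
    (Real.exp_le_exp.2 ?_)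
  have hD2 : θ.1 ^ 2 ≤ D ^ 2 := sq_le_sq' (by linarith [abs_le.1 h₁]) (abs_le.1 h₁).2
  have hβ2 : ‖θ.2.1‖ ^ 2 ≤ D ^ 2 := by gcongr
  have hW1 : ∀ i, 0 ≤ 1 + ∑ j, X n i j ^ 2 := fun i => by positivity
  have hdE : ∀ i, (linPred (X n) θ.1 θ.2.1 i - linPred (X n) θ₀.1 θ₀.2.1 i) ^ 2 ≤
      E * (1 + ∑ j, X n i j ^ 2) := by
    intro i
    rw [linPred_sub, mul_comm]
    refine (linPred_sq_le _ _ _ _).trans (mul_le_mul_of_nonneg_left ?_ (hW1 i))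
    have n1 : ‖θ.2.1 - θ₀.2.1‖ ^ 2 ≤ 2 * (‖θ.2.1‖ ^ 2 + ‖θ₀.2.1‖ ^ 2) := by
      have := pow_le_pow_left₀ (norm_nonneg _) (norm_sub_le θ.2.1 θ₀.2.1) 2
      linarith [add_sq_le (a := ‖θ.2.1‖) (b := ‖θ₀.2.1‖)]
    have n2 : (θ.1 - θ₀.1) ^ 2 ≤ 2 * (θ.1 ^ 2 + θ₀.1 ^ 2) := by
      linarith [sq_nonneg (θ.1 + θ₀.1), add_sq θ.1 θ₀.1, sub_sq θ.1 θ₀.1]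
    linarith [hE.1, hE.2]
  have htot : Λ * n ≤ ∑ i, (linPred (X n) θ.1 θ.2.1 i - linPred (X n) θ₀.1 θ₀.2.1 i) ^ 2 := by
    simp_rw [linPred_sub]
    rw [sum_linPred_sq_of_centered (hcentered n)]
    have h6 := hn (θ.2.1 - θ₀.2.1).ofLp j₀
    have h7 : b ^ 2 ≤ (θ.2.1 - θ₀.2.1).ofLp j₀ ^ 2 := by
      rw [← sq_abs ((θ.2.1 - θ₀.2.1).ofLp j₀)]; gcongr; exact h₅
    have h8 : Λ * n ≤ l * n * (θ.2.1 - θ₀.2.1).ofLp j₀ ^ 2 := by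
      calc l * b ^ 2 * n = l * n * b ^ 2 := by ring
        _ ≤ _ := by gcongr
    have h9 : 0 ≤ n * (θ.1 - θ₀.1) ^ 2 := by positivity
    linarith
  have hmain := exists_sum_lower_bound hΛ hE0 hG hγ
    (fun i => (linPred (X n) θ.1 θ.2.1 i - linPred (X n) θ₀.1 θ₀.2.1 i) ^ 2)
    (fun i => 1 + ∑ j, X n i j ^ 2)
    (fun i => cellGap (linPred (X n) θ.1 θ.2.1 i) θ.2.2 (linPred (X n) θ₀.1 θ₀.2.1 i) θ₀.2.2)
    hW1 (fun i => cellGap_nonneg _ _ _ _) hdE (fun i hc1 hc2 => by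
      have hWT : (1 + ∑ j, X n i j ^ 2) * E ≤ 4 * E * G / Λ * E :=
        mul_le_mul_of_nonneg_right hc1 hE0.le
      refine hgap _ _ _ (Real.abs_le_sqrt ?_) (Real.abs_le_sqrt ?_) ?_ h₃ h₄
      · refine (linPred_sq_le _ _ _ _).trans (le_trans ?_ hWT)
        exact mul_le_mul_of_nonneg_left (by linarith [hE.1]) (hW1 i)
      · refine (linPred_sq_le _ _ _ _).trans (le_trans ?_ hWT)
        exact mul_le_mul_of_nonneg_left (by linarith [hE.2]) (hW1 i)
      · rw [← Real.sqrt_sq_eq_abs]; exact Real.sqrt_le_sqrt hc2)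
    htot (sum_one_add_sum_sq_sq_le (X n) (hmom n))
  have h12 : γ / (E * (4 * E * G / Λ)) * Λ / 2 * n =
    2 * (γ / (E * (4 * E * G / Λ)) * Λ / 4 * n) := by ring
  linarith

/-! ### Stochastic order calculus -/

section StochasticOrder

variable {Ω : ℕ → Type} [∀ n, MeasurableSpace (Ω n)] {P : ∀ n, Measure (Ω n)}

theorem tendsto_measureReal_zero_of_le [∀ n, IsFiniteMeasure (P n)] {A : ∀ n, Set (Ω n)}
    (h : ∀ ε > 0, ∀ᶠ n in atTop, (P n).real (A n) ≤ ε) :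
    Tendsto (fun n => (P n).real (A n)) atTop (𝓝 0) := by
  refine tendsto_order.2 ⟨fun a ha => Eventually.of_forall fun n => ha.trans_le measureReal_nonneg,
    fun a ha => ?_⟩
  filter_upwards [h (a / 2) (by positivity)] with n hn
  linarith

theorem eventually_measureReal_le {A : ∀ n, Set (Ω n)}
    (h : Tendsto (fun n => (P n).real (A n)) atTop (𝓝 0)) {ε : ℝ} (hε : 0 < ε) :
    ∀ᶠ n in atTop, (P n).real (A n) ≤ ε :=
  h.eventually (Iic_mem_nhds hε)

theorem tendsto_one_iff_compl [∀ n, IsProbabilityMeasure (P n)]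
    [∀ n, DiscreteMeasurableSpace (Ω n)] {A : ∀ n, Set (Ω n)} :
    Tendsto (fun n => P n (A n)) atTop (𝓝 1) ↔
      Tendsto (fun n => (P n).real (A n)ᶜ) atTop (𝓝 0) := by
  have h1 : ∀ n, (P n).real (A n)ᶜ = 1 - (P n).real (A n) := fun n =>
    probReal_compl_eq_one_sub (MeasurableSet.of_discrete)
  simp_rw [h1, measureReal_def]
  rw [← ENNReal.tendsto_toReal_iff (fun n => measure_ne_top _ _) ENNReal.one_ne_top]
  constructor
  · intro h
    simpa using h.const_sub 1
  · intro h
    simpa using h.const_sub 1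

theorem IsBoundedInProb.add [∀ n, IsFiniteMeasure (P n)] {V W : ∀ n, Ω n → ℝ}
    (hV : IsBoundedInProb P V) (hW : IsBoundedInProb P W) :
    IsBoundedInProb P fun n ω => V n ω + W n ω := by
  intro ε hε
  obtain ⟨M, hM⟩ := hV (ε / 2) (by positivity)
  obtain ⟨M', hM'⟩ := hW (ε / 2) (by positivity)
  refine ⟨M + M', ?_⟩
  filter_upwards [hM, hM'] with n h h'
  have hsub : {ω | M + M' < |V n ω + W n ω|} ⊆ {ω | M < |V n ω|} ∪ {ω | M' < |W n ω|} := by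
    intro ω hω
    by_contra hcon
    simp only [Set.mem_union, Set.mem_ofPred_eq, not_or, not_lt] at hcon hω
    linarith [abs_add_le (V n ω) (W n ω)]
  linarith [(measureReal_mono (μ := P n) hsub).trans (measureReal_union_le _ _)]

theorem IsBoundedInProb.neg {W : ∀ n, Ω n → ℝ} (hW : IsBoundedInProb P W) :
    IsBoundedInProb P fun n ω => -W n ω := by
  intro ε hε
  simpa using hW ε hε

theorem IsBoundedInProb.tendsto_measureReal_zero [∀ n, IsFiniteMeasure (P n)] {W : ∀ n, Ω n → ℝ}
    (hW : IsBoundedInProb P W) {a : ℕ → ℝ} (ha : Tendsto a atTop atTop) :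
    Tendsto (fun n => (P n).real {ω | a n ≤ W n ω}) atTop (𝓝 0) := by
  refine tendsto_measureReal_zero_of_le fun ε hε => ?_
  obtain ⟨M, hM⟩ := hW ε hε
  filter_upwards [hM, ha.eventually_gt_atTop M] with n h h'
  refine (measureReal_mono fun ω (hω : a n ≤ W n ω) => ?_).trans h
  exact lt_of_lt_of_le h' (hω.trans (le_abs_self _))

end StochasticOrder

/-! ### Point estimates and the criterion under contraction -/

section SingleModel

variable {ι : Type} [Fintype ι] [DecidableEq ι] {P : ∀ n : ℕ, Measure (Fin n → ℕ)}
  [∀ n, IsProbabilityMeasure (P n)] {X : ∀ n : ℕ, Matrix (Fin n) ι ℝ}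
  {v : ∀ n, (Fin n → ℕ) → VarParams ι} {θ₀ : Param ι}

theorem IsCAVIFixedPoint.half_le_a {n : ℕ} {X : Matrix (Fin n) ι ℝ} {y : Fin n → ℕ}
    {w : VarParams ι} (h : IsCAVIFixedPoint X (n : ℝ) y w) : (n : ℝ) / 2 ≤ w.a := by
  rw [h.a_eq]
  have : (0 : ℝ) ≤ Fintype.card ι := Nat.cast_nonneg _
  linarith

/-- Contraction of the variational posterior at the rate `1/√n` makes its mean `√n`-consistent. -/
theorem isRootNConsistent_thetaHat (hθ₀ : 0 < θ₀.2.2)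
    (hcavi : Tendsto (fun n => (P n).real {y | ¬IsCAVIFixedPoint (X n) (n : ℝ) y (v n y)})
      atTop (𝓝 0))
    (hcontract : ContractsAtRootN P (fun n y => qThetaMeasure (v n y)) θ₀) :
    IsRootNConsistent P (fun n y => thetaHat (v n y)) θ₀ := by
  intro ε hε
  obtain ⟨M, hM⟩ := hcontract (min (ε / 2) (1 / 4)) (by positivity)
  refine ⟨|M| + 8 * (θ₀.2.2 + |M|), by positivity, ?_⟩
  filter_upwards [hM, eventually_measureReal_le hcavi (show 0 < ε / 2 by positivity),
    eventually_ge_atTop 36] with n h1 h2 h3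
  have hn : (36 : ℝ) ≤ n := by exact_mod_cast h3
  have hsq : 1 ≤ Real.sqrt n := Real.one_le_sqrt.2 (by linarith)
  have hsub : {y | (|M| + 8 * (θ₀.2.2 + |M|)) / Real.sqrt n < ‖thetaHat (v n y) - θ₀‖} ⊆
      {y | min (ε / 2) (1 / 4) <
        (qThetaMeasure (v n y)).real {θ | M / Real.sqrt n < ‖θ - θ₀‖}} ∪
      {y | ¬IsCAVIFixedPoint (X n) (n : ℝ) y (v n y)} := by
    intro y hy
    by_contra hcon
    simp only [Set.mem_union, Set.mem_ofPred_eq, not_or, not_lt, not_not] at hcon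
    obtain ⟨hq, hc⟩ := hcon
    have ha := hc.half_le_a
    have hqp := isProbabilityMeasure_qThetaMeasure hc.a_pos hc.b_pos
    have hq' : (qThetaMeasure (v n y)).real {θ | |M| / Real.sqrt n < ‖θ - θ₀‖} ≤ 1 / 4 := by
      refine (measureReal_mono fun θ (hθ : |M| / Real.sqrt n < _) => ?_).trans
        (hq.trans (min_le_right _ _))
      refine lt_of_le_of_lt ?_ hθ
      gcongr
      exact le_abs_self M
    obtain ⟨g1, g2, g3⟩ := thetaHat_close (by linarith) hc.b_pos hq'
    have hr : |M| / Real.sqrt n ≤ |M| := div_le_self (abs_nonneg M) hsq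
    have hsa : Real.sqrt n / 2 ≤ Real.sqrt ((v n y).a - 2) := by
      apply Real.le_sqrt_of_sq_le
      rw [div_pow, Real.sq_sqrt (Nat.cast_nonneg n)]
      linarith
    have hlast : 4 * (θ₀.2.2 + |M| / Real.sqrt n) / Real.sqrt ((v n y).a - 2) ≤
        8 * (θ₀.2.2 + |M|) / Real.sqrt n := by
      calc 4 * (θ₀.2.2 + |M| / Real.sqrt n) / Real.sqrt ((v n y).a - 2)
          ≤ 4 * (θ₀.2.2 + |M|) / (Real.sqrt n / 2) := by gcongr
        _ = _ := by field_simp; ring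
    have hle : |M| / Real.sqrt n ≤ (|M| + 8 * (θ₀.2.2 + |M|)) / Real.sqrt n := by
      gcongr
      have : 0 ≤ 8 * (θ₀.2.2 + |M|) := by positivity
      linarith
    rw [Set.mem_ofPred_eq] at hy
    refine absurd hy (not_lt.2 ?_)
    rw [thetaHat_eq (by linarith) hc.b_pos]
    refine norm_prod_le_iff.2 ⟨g1.trans hle, norm_prod_le_iff.2 ⟨g2.trans hle, ?_⟩⟩
    refine g3.trans ?_
    rw [add_div]
    linarith
  have := (measureReal_mono (μ := P n) hsub).trans (measureReal_union_le _ _)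
  linarith [min_le_left (ε / 2) (1 / 4)]

theorem isBoundedInProb_log_pVBC (hθ₀ : 0 < θ₀.2.2) {B : ℝ}
    (hX : ∀ n, ∑ i, ∑ j, X n i j ^ 2 ≤ B * n) (hdet : ∀ᶠ n in atTop, 0 < ((X n)ᵀ * X n).det)
    (hcavi : Tendsto (fun n => (P n).real {y | ¬IsCAVIFixedPoint (X n) (n : ℝ) y (v n y)})
      atTop (𝓝 0))
    (hT : IsRootNConsistent P (fun n y => thetaHat (v n y)) θ₀) :
    IsBoundedInProb P fun n y => Real.log (pVBC (X n) (n : ℝ) y (v n y)) -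
      (Real.log (likelihood (X n) y (thetaHat (v n y))) -
        ((Fintype.card ι : ℝ) + 2) / 2 * Real.log n) := by
  obtain ⟨C, hC⟩ := exists_abs_log_Gamma_sub_le
  intro ε hε
  obtain ⟨M, hM0, hM⟩ := hT (ε / 2) (by positivity)
  set K := |Real.log (θ₀.2.2 / 2)| + |Real.log (2 * θ₀.2.2)| with hK
  set R := ‖θ₀.2.1‖ + 1 with hR
  refine ⟨4 + C + Fintype.card ι + B * R ^ 2 * Real.exp K + 3 * K + 20, ?_⟩
  have hsmall : ∀ᶠ n : ℕ in atTop, M / Real.sqrt n ≤ min (θ₀.2.2 / 2) 1 :=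
    (tendsto_const_div_sqrt M).eventually (Iic_mem_nhds (by positivity))
  filter_upwards [hM, eventually_measureReal_le hcavi (show 0 < ε / 2 by positivity), hsmall, hdet,
    eventually_ge_atTop (4 + Fintype.card ι)] with n h1 h2 h3 h4 h5
  have hn4 : (4 : ℝ) ≤ n := by exact_mod_cast (by omega : 4 ≤ n)
  have hsub : {y | 4 + C + Fintype.card ι + B * R ^ 2 * Real.exp K + 3 * K + 20 <
      |Real.log (pVBC (X n) (n : ℝ) y (v n y)) -
        (Real.log (likelihood (X n) y (thetaHat (v n y))) -
          ((Fintype.card ι : ℝ) + 2) / 2 * Real.log n)|} ⊆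
      {y | M / Real.sqrt n < ‖thetaHat (v n y) - θ₀‖} ∪
      {y | ¬IsCAVIFixedPoint (X n) (n : ℝ) y (v n y)} := by
    intro y hy
    by_contra hcon
    simp only [Set.mem_union, Set.mem_ofPred_eq, not_or, not_lt, not_not] at hcon
    obtain ⟨hq, hc⟩ := hcon
    have ha := hc.half_le_a
    have hclose := hq.trans h3
    rw [thetaHat_eq (by linarith) hc.b_pos] at hclose
    obtain ⟨-, g⟩ := norm_prod_le_iff.1 hclose
    obtain ⟨g2, g3⟩ := norm_prod_le_iff.1 g
    have g2' : ‖(v n y).μβ - θ₀.2.1‖ ≤ 1 := g2.trans (min_le_right _ _)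
    have g3' : |(v n y).b / ((v n y).a - 1) - θ₀.2.2| ≤ θ₀.2.2 / 2 := g3.trans (min_le_left _ _)
    have hβ : ‖(v n y).μβ‖ ≤ R := by
      have := norm_sub_norm_le (v n y).μβ θ₀.2.1
      linarith
    have habs := abs_le.1 g3'
    have hlog : |Real.log ((v n y).b / ((v n y).a - 1))| ≤ K := by
      have l1 := Real.log_le_log (by positivity)
        (show θ₀.2.2 / 2 ≤ (v n y).b / ((v n y).a - 1) by linarith)
      have l2 := Real.log_le_log (by linarith)
        (show (v n y).b / ((v n y).a - 1) ≤ 2 * θ₀.2.2 by linarith)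
      have := neg_abs_le (Real.log (θ₀.2.2 / 2))
      have := le_abs_self (Real.log (2 * θ₀.2.2))
      have := abs_nonneg (Real.log (θ₀.2.2 / 2))
      have := abs_nonneg (Real.log (2 * θ₀.2.2))
      rw [abs_le]; constructor <;> linarith
    have hmain := abs_log_pVBC_sub_le hc (by linarith) (by omega) h4 (hX n) hβ hlog
      (hC _ (by linarith))
    have hna : n / ((v n y).a - 1) ≤ 4 := by
      rw [div_le_iff₀ (by linarith)]; linarith
    refine absurd hy (not_lt.2 (hmain.trans ?_))
    linarith
  have := (measureReal_mono (μ := P n) hsub).trans (measureReal_union_le _ _)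
  linarith

end SingleModel

/-! ### Submodels -/

section Submodel

variable {n p : ℕ}

/-- The coefficient vector of a submodel, extended by zero to all regressors. -/
def extendZero (k : Finset (Fin p)) (β : EuclideanSpace ℝ k) : EuclideanSpace ℝ (Fin p) :=
  WithLp.toLp 2 fun j => if h : j ∈ k then β ⟨j, h⟩ else 0

theorem sum_submodel {k : Finset (Fin p)} {f : k → ℝ} {g : Fin p → ℝ} (h₁ : ∀ j : k, g j = f j)
    (h₂ : ∀ j ∉ k, g j = 0) : ∑ j, g j = ∑ j, f j := by
  rw [← Finset.sum_subset (Finset.subset_univ k) (fun j _ hj => h₂ j hj), ← Finset.sum_coe_sort k]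
  exact Finset.sum_congr rfl fun j _ => h₁ j

theorem norm_extendZero (k : Finset (Fin p)) (β : EuclideanSpace ℝ k) : ‖extendZero k β‖ = ‖β‖ := by
  rw [EuclideanSpace.norm_eq, EuclideanSpace.norm_eq]
  congr 1
  refine sum_submodel (fun j => ?_) fun j hj => ?_
  · simp [extendZero]
  · simp [extendZero, hj]

theorem linPred_subDesign (X : Matrix (Fin n) (Fin p) ℝ) (k : Finset (Fin p)) (α : ℝ)
    (β : EuclideanSpace ℝ k) (i : Fin n) :
    linPred (subDesign X k) α β i = linPred X α (extendZero k β) i := by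
  unfold linPred
  congr 1
  symm
  refine sum_submodel (fun j => ?_) fun j hj => ?_
  · simp [extendZero, subDesign]
  · simp [extendZero, hj]

theorem likelihood_subDesign (X : Matrix (Fin n) (Fin p) ℝ) (k : Finset (Fin p)) (y : Fin n → ℕ)
    (θ : Param k) :
    likelihood (subDesign X k) y θ = likelihood X y (θ.1, extendZero k θ.2.1, θ.2.2) := by
  rw [likelihood_eq_prod, likelihood_eq_prod]
  simp only [linPred_subDesign]

theorem dataLaw_subDesign (X : Matrix (Fin n) (Fin p) ℝ) (k : Finset (Fin p)) (θ : Param k) :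
    dataLaw (subDesign X k) θ = dataLaw X (θ.1, extendZero k θ.2.1, θ.2.2) := by
  unfold dataLaw
  simp only [linPred_subDesign]

theorem extendZero_restrict {k : Finset (Fin p)} {β : EuclideanSpace ℝ (Fin p)}
    (h : ∀ j ∉ k, β j = 0) : extendZero k (WithLp.toLp 2 fun j : k => β j) = β := by
  ext j
  by_cases hj : j ∈ k
  · simp [extendZero, hj]
  · simp [extendZero, hj, h j hj]

theorem sum_sq_le_of_fourth_moment {X : Matrix (Fin n) (Fin p) ℝ} {B : ℝ}
    (h : ∑ i, ∑ j, X i j ^ 4 ≤ B * n) : ∑ i, ∑ j, X i j ^ 2 ≤ (p + B) * n := by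
  have h1 : ∑ i, ∑ j, X i j ^ 2 ≤ ∑ i : Fin n, ∑ j : Fin p, (1 + X i j ^ 4) :=
    Finset.sum_le_sum fun i _ => Finset.sum_le_sum fun j _ => by
      nlinarith [sq_nonneg (X i j ^ 2 - 1)]
  simp only [Finset.sum_add_distrib, Finset.sum_const, Finset.card_univ, Fintype.card_fin,
    nsmul_eq_mul, mul_one] at h1
  linarith

theorem sum_sq_subDesign_le (X : Matrix (Fin n) (Fin p) ℝ) (k : Finset (Fin p)) :
    ∑ i, ∑ j, subDesign X k i j ^ 2 ≤ ∑ i, ∑ j, X i j ^ 2 := by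
  refine Finset.sum_le_sum fun i _ => ?_
  change ∑ j : k, X i j ^ 2 ≤ _
  rw [Finset.sum_coe_sort k fun j => X i j ^ 2]
  exact Finset.sum_le_sum_of_subset_of_nonneg (Finset.subset_univ k) fun j _ _ => sq_nonneg _

theorem eventually_det_gram_subDesign_pos (X : ∀ n : ℕ, Matrix (Fin n) (Fin p) ℝ)
    {S : Matrix (Fin p) (Fin p) ℝ} (hS : S.PosDef)
    (hlim : Tendsto (fun n : ℕ => (n : ℝ)⁻¹ • ((X n)ᵀ * X n)) atTop (𝓝 S)) (k : Finset (Fin p)) :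
    ∀ᶠ n in atTop, 0 < ((subDesign (X n) k)ᵀ * subDesign (X n) k).det := by
  have hSk : 0 < (S.submatrix ((↑) : k → Fin p) (↑)).det :=
    (hS.submatrix Subtype.val_injective).det_pos
  have hc : Continuous fun A : Matrix (Fin p) (Fin p) ℝ => (A.submatrix ((↑) : k → Fin p) (↑)).det :=
    (continuous_id.matrix_submatrix _ _).matrix_det
  filter_upwards [(hc.tendsto S).comp hlim |>.eventually (lt_mem_nhds hSk),
    eventually_gt_atTop 0] with n hn hn0
  have hnp : (0 : ℝ) < n := by exact_mod_cast hn0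
  have e : ((n : ℝ)⁻¹ • ((X n)ᵀ * X n)).submatrix ((↑) : k → Fin p) (↑) =
      (n : ℝ)⁻¹ • ((subDesign (X n) k)ᵀ * subDesign (X n) k) := by
    ext i j
    simp [subDesign, Matrix.mul_apply]
  simp only [Function.comp_apply, e, Matrix.det_smul] at hn
  exact pos_of_mul_pos_right hn (by positivity)

/-- A model that misses a regressor of the truth has, at a `√n`-consistent estimator of its
pseudo-true parameter, a log-likelihood that is smaller than that of the truth by an amount of the
order `n`. -/
theorem exists_log_likelihood_deficit (X : ∀ n : ℕ, Matrix (Fin n) (Fin p) ℝ)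
    (hcentered : ∀ n j, ∑ i, X n i j = 0)
    (S : Matrix (Fin p) (Fin p) ℝ) (hS : S.PosDef)
    (hlim : Tendsto (fun n : ℕ => (n : ℝ)⁻¹ • ((X n)ᵀ * X n)) atTop (𝓝 S))
    {B : ℝ} (hmom : ∀ n : ℕ, ∑ i, ∑ j, X n i j ^ 4 ≤ B * n)
    {θ₀ : Param (Fin p)} (hθ₀ : 0 < θ₀.2.2) {k : Finset (Fin p)} {θk : Param k} (hθk : 0 < θk.2.2)
    {j₀ : Fin p} (hj₀ : j₀ ∉ k) (hβ : θ₀.2.1 j₀ ≠ 0) (T : ∀ n, (Fin n → ℕ) → Param k)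
    (hT : IsRootNConsistent (fun n => dataLaw (X n) θ₀) T θk) :
    ∃ c > 0, Tendsto (fun n : ℕ => (dataLaw (X n) θ₀).real
      {y | -(c * n) ≤ Real.log (likelihood (subDesign (X n) k) y (T n y)) -
        Real.log (likelihood (X n) y θ₀)}) atTop (𝓝 0) := by
  obtain ⟨c, hc, hsep⟩ := exists_exponential_separation X hcentered S hS hlim hmom hθ₀
    (‖θk‖ + 1) (θk.2.2 / 2) (2 * θk.2.2) (by positivity) (abs_pos.2 hβ) j₀
  refine ⟨c / 2, by positivity, tendsto_measureReal_zero_of_le fun ε hε => ?_⟩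
  obtain ⟨M, hM, hTM⟩ := hT (ε / 2) (by positivity)
  obtain ⟨L, hL, K, δ, hδ, hbound⟩ := exists_log_likelihood_vertex_bound θk hθk (p + B)
  set V := (finite_cubeVertices (ι := k)).toFinset with hV
  have hsmall : ∀ᶠ n : ℕ in atTop, M / Real.sqrt n ≤ δ :=
    (tendsto_const_div_sqrt M).eventually (Iic_mem_nhds hδ)
  have hclose : ∀ e ∈ V, ∀ᶠ n : ℕ in atTop,
      ‖vertexParam θk (L * (M / Real.sqrt n)) e - θk‖ ≤ min (θk.2.2 / 2) 1 := by
    intro e _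
    have h0 : Tendsto (fun n : ℕ => L * (M / Real.sqrt n)) atTop (𝓝 0) := by
      simpa using (tendsto_const_div_sqrt M).const_mul L
    have h1 := ((tendsto_vertexParam hθk e).comp h0).sub_const θk
    rw [sub_self] at h1
    have h2 := h1.norm
    rw [norm_zero] at h2
    exact h2.eventually (Iic_mem_nhds (by positivity))
  have hcn : Tendsto (fun n : ℕ => c * n) atTop atTop :=
    tendsto_natCast_atTop_atTop.const_mul_atTop hc
  have hexp : ∀ᶠ n : ℕ in atTop, V.card * Real.exp (-(c * n)) ≤ ε / 2 := by
    have h1 : Tendsto (fun n : ℕ => V.card * Real.exp (-(c * n))) atTop (𝓝 (V.card * 0)) :=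
      (Real.tendsto_exp_neg_atTop_nhds_zero.comp hcn).const_mul _
    rw [mul_zero] at h1
    exact h1.eventually (Iic_mem_nhds (by positivity))
  filter_upwards [hsep, hTM, hsmall, (Finset.eventually_all V).2 hclose, hexp,
    hcn.eventually_gt_atTop (2 * (K * M ^ 2)), eventually_gt_atTop 0] with n h1 h2 h3 h4 h5 h6 h7
  have hn : (0 : ℝ) < n := by exact_mod_cast h7
  have hρ : 0 < M / Real.sqrt n := by positivity
  have hXk : ∑ i, ∑ j, subDesign (X n) k i j ^ 2 ≤ (p + B) * n :=
    (sum_sq_subDesign_le (X n) k).trans (sum_sq_le_of_fourth_moment (hmom n))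
  set μ := dataLaw (X n) θ₀
  have hsub : {y | -(c / 2 * n) ≤ Real.log (likelihood (subDesign (X n) k) y (T n y)) -
      Real.log (likelihood (X n) y θ₀)} ⊆ {y | M / Real.sqrt n < ‖T n y - θk‖} ∪
      ⋃ e ∈ V, {y | -(c * n) ≤ Real.log (likelihood (subDesign (X n) k) y
        (vertexParam θk (L * (M / Real.sqrt n)) e)) - Real.log (likelihood (X n) y θ₀)} := by
    intro y hy
    by_contra hcon
    simp only [Set.mem_union, Set.mem_ofPred_eq, Set.mem_iUnion, not_or, not_exists, not_lt,
      not_le] at hcon hy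
    obtain ⟨⟨e, he, hup⟩, -⟩ := hbound n _ hXk y _ hρ h3 (T n y) hcon.1
    rw [nat_mul_div_sqrt_sq h7.ne'] at hup
    have g1 := hcon.2 e (by simpa [hV] using he)
    linarith
  refine (measureReal_mono hsub).trans ((measureReal_union_le _ _).trans ?_)
  have hV2 : μ.real (⋃ e ∈ V, {y | -(c * n) ≤ Real.log (likelihood (subDesign (X n) k) y
      (vertexParam θk (L * (M / Real.sqrt n)) e)) - Real.log (likelihood (X n) y θ₀)}) ≤
      V.card * Real.exp (-(c * n)) := by
    refine (measureReal_biUnion_finset_le _ _).trans ?_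
    rw [← nsmul_eq_mul, ← Finset.sum_const]
    refine Finset.sum_le_sum fun e he => ?_
    have h8 := h4 e he
    set θ := vertexParam θk (L * (M / Real.sqrt n)) e
    have h9 : ‖θ‖ ≤ ‖θk‖ + 1 := by
      have := norm_sub_norm_le θ θk
      linarith [h8.trans (min_le_right _ _)]
    obtain ⟨-, g⟩ := norm_prod_le_iff.1 (h8.trans (min_le_left _ _))
    have g3 := abs_le.1 (norm_prod_le_iff.1 g).2
    simp only [Prod.snd_sub] at g3
    simp_rw [likelihood_subDesign]
    refine h1 (θ.1, extendZero k θ.2.1, θ.2.2) ((norm_fst_le θ).trans h9) ?_ ?_ ?_ ?_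
    · rw [norm_extendZero]
      exact (norm_fst_le θ.2).trans ((norm_snd_le θ).trans h9)
    · simp only; linarith
    · simp only; linarith
    · simp [extendZero, hj₀]
  linarith

end Submodel

theorem tendsto_mul_sub_mul_log_atTop {c : ℝ} (hc : 0 < c) (C : ℝ) :
    Tendsto (fun n : ℕ => c * n - C * Real.log n) atTop atTop := by
  have h1 : ∀ᶠ x : ℝ in atTop, ‖C * Real.log x‖ ≤ c / 2 * ‖x‖ :=
    (Real.isLittleO_log_id_atTop.const_mul_left C).def (by positivity)
  have h2 := tendsto_natCast_atTop_atTop (R := ℝ) |>.eventually h1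
  have h3 : Tendsto (fun n : ℕ => c / 2 * (n : ℝ)) atTop atTop :=
    tendsto_natCast_atTop_atTop.const_mul_atTop (by positivity)
  refine tendsto_atTop_mono' _ ?_ h3
  filter_upwards [h2] with n hn
  rw [Real.norm_eq_abs, Real.norm_eq_abs, Nat.abs_cast] at hn
  linarith [le_abs_self (C * Real.log n)]

end STAR

end

theorem proposition10 {p : ℕ}
    -- the candidate models (sets of included regressors) and the true model
    (models : Finset (Finset (Fin p))) (kstar : Finset (Fin p)) (hkstar : kstar ∈ models)
    -- the true parameters; the true model consists of the regressors with nonzero coefficient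
    (αstar : ℝ) (βstar : EuclideanSpace ℝ (Fin p)) (σ2star : ℝ) (hσ2star : 0 < σ2star)
    (hsupp : ∀ j, j ∈ kstar ↔ βstar j ≠ 0)
    -- the designs: centered columns, `XᵀX/n` with a positive definite limit, bounded moments
    (X : ∀ n : ℕ, Matrix (Fin n) (Fin p) ℝ)
    (hcentered : ∀ n j, ∑ i, X n i j = 0)
    (S : Matrix (Fin p) (Fin p) ℝ) (hS : S.PosDef)
    (hlim : Tendsto (fun n : ℕ => (n : ℝ)⁻¹ • ((X n)ᵀ * X n)) atTop (𝓝 S))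
    (hmom : ∃ B : ℝ, ∀ n : ℕ, ∑ i, ∑ j, X n i j ^ 4 ≤ B * n)
    -- the laws of the data
    (P : ∀ n : ℕ, Measure (Fin n → ℕ))
    (hP : ∀ n, P n = dataLaw (X n) (αstar, βstar, σ2star))
    -- the fitted variational posteriors, with `g = n`
    (v : ∀ n : ℕ, (Fin n → ℕ) → ∀ k : Finset (Fin p), VarParams k)
    (hcavi : Tendsto
      (fun n : ℕ => P n {y | ∀ k ∈ models,
        IsCAVIFixedPoint (subDesign (X n) k) (n : ℝ) y (v n y k)}) atTop (𝓝 1))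
    -- contraction around the model-specific true parameters at the rate `1/√n`
    (θstar : ∀ k : Finset (Fin p), Param k)
    (hθpos : ∀ k ∈ models, 0 < (θstar k).2.2)
    (hθtrue : ∀ k ∈ models, kstar ⊆ k →
      θstar k = (αstar, WithLp.toLp 2 (fun j : k => βstar j), σ2star))
    (hcontract : ∀ k ∈ models,
      ContractsAtRootN P (fun n y => qThetaMeasure (v n y k)) (θstar k)) :
    -- the likelihood is a product of interval probabilities
    (∀ (n : ℕ) (k : Finset (Fin p)) (y : Fin n → ℕ) (θ : Param k), 0 < θ.2.2 →
      likelihood (subDesign (X n) k) y θ = intervalLikelihood (subDesign (X n) k) y θ) ∧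
    -- `p(y|ẑ) p(ẑ|θ) / q(ẑ) = p(y|θ)` exactly, if `σ²` is set to the variational scale `b/a` ...
    (∀ (n : ℕ) (k : Finset (Fin p)) (y : Fin n → ℕ) (w : VarParams k),
      IsCAVIFixedPoint (subDesign (X n) k) (n : ℝ) y w →
      latentRatio (subDesign (X n) k) y w (w.μα, w.μβ, w.b / w.a) =
        likelihood (subDesign (X n) k) y (w.μα, w.μβ, w.b / w.a)) ∧
    -- ... the point estimate has the same location, and its scale is asymptotically the same ...
    (∀ ε > 0, ∀ᶠ n : ℕ in atTop, ∀ (k : Finset (Fin p)) (y : Fin n → ℕ) (w : VarParams k),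
      IsCAVIFixedPoint (subDesign (X n) k) (n : ℝ) y w →
      (thetaHat w).1 = w.μα ∧ (thetaHat w).2.1 = w.μβ ∧
        |(thetaHat w).2.2 / (w.b / w.a) - 1| ≤ ε) ∧
    -- ... and at the point estimate the identity holds up to a bounded term on the log scale
    (∃ C : ℝ, ∀ᶠ n : ℕ in atTop, ∀ (k : Finset (Fin p)) (y : Fin n → ℕ) (w : VarParams k),
      IsCAVIFixedPoint (subDesign (X n) k) (n : ℝ) y w →
      |Real.log (latentRatio (subDesign (X n) k) y w (thetaHat w)) -
        Real.log (likelihood (subDesign (X n) k) y (thetaHat w))| ≤ C) ∧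
    -- `log p_VBC` has the BIC form
    (∀ k ∈ models, IsBoundedInProb P fun n y =>
      Real.log (pVBC (subDesign (X n) k) (n : ℝ) y (v n y k)) -
        (Real.log (likelihood (subDesign (X n) k) y (thetaHat (v n y k))) -
          ((k.card : ℝ) + 2) / 2 * Real.log n)) ∧
    -- model selection consistency
    Tendsto
      (fun n : ℕ => P n {y | ∀ k ∈ models, k ≠ kstar →
        VBC (subDesign (X n) kstar) (n : ℝ) y (v n y kstar) <
          VBC (subDesign (X n) k) (n : ℝ) y (v n y k)}) atTop (𝓝 1) := by
  have hprob : ∀ n, IsProbabilityMeasure (P n) := fun n => by rw [hP]; infer_instance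
  obtain ⟨B, hB⟩ := hmom
  have hP' : P = fun n => dataLaw (X n) (αstar, βstar, σ2star) := funext hP
  have hXk : ∀ (k : Finset (Fin p)) (n : ℕ), ∑ i, ∑ j, subDesign (X n) k i j ^ 2 ≤ (p + B) * n :=
    fun k n => (sum_sq_subDesign_le (X n) k).trans (sum_sq_le_of_fourth_moment (hB n))
  have hfix : ∀ k ∈ models, Tendsto (fun n => (P n).real
      {y | ¬IsCAVIFixedPoint (subDesign (X n) k) (n : ℝ) y (v n y k)}) atTop (𝓝 0) := by
    intro k hk
    refine tendsto_measureReal_zero_of_le fun ε hε => ?_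
    filter_upwards [eventually_measureReal_le (tendsto_one_iff_compl.1 hcavi) hε] with n hn
    have hsub : {y | ¬IsCAVIFixedPoint (subDesign (X n) k) (n : ℝ) y (v n y k)} ⊆
        {y | ∀ k ∈ models, IsCAVIFixedPoint (subDesign (X n) k) (n : ℝ) y (v n y k)}ᶜ :=
      fun y hy hall => hy (hall k hk)
    exact (measureReal_mono hsub).trans hn
  have hT : ∀ k ∈ models, IsRootNConsistent P (fun n y => thetaHat (v n y k)) (θstar k) :=
    fun k hk => isRootNConsistent_thetaHat (hθpos k hk) (hfix k hk) (hcontract k hk)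
  have hBIC : ∀ k ∈ models, IsBoundedInProb P fun n y =>
      Real.log (pVBC (subDesign (X n) k) (n : ℝ) y (v n y k)) -
        (Real.log (likelihood (subDesign (X n) k) y (thetaHat (v n y k))) -
          ((k.card : ℝ) + 2) / 2 * Real.log n) := by
    intro k hk
    have h := isBoundedInProb_log_pVBC (hθpos k hk) (hXk k)
      (eventually_det_gram_subDesign_pos X hS hlim k) (hfix k hk) (hT k hk)
    simpa only [Fintype.card_coe] using h
  refine ⟨fun n k y θ hθ => likelihood_eq_intervalLikelihood _ y hθ,
    fun n k y w hw => latentRatio_eq_likelihood hw, ?_, ?_, hBIC, ?_⟩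
  · intro ε hε
    obtain ⟨N, hN⟩ := exists_nat_gt (4 / ε)
    filter_upwards [eventually_ge_atTop (max 4 N)] with n hn k y w hw
    have h4 : (4 : ℝ) ≤ n := by exact_mod_cast (le_max_left 4 N).trans hn
    have hNn : (N : ℝ) ≤ n := by exact_mod_cast (le_max_right 4 N).trans hn
    have ha := hw.half_le_a
    have hb := hw.b_pos
    have ha1 : 0 < w.a - 1 := by linarith
    rw [thetaHat_eq (by linarith) hb]
    refine ⟨rfl, rfl, ?_⟩
    have e : w.b / (w.a - 1) / (w.b / w.a) - 1 = 1 / (w.a - 1) := by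
      have := hw.a_pos
      field_simp
      ring
    simp only
    rw [e, abs_of_pos (by positivity), div_le_iff₀ ha1]
    have h5 : 4 < n * ε := (div_lt_iff₀ hε).1 (hN.trans_le hNn)
    nlinarith
  · refine ⟨6, ?_⟩
    filter_upwards [eventually_ge_atTop 4] with n hn k y w hw
    have h4 : (4 : ℝ) ≤ n := by exact_mod_cast hn
    have ha := hw.half_le_a
    rw [thetaHat_eq (by linarith) hw.b_pos]
    refine (abs_log_latentRatio_sub_le hw (by linarith)).trans ?_
    have : n / (w.a - 1) ≤ 4 := by rw [div_le_iff₀ (by linarith)]; linarith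
    linarith
  · -- models that contain the truth have a bounded log-likelihood ratio
    have hover : ∀ k ∈ models, kstar ⊆ k → IsBoundedInProb P fun n y =>
        Real.log (likelihood (subDesign (X n) k) y (thetaHat (v n y k))) -
          Real.log (likelihood (X n) y (αstar, βstar, σ2star)) := by
      intro k hk hsub
      have hβ : extendZero k (WithLp.toLp 2 fun j : k => βstar j) = βstar :=
        extendZero_restrict fun j hj => by
          by_contra h
          exact hj (hsub ((hsupp j).2 h))
      have hlaw : P = fun n => dataLaw (subDesign (X n) k) (θstar k) := by
        funext n
        rw [hP, dataLaw_subDesign, hθtrue k hk hsub, hβ]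
      have hTk := hT k hk
      rw [hlaw] at hTk ⊢
      have h := isBoundedInProb_log_likelihood_ratio (fun n => subDesign (X n) k) (hXk k)
        (hθpos k hk) _ hTk
      have e : ∀ (n : ℕ) (y : Fin n → ℕ), likelihood (subDesign (X n) k) y (θstar k) =
          likelihood (X n) y (αstar, βstar, σ2star) := by
        intro n y
        rw [likelihood_subDesign, hθtrue k hk hsub, hβ]
      simpa only [e] using h
    have hstar := hover kstar hkstar subset_rfl
    have hpair : ∀ k ∈ models, k ≠ kstar → Tendsto (fun n => (P n).real
        {y | VBC (subDesign (X n) k) (n : ℝ) y (v n y k) ≤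
          VBC (subDesign (X n) kstar) (n : ℝ) y (v n y kstar)}) atTop (𝓝 0) := by
      intro k hk hne
      by_cases hsub : kstar ⊆ k
      · -- overfitting: the penalty dominates
        have hW := ((hBIC k hk).add (hBIC kstar hkstar).neg).add ((hover k hk hsub).add hstar.neg)
        have ha : Tendsto (fun n : ℕ => 1 / 2 * Real.log n) atTop atTop :=
          (Real.tendsto_log_atTop.comp tendsto_natCast_atTop_atTop).const_mul_atTop (by norm_num)
        refine tendsto_measureReal_zero_of_le fun ε hε => ?_
        filter_upwards [eventually_measureReal_le (hW.tendsto_measureReal_zero ha) hε,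
          eventually_ge_atTop 1] with n hn hn1
        refine (measureReal_mono fun y hy => ?_).trans hn
        have hlog : 0 ≤ Real.log n := Real.log_nonneg (by exact_mod_cast hn1)
        have hcard : (kstar.card : ℝ) + 1 ≤ k.card := by
          exact_mod_cast Finset.card_lt_card (hsub.ssubset_of_ne hne.symm)
        simp only [Set.mem_ofPred_eq, VBC] at hy ⊢
        nlinarith
      · -- underfitting: the log-likelihood is smaller by an amount of order `n`
        obtain ⟨j₀, hj₀, hj₀k⟩ := Finset.not_subset.1 hsub
        have hTk := hT k hk
        rw [hP'] at hTk
        obtain ⟨c, hc, hdef⟩ := exists_log_likelihood_deficit X hcentered S hS hlim hB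
          (θ₀ := (αstar, βstar, σ2star)) hσ2star (hθpos k hk) hj₀k ((hsupp j₀).1 hj₀) _ hTk
        simp only [← hP] at hdef
        have hW := ((hBIC k hk).add (hBIC kstar hkstar).neg).add hstar.neg
        have ha := tendsto_mul_sub_mul_log_atTop hc (((kstar.card : ℝ) + 2) / 2)
        refine tendsto_measureReal_zero_of_le fun ε hε => ?_
        filter_upwards [eventually_measureReal_le (hW.tendsto_measureReal_zero ha)
          (half_pos hε), eventually_measureReal_le hdef (half_pos hε), eventually_ge_atTop 1]
          with n hn hn' hn1
        have hlog : 0 ≤ Real.log n := Real.log_nonneg (by exact_mod_cast hn1)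
        have hpen : 0 ≤ ((k.card : ℝ) + 2) / 2 * Real.log n := by positivity
        refine (measureReal_mono fun y hy => ?_).trans
          ((measureReal_union_le _ _).trans ((add_le_add hn hn').trans (add_halves ε).le))
        by_contra hcon
        simp only [Set.mem_union, Set.mem_ofPred_eq, not_or, not_le, VBC] at hcon hy
        linarith [hcon.1, hcon.2]
    rw [tendsto_one_iff_compl]
    have hsum : Tendsto (fun n => ∑ k ∈ models.erase kstar, (P n).real
        {y | VBC (subDesign (X n) k) (n : ℝ) y (v n y k) ≤
          VBC (subDesign (X n) kstar) (n : ℝ) y (v n y kstar)}) atTop (𝓝 0) := by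
      rw [← Finset.sum_const_zero (s := models.erase kstar)]
      exact tendsto_finsetSum _ fun k hk =>
        hpair k (Finset.mem_of_mem_erase hk) (Finset.ne_of_mem_erase hk)
    refine squeeze_zero (fun n => measureReal_nonneg) (fun n => ?_) hsum
    have hcover : {y | ∀ k ∈ models, k ≠ kstar →
          VBC (subDesign (X n) kstar) (n : ℝ) y (v n y kstar) <
            VBC (subDesign (X n) k) (n : ℝ) y (v n y k)}ᶜ ⊆
        ⋃ k ∈ models.erase kstar, {y | VBC (subDesign (X n) k) (n : ℝ) y (v n y k) ≤
          VBC (subDesign (X n) kstar) (n : ℝ) y (v n y kstar)} := by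
      intro y hy
      simp only [Set.mem_compl_iff, Set.mem_ofPred_eq, not_forall, not_lt] at hy
      obtain ⟨k, hk, hne, hle⟩ := hy
      simp only [Set.mem_iUnion]
      exact ⟨k, Finset.mem_erase.2 ⟨hne, hk⟩, hle⟩
    exact (measureReal_mono hcover (measure_ne_top _ _)).trans (measureReal_biUnion_finset_le _ _)
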